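/- Let $M$ be a smooth (Hausdorff, finite-dimensional, boundaryless) manifold and $r\ge 0$ an integer; metrics are smooth and connections are smooth affine connections. Let $T^rM$ be the manifold of $r$-jets $[\gamma]_r$ at $0$ of smooth curves $\gamma:\mathbb R\to M$, with the coordinates $x^i_\lambda$, $0\le\lambda\le r$, given by $x^i(\gamma(t))=\sum_{\lambda=0}^r x^i_\lambda t^\lambda+o(t^r)$ for local coordinates $(x^i)$ on $M$. For a function $f$ on $M$ put $f^{(\lambda)}([\gamma]_r)=\frac1{\lambda!}\frac{d^\lambda (f\circ\gamma)}{dt^\lambda}(0)$ for $0\le\lambda\le r$ and $f^{(\lambda)}=0$ for $\lambda<0$. Tensor fields are lifted by $(dx^i)^{(\lambda)}=dx^i_\lambda$, $(\partial_{x^i})^{(\lambda)}=\partial_{x^i_{r-\lambda}}$ and the rule $(K\otimes S)^{(\lambda)}=\sum_{\mu=0}^{\lambda}K^{(\mu)}\otimes S^{(\lambda-\mu)}$, where $f\otimes K=fK$ for functions $f$; in particular $(a^i\partial_{x^i})^{(\lambda)}=\sum_{\nu=0}^{r}(a^i)^{(\nu+\lambda-r)}\partial_{x^i_\nu}$, and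 this formula also defines $X^{(\lambda)}$ for every integer $\lambda\le r$ (it is $0$ for $\lambda<0$). The complete lift of a tensor field $K$ is $K^c=K^{(r)}$. The complete lift $\nabla^c$ of a connection $\nabla$ on $M$ is the connection on $T^rM$ with $$\nabla^c_{X^{(\lambda)}}Y^{(\mu)}=(\nabla_XY)^{(\lambda+\mu-r)}\qquad(0\le\lambda,\mu\le r)$$ for all smooth vector fields $X,Y$ on $M$. In coordinates, if $\Gamma^i_{jk}$ are the components of $\nabla$ (so $\nabla_{\partial_{x^j}}\partial_{x^k}=\Gamma^i_{jk}\partial_{x^i}$), then $\nabla^c_{\partial_{x^j_\alpha}}\partial_{x^k_\beta}=\sum_{\kappa=0}^{r}(\Gamma^i_{jk})^{(\kappa-\alpha-\beta)}\partial_{x^i_\kappa}$; this formula defines a smooth connection on $T^rM$, which has the above property and is the only connection that has it. For a pseudo-Riemannian metric $g$ (smooth, symmetric, nondegenerate), the dual $\nabla^*$ of $\nabla$ with respect to $g$ is the connection with $g(\nabla^*_XY,Z)=X\,g(Y,Z)-g(Y,\nabla_XZ)$. The metric (Levi-Civita) connection $\nabla^g$ is the torsion-free connection with $\nabla^g g=0$.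 A dualistic structure is a pair $(\nabla,\nabla^*)$ of dual torsion-free connections. $\nabla$ is Codazzi coupled with $g$ if the 3-tensor $\nabla g$ is symmetric. Then: 1. If $g$ is a pseudo-Riemannian metric on $M$, then $g^c$ is a pseudo-Riemannian metric on $T^rM$. 2. If $\nabla$ is a connection on $M$ with torsion $\mathrm{Tor}^\nabla$ and curvature $R^\nabla$, then $\mathrm{Tor}^{\nabla^c}=(\mathrm{Tor}^\nabla)^c$ and $R^{\nabla^c}=(R^\nabla)^c$. In particular $\nabla^c$ is torsion-free (respectively flat, i.e. of zero curvature) if $\nabla$ is. Moreover, for a pseudo-Riemannian metric $g$ on $M$, a connection $\nabla$ on $M$ and its dual $\nabla^*$ (duals on $T^rM$ being taken with respect to $g^c$): 3. $(\nabla^*)^c=(\nabla^c)^*$. 4. $(\nabla^g)^c=\nabla^{g^c}$. 5. If $\nabla$ is torsion-free and $\nabla^g=\frac12(\nabla+\nabla^*)$, then $\nabla^c$ is torsion-free and $\nabla^{g^c}=\frac12(\nabla^c+(\nabla^c)^*)$. 6. If $(\nabla,\nabla^*)$ is a dualistic structure on $(M,g)$, then $(\nabla^c,(\nabla^c)^*)$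 is a dualistic structure on $(T^rM,g^c)$. 7. If $\nabla$ is torsion-free and Codazzi coupled with $g$, then $\nabla^c$ is torsion-free and Codazzi coupled with $g^c$. -/

import Mathlib

open scoped Manifold ContDiff Topology Nat

set_option linter.unusedSectionVars false

namespace HigherLift

open Filter

/-- The `k`-th Taylor coefficient `c^(k)(0) / k!` at `0` of a curve `c` in a normed space,
with the convention that it is `0` for `k < 0`. -/
noncomputable def taylorCoeff {F : Type*} [NormedAddCommGroup F] [NormedSpace ℝ F] :
    ℤ → (ℝ → F) → F
  | .ofNat k, c => (k ! : ℝ)⁻¹ • iteratedDeriv k c 0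
  | .negSucc _, _ => 0

section Calculus
variable {V W : Type*} [NormedAddCommGroup V] [NormedSpace ℝ V]
  [NormedAddCommGroup W] [NormedSpace ℝ W]

theorem iteratedDeriv_comp_congr {n : ℕ} {F : V → W} {c₁ c₂ : ℝ → V} (h0 : c₁ 0 = c₂ 0)
    (hF : ContDiffAt ℝ ∞ F (c₁ 0)) (h₁ : ContDiffAt ℝ ∞ c₁ 0) (h₂ : ContDiffAt ℝ ∞ c₂ 0)
    (h : ∀ k ≤ n, iteratedDeriv k c₁ 0 = iteratedDeriv k c₂ 0) :
    iteratedDeriv n (F ∘ c₁) 0 = iteratedDeriv n (F ∘ c₂) 0 := by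
  have hn : (n : ℕ∞ω) ≤ ∞ := by exact_mod_cast le_top
  rw [iteratedDeriv_vcomp_eq_sum_orderedFinpartition (hF.of_le hn) (h₁.of_le hn) le_rfl,
    iteratedDeriv_vcomp_eq_sum_orderedFinpartition ((h0 ▸ hF).of_le hn) (h₂.of_le hn) le_rfl, h0]
  refine Finset.sum_congr rfl fun c _ => ?_
  congr 1
  funext m
  exact h _ (c.partSize_le m)

theorem contDiffOn_iteratedDeriv_param {G : ℝ × V → W} {Ω : Set (ℝ × V)} (hΩ : IsOpen Ω)
    (hG : ContDiffOn ℝ ∞ G Ω) (k : ℕ) :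
    ContDiffOn ℝ ∞ (fun p : ℝ × V => iteratedDeriv k (fun t => G (t, p.2)) p.1) Ω := by
  induction k with
  | zero => simpa [iteratedDeriv_zero] using hG
  | succ k ih =>
    have h1 : ContDiffOn ℝ ∞ (fun p : ℝ × V =>
        fderiv ℝ (fun p : ℝ × V => iteratedDeriv k (fun t => G (t, p.2)) p.1) p (1, 0)) Ω :=
      (ih.fderiv_of_isOpen hΩ (by simp)).clm_apply contDiffOn_const
    refine h1.congr fun p hp => ?_
    have h2 := ((ih.contDiffAt (hΩ.mem_nhds hp)).differentiableAt (by simp)).hasFDerivAt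
    have h3 : HasDerivAt (fun t : ℝ => (t, p.2)) (1, 0) p.1 :=
      (hasDerivAt_id _).prodMk (hasDerivAt_const _ _)
    rw [iteratedDeriv_succ]
    exact (HasFDerivAt.comp_hasDerivAt p.1 (f := fun t : ℝ => (t, p.2)) h2 h3).deriv

theorem iteratedDeriv_poly_zero {r : ℕ} (v : Fin (r + 1) → V) (k : Fin (r + 1)) :
    iteratedDeriv (k : ℕ) (fun t : ℝ => ∑ i : Fin (r + 1), t ^ (i : ℕ) • v i) 0 = ((k : ℕ)! : ℝ) • v k := by
  rw [iteratedDeriv_fun_sum fun i _ => by fun_prop]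
  rw [Finset.sum_eq_single k]
  · rw [iteratedDeriv_smul_const (by fun_prop), iteratedDeriv_fun_pow_zero]; simp
  · intro i _ hi
    rw [iteratedDeriv_smul_const (by fun_prop), iteratedDeriv_fun_pow_zero, if_neg, Nat.cast_zero,
      zero_smul]
    exact fun h => hi (Fin.ext h.symm)
  · simp

theorem poly_zero {r : ℕ} (v : Fin (r + 1) → V) :
    ∑ i : Fin (r + 1), (0 : ℝ) ^ (i : ℕ) • v i = v 0 := by
  rw [Finset.sum_eq_single 0]
  · simp
  · intro i _ hi
    rw [zero_pow (fun h => hi (Fin.ext h)), zero_smul]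
  · simp

theorem taylorCoeff_poly {r : ℕ} {c : ℝ → V} {v : Fin (r + 1) → V}
    (h : c =ᶠ[𝓝 0] fun t => ∑ i : Fin (r + 1), t ^ (i : ℕ) • v i) (k : Fin (r + 1)) :
    taylorCoeff (k : ℕ) c = v k := by
  change _ • _ = _
  rw [h.iteratedDeriv_eq, iteratedDeriv_poly_zero, inv_smul_smul₀]
  exact_mod_cast (Nat.factorial_pos _).ne'

theorem clm_iteratedDeriv (l : V →L[ℝ] W) {c : ℝ → V} (hc : ContDiffAt ℝ ∞ c 0) (n : ℕ) :
    iteratedDeriv n (fun t => l (c t)) 0 = l (iteratedDeriv n c 0) := by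
  have hn : (n : ℕ∞ω) ≤ ∞ := by exact_mod_cast le_top
  have h := l.iteratedFDeriv_comp_left (hc.of_le hn) le_rfl
  simp only [iteratedDeriv]
  change iteratedFDeriv ℝ n (l ∘ c) 0 _ = _
  rw [h]; rfl

end Calculus

section Jets

open Manifold

variable {E : Type*} [NormedAddCommGroup E] [NormedSpace ℝ E]
  {M : Type*} [TopologicalSpace M] [ChartedSpace E M]

variable (E M) in
/-- Smooth curves `ℝ → M`. -/
abbrev Curve : Type _ := C^∞⟮𝓘(ℝ, ℝ), ℝ; 𝓘(ℝ, E), M⟯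

variable (E M) in
/-- Two smooth curves have the same `r`-jet at `0` if, for all smooth functions `f` on `M`, the
derivatives at `0` of `f ∘ γ₁` and `f ∘ γ₂` of order at most `r` agree. -/
def jetSetoid (r : ℕ) : Setoid (Curve E M) where
  r γ₁ γ₂ := ∀ f : M → ℝ, ContMDiff 𝓘(ℝ, E) 𝓘(ℝ, ℝ) ∞ f →
    ∀ k ≤ r, iteratedDeriv k (f ∘ γ₁) 0 = iteratedDeriv k (f ∘ γ₂) 0
  iseqv := ⟨fun _ _ _ _ _ => rfl, fun h f hf k hk => (h f hf k hk).symm,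
    fun h h' f hf k hk => (h f hf k hk).trans (h' f hf k hk)⟩

variable (E M) in
/-- The higher tangent bundle `T^r M`: the set of `r`-jets at `0` of smooth curves `ℝ → M`. -/
def JetBundle (r : ℕ) : Type _ := Quotient (jetSetoid E M r)

/-- A smooth curve representing a given jet. -/
noncomputable def JetBundle.rep {r : ℕ} (j : JetBundle E M r) : Curve E M := Quotient.out j

/-- The `r`-jet of a curve. -/
def JetBundle.mk (r : ℕ) (γ : Curve E M) : JetBundle E M r := Quotient.mk (jetSetoid E M r) γ

/-- The projection `T^r M → M`. -/
noncomputable def JetBundle.proj {r : ℕ} (j : JetBundle E M r) : M := j.rep 0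

theorem JetBundle.mk_rep {r : ℕ} (j : JetBundle E M r) : JetBundle.mk r j.rep = j :=
  Quotient.out_eq j

theorem JetBundle.mk_eq_mk {r : ℕ} {γ₁ γ₂ : Curve E M} :
    JetBundle.mk r γ₁ = JetBundle.mk r γ₂ ↔ (jetSetoid E M r).r γ₁ γ₂ := Quotient.eq

theorem Curve.continuous (γ : Curve E M) : Continuous γ := γ.contMDiff.continuous

theorem comp_eventuallyEq {X : Type*} {e : OpenPartialHomeomorph M E} {γ : Curve E M}
    (h : γ 0 ∈ e.source) (f : M → X) : f ∘ γ =ᶠ[𝓝 0] (f ∘ e.symm) ∘ (e ∘ γ) := by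
  filter_upwards [γ.continuous.continuousAt.preimage_mem_nhds (e.open_source.mem_nhds h)] with t ht
  simp [e.left_inv ht]

variable [IsManifold 𝓘(ℝ, E) ∞ M]

theorem contDiffAt_chart_comp {e : OpenPartialHomeomorph M E} (he : e ∈ atlas E M)
    {γ : Curve E M} (h : γ 0 ∈ e.source) : ContDiffAt ℝ ∞ (e ∘ γ) 0 :=
  contMDiffAt_iff_contDiffAt.1 <|
    (contMDiffAt_of_mem_maximalAtlas (IsManifold.subset_maximalAtlas he) h).comp 0
      γ.contMDiff.contMDiffAt

theorem contDiffAt_transition {e e' : OpenPartialHomeomorph M E} (he : e ∈ atlas E M)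
    (he' : e' ∈ atlas E M) {x : M} (h : x ∈ e.source) (h' : x ∈ e'.source) :
    ContDiffAt ℝ ∞ (e' ∘ e.symm) (e x) := by
  refine contMDiffAt_iff_contDiffAt.1 (ContMDiffAt.comp (I' := 𝓘(ℝ, E)) _ ?_ ?_)
  · rw [e.left_inv h]
    exact contMDiffAt_of_mem_maximalAtlas (IsManifold.subset_maximalAtlas he') h'
  · exact contMDiffAt_symm_of_mem_maximalAtlas (IsManifold.subset_maximalAtlas he)
      (e.map_source h)

theorem jet_change {e e' : OpenPartialHomeomorph M E} (he : e ∈ atlas E M)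
    (he' : e' ∈ atlas E M) {γ₁ γ₂ : Curve E M} (h0 : γ₁ 0 = γ₂ 0) (h : γ₁ 0 ∈ e.source)
    (h' : γ₁ 0 ∈ e'.source) {n : ℕ}
    (H : ∀ k ≤ n, iteratedDeriv k (e ∘ γ₁) 0 = iteratedDeriv k (e ∘ γ₂) 0) :
    ∀ k ≤ n, iteratedDeriv k (e' ∘ γ₁) 0 = iteratedDeriv k (e' ∘ γ₂) 0 := by
  intro k hk
  rw [(comp_eventuallyEq h e').iteratedDeriv_eq k,
    (comp_eventuallyEq (h0 ▸ h) e').iteratedDeriv_eq k]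
  exact iteratedDeriv_comp_congr (by simp [h0]) (contDiffAt_transition he he' h h')
    (contDiffAt_chart_comp he h) (contDiffAt_chart_comp he (h0 ▸ h))
    fun l hl => H l (hl.trans hk)

theorem exists_curve {r : ℕ} {e : OpenPartialHomeomorph M E} (he : e ∈ atlas E M)
    {v : Fin (r + 1) → E} (hv : v 0 ∈ e.target) :
    ∃ γ : Curve E M, ∀ᶠ t in 𝓝 (0 : ℝ), γ t = e.symm (∑ i : Fin (r + 1), t ^ (i : ℕ) • v i) := by
  set p : ℝ → E := fun t => ∑ i : Fin (r + 1), t ^ (i : ℕ) • v i with hp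
  have hpd : ContDiff ℝ ∞ p := by fun_prop
  have hp0 : p 0 = v 0 := poly_zero v
  obtain ⟨δ, hδ, hδt⟩ := Metric.mem_nhds_iff.1
    (hpd.continuous.continuousAt.preimage_mem_nhds (e.open_target.mem_nhds (hp0 ▸ hv)))
  let b : ContDiffBump (0 : ℝ) := ⟨δ / 4, δ / 2, by positivity, by linarith⟩
  have hb : ContDiff ℝ ∞ fun t => b t * t := b.contDiff.mul contDiff_id
  have hmem : ∀ t, p (b t * t) ∈ e.target := by
    intro t
    refine hδt ?_
    rw [Metric.mem_ball, dist_zero_right, norm_mul, Real.norm_of_nonneg b.nonneg]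
    by_cases h : dist t 0 < δ / 2
    · rw [dist_zero_right] at h
      nlinarith [b.le_one (x := t), norm_nonneg t, b.nonneg (x := t)]
    · rw [b.zero_of_le_dist (not_lt.1 h)]; simpa using hδ
  refine ⟨⟨fun t => e.symm (p (b t * t)), fun t => ?_⟩, ?_⟩
  · exact (contMDiffAt_symm_of_mem_maximalAtlas (IsManifold.subset_maximalAtlas he)
      (hmem t)).comp (I' := 𝓘(ℝ, E)) t (hpd.comp hb).contMDiff.contMDiffAt
  · filter_upwards [b.eventuallyEq_one] with t ht
    change e.symm (p (b t * t)) = _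
    simp [ht, hp]

/-- The coordinates `xⁱ_k` on `T^r M` induced by a chart `(xⁱ)` of `M`: Taylor coefficients of the
curve read in the chart, `xⁱ(γ(t)) = xⁱ_0 + xⁱ_1 t + ⋯ + xⁱ_r t^r + o(t^r)`. -/
noncomputable def JetBundle.coord {r : ℕ} (e : OpenPartialHomeomorph M E) (j : JetBundle E M r) :
    Fin (r + 1) → E :=
  fun k => taylorCoeff (k : ℕ) (e ∘ j.rep)

open Classical in
/-- The jet with given coordinates: the jet of any smooth curve which near `0` is the polynomial
curve with the given coefficients, read in the chart (the value is irrelevant if there is none). -/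
noncomputable def JetBundle.ofCoord {r : ℕ} (e : OpenPartialHomeomorph M E) (v : Fin (r + 1) → E) :
    JetBundle E M r :=
  if h : ∃ γ : Curve E M, ∀ᶠ t in 𝓝 (0 : ℝ), γ t = e.symm (∑ i : Fin (r + 1), t ^ (i : ℕ) • v i)
  then JetBundle.mk r h.choose
  else JetBundle.mk r ⟨fun _ => e.symm (v 0), contMDiff_const⟩

variable [FiniteDimensional ℝ E] [T2Space M]

theorem base_eq {r : ℕ} {γ₁ γ₂ : Curve E M} (h : (jetSetoid E M r).r γ₁ γ₂) : γ₁ 0 = γ₂ 0 := by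
  by_contra hne
  obtain ⟨f, hf, -⟩ := (SmoothBumpFunction.nhds_basis_support (I := 𝓘(ℝ, E))
    (isOpen_compl_singleton.mem_nhds (show γ₁ 0 ∈ ({γ₂ 0}ᶜ : Set M) from hne))).mem_iff.1
      (Filter.univ_mem)
  have h1 := h f f.contMDiff 0 (Nat.zero_le _)
  simp only [iteratedDeriv_zero, Function.comp_apply, f.eq_one] at h1
  have h2 : γ₂ 0 ∈ tsupport f := subset_tsupport _ (by simp [← h1])
  exact hf h2 rfl

theorem jet_iff {r : ℕ} {e : OpenPartialHomeomorph M E} (he : e ∈ atlas E M) {γ₁ γ₂ : Curve E M}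
    (h₁ : γ₁ 0 ∈ e.source) (h₂ : γ₂ 0 ∈ e.source) :
    (jetSetoid E M r).r γ₁ γ₂ ↔
      ∀ k ≤ r, iteratedDeriv k (e ∘ γ₁) 0 = iteratedDeriv k (e ∘ γ₂) 0 := by
  constructor
  · intro h
    have h0 := base_eq h
    set c := γ₁ 0 with hc
    have hcs : c ∈ (chartAt E c).source := mem_chart_source E c
    refine jet_change (chart_mem_atlas E c) he h0 hcs h₁ fun k hk => ?_
    obtain ⟨b⟩ : Nonempty (SmoothBumpFunction 𝓘(ℝ, E) c) := inferInstance
    rw [SeparatingDual.eq_iff_forall_dual_eq (R := ℝ)]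
    intro l
    have hd₁ := contDiffAt_chart_comp (chart_mem_atlas E c) (γ := γ₁) hcs
    have hd₂ := contDiffAt_chart_comp (chart_mem_atlas E c) (γ := γ₂) (h0 ▸ hcs)
    rw [← clm_iteratedDeriv l hd₁, ← clm_iteratedDeriv l hd₂]
    have hsm : ContMDiff 𝓘(ℝ, E) 𝓘(ℝ, ℝ) ∞ fun x => b x • l (chartAt E c x) :=
      b.contMDiff_smul (l.contDiff.contMDiff.comp_contMDiffOn contMDiffOn_chart)
    have key := h _ hsm k hk
    have hev : ∀ γ : Curve E M, γ 0 = c →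
        ((fun x => b x • l (chartAt E c x)) ∘ γ) =ᶠ[𝓝 0] fun t => l ((chartAt E c ∘ γ) t) := by
      intro γ hγ
      have hb := b.eventuallyEq_one
      have hγc : Tendsto γ (𝓝 0) (𝓝 c) := by
        rw [← hγ]; exact γ.continuous.continuousAt
      filter_upwards [hγc.eventually hb] with t ht
      simp [ht]
    rwa [(hev γ₁ rfl).iteratedDeriv_eq k, (hev γ₂ h0.symm).iteratedDeriv_eq k] at key
  · intro H f hf k hk
    have h0 : γ₁ 0 = γ₂ 0 := by
      have := H 0 (Nat.zero_le _)
      simp only [iteratedDeriv_zero, Function.comp_apply] at this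
      exact e.injOn h₁ h₂ this
    rw [(comp_eventuallyEq h₁ f).iteratedDeriv_eq k, (comp_eventuallyEq h₂ f).iteratedDeriv_eq k]
    refine iteratedDeriv_comp_congr (by simp [h0]) ?_ (contDiffAt_chart_comp he h₁)
      (contDiffAt_chart_comp he h₂) fun l hl => H l (hl.trans hk)
    exact contMDiffAt_iff_contDiffAt.1 (hf.contMDiffAt.comp (I' := 𝓘(ℝ, E)) _
      (contMDiffAt_symm_of_mem_maximalAtlas (IsManifold.subset_maximalAtlas he)
        (e.map_source h₁)))


theorem JetBundle.proj_mk {r : ℕ} (γ : Curve E M) : (JetBundle.mk r γ).proj = γ 0 :=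
  base_eq (JetBundle.mk_eq_mk.1 (JetBundle.mk_rep (JetBundle.mk r γ)))

theorem JetBundle.coord_mk {r : ℕ} {e : OpenPartialHomeomorph M E} (he : e ∈ atlas E M)
    {γ : Curve E M} (h : γ 0 ∈ e.source) (k : Fin (r + 1)) :
    (JetBundle.mk r γ).coord e k = taylorCoeff (k : ℕ) (e ∘ γ) := by
  have h1 := JetBundle.mk_eq_mk.1 (JetBundle.mk_rep (JetBundle.mk r γ))
  have h2 := (jet_iff he (base_eq h1 ▸ h) h).1 h1 k (Nat.lt_succ_iff.1 k.2)
  simp only [JetBundle.coord]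
  change _ • _ = _ • _
  rw [h2]

theorem JetBundle.ofCoord_spec {r : ℕ} {e : OpenPartialHomeomorph M E} (he : e ∈ atlas E M)
    {v : Fin (r + 1) → E} (hv : v 0 ∈ e.target) :
    ∃ γ : Curve E M, JetBundle.ofCoord e v = JetBundle.mk r γ ∧ γ 0 = e.symm (v 0) ∧
      γ 0 ∈ e.source ∧ (e ∘ γ) =ᶠ[𝓝 0] fun t => ∑ i : Fin (r + 1), t ^ (i : ℕ) • v i := by
  have h := exists_curve he hv
  have h0 : h.choose 0 = e.symm (v 0) := by
    rw [h.choose_spec.self_of_nhds, poly_zero]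
  have hs : h.choose 0 ∈ e.source := h0 ▸ e.map_target hv
  refine ⟨h.choose, by rw [JetBundle.ofCoord, dif_pos h], h0, hs, ?_⟩
  have hpc : ContinuousAt (fun t : ℝ => ∑ i : Fin (r + 1), t ^ (i : ℕ) • v i) 0 := by fun_prop
  have hp0 : (∑ i : Fin (r + 1), (0 : ℝ) ^ (i : ℕ) • v i) ∈ e.target := by
    rwa [poly_zero]
  filter_upwards [h.choose_spec, hpc.preimage_mem_nhds (e.open_target.mem_nhds hp0)] with t ht ht'
  rw [Function.comp_apply, ht, e.right_inv ht']

theorem JetBundle.coord_zero {r : ℕ} (e : OpenPartialHomeomorph M E) (j : JetBundle E M r) :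
    j.coord e 0 = e j.proj := by
  simp [JetBundle.coord, JetBundle.proj, taylorCoeff]

/-- The chart of `T^r M` induced by a chart of `M`. -/
noncomputable def JetBundle.chart (r : ℕ) (e : OpenPartialHomeomorph M E) (he : e ∈ atlas E M) :
    PartialEquiv (JetBundle E M r) (Fin (r + 1) → E) where
  toFun := JetBundle.coord e
  invFun := JetBundle.ofCoord e
  source := {j | j.proj ∈ e.source}
  target := {v | v 0 ∈ e.target}
  map_source' j hj := by
    rw [Set.mem_ofPred_eq, JetBundle.coord_zero]; exact e.map_source hj
  map_target' v hv := by
    obtain ⟨γ, h1, h2, h3, h4⟩ := JetBundle.ofCoord_spec he hv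
    rw [Set.mem_ofPred_eq, h1, JetBundle.proj_mk]; exact h3
  left_inv' j hj := by
    have hv : j.coord e 0 ∈ e.target := by rw [JetBundle.coord_zero]; exact e.map_source hj
    obtain ⟨γ, h1, h2, h3, h4⟩ := JetBundle.ofCoord_spec he hv
    rw [h1]
    conv_rhs => rw [← j.mk_rep]
    rw [JetBundle.mk_eq_mk, jet_iff he h3 hj]
    intro k hk
    have h5 := taylorCoeff_poly h4 ⟨k, Nat.lt_succ_iff.2 hk⟩
    change (k ! : ℝ)⁻¹ • _ = (k ! : ℝ)⁻¹ • _ at h5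
    exact smul_right_injective E (inv_ne_zero (by exact_mod_cast (Nat.factorial_pos k).ne')) h5
  right_inv' v hv := by
    obtain ⟨γ, h1, h2, h3, h4⟩ := JetBundle.ofCoord_spec he hv
    funext k
    rw [h1, JetBundle.coord_mk he h3, taylorCoeff_poly h4]

theorem JetBundle.chart_trans_source {r : ℕ} {e e' : OpenPartialHomeomorph M E}
    (he : e ∈ atlas E M) (he' : e' ∈ atlas E M) :
    ((JetBundle.chart r e he).symm.trans (JetBundle.chart r e' he')).source =
      {v | v 0 ∈ (e.symm.trans e').source} := by
  ext v
  simp only [PartialEquiv.trans_source, PartialEquiv.symm_source, Set.mem_inter_iff,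
    Set.mem_preimage, Set.mem_ofPred_eq, OpenPartialHomeomorph.trans_source,
    OpenPartialHomeomorph.symm_source]
  refine and_congr_right fun hv => ?_
  obtain ⟨γ, h1, h2, h3, h4⟩ := JetBundle.ofCoord_spec he hv
  change (JetBundle.ofCoord e v).proj ∈ e'.source ↔ _
  rw [h1, JetBundle.proj_mk, h2]

theorem JetBundle.isOpen_trans_source {r : ℕ} {e e' : OpenPartialHomeomorph M E}
    (he : e ∈ atlas E M) (he' : e' ∈ atlas E M) :
    IsOpen ((JetBundle.chart r e he).symm.trans (JetBundle.chart r e' he')).source := by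
  rw [JetBundle.chart_trans_source]
  exact (e.symm.trans e').open_source.preimage (continuous_apply 0)

theorem JetBundle.contDiffOn_trans {r : ℕ} {e e' : OpenPartialHomeomorph M E}
    (he : e ∈ atlas E M) (he' : e' ∈ atlas E M) :
    ContDiffOn ℝ ∞ ((JetBundle.chart r e he).symm.trans (JetBundle.chart r e' he'))
      ((JetBundle.chart r e he).symm.trans (JetBundle.chart r e' he')).source := by
  rw [JetBundle.chart_trans_source]
  set P : ℝ × (Fin (r + 1) → E) → E := fun q => ∑ i : Fin (r + 1), q.1 ^ (i : ℕ) • q.2 i with hP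
  have hPd : ContDiff ℝ ∞ P := by fun_prop
  set Ω : Set (ℝ × (Fin (r + 1) → E)) := P ⁻¹' (e.symm.trans e').source with hΩ
  have hΩo : IsOpen Ω := (e.symm.trans e').open_source.preimage hPd.continuous
  have hG : ContDiffOn ℝ ∞ ((e' ∘ e.symm) ∘ P) Ω := by
    intro q hq
    have hq' : P q ∈ (e.symm.trans e').source := hq
    rw [OpenPartialHomeomorph.trans_source] at hq'
    have := contDiffAt_transition he he' (e.map_target hq'.1) hq'.2
    rw [e.right_inv hq'.1] at this
    exact (this.comp q hPd.contDiffAt).contDiffWithinAt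
  have hP0 : ∀ v : Fin (r + 1) → E, P (0, v) = v 0 := poly_zero
  refine contDiffOn_pi.2 fun k => ?_
  have h1 := contDiffOn_iteratedDeriv_param hΩo hG k
  have h2 : ContDiffOn ℝ ∞ (fun v : Fin (r + 1) → E => ((k : ℕ)! : ℝ)⁻¹ •
      iteratedDeriv k (fun t => ((e' ∘ e.symm) ∘ P) (t, v)) 0)
      {v | v 0 ∈ (e.symm.trans e').source} := by
    refine ContDiffOn.const_smul _ (h1.comp (f := fun v : Fin (r + 1) → E => ((0 : ℝ), v))
      (by fun_prop) fun v hv => ?_)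
    change P (0, v) ∈ (e.symm.trans e').source
    rw [hP0]; exact hv
  refine h2.congr fun v hv => ?_
  have hv' : v 0 ∈ (e.symm.trans e').source := hv
  rw [OpenPartialHomeomorph.trans_source] at hv'
  obtain ⟨γ, g1, g2, g3, g4⟩ := JetBundle.ofCoord_spec he hv'.1
  change (JetBundle.ofCoord e v).coord e' k = _
  rw [g1, JetBundle.coord_mk he' (g2 ▸ hv'.2)]
  change _ • _ = _
  rw [(comp_eventuallyEq g3 e').iteratedDeriv_eq]
  congr 1
  refine Filter.EventuallyEq.iteratedDeriv_eq _ ?_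
  filter_upwards [g4] with t ht
  simp only [Function.comp_apply] at ht ⊢
  rw [ht]

variable (E M) in
/-- The atlas of `T^r M` induced by the atlas of `M`. -/
noncomputable def JetBundle.core (r : ℕ) : ChartedSpaceCore (Fin (r + 1) → E) (JetBundle E M r) where
  atlas := {c | ∃ (e : OpenPartialHomeomorph M E) (he : e ∈ atlas E M), c = JetBundle.chart r e he}
  chartAt j := JetBundle.chart r (chartAt E j.proj) (chart_mem_atlas E j.proj)
  mem_chart_source j := mem_chart_source E j.proj
  chart_mem_atlas j := ⟨_, _, rfl⟩
  open_source := by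
    rintro _ _ ⟨e, he, rfl⟩ ⟨e', he', rfl⟩
    exact JetBundle.isOpen_trans_source he he'
  continuousOn_toFun := by
    rintro _ _ ⟨e, he, rfl⟩ ⟨e', he', rfl⟩
    exact (JetBundle.contDiffOn_trans he he').continuousOn

noncomputable instance (r : ℕ) : TopologicalSpace (JetBundle E M r) :=
  (JetBundle.core E M r).toTopologicalSpace

noncomputable instance (r : ℕ) : ChartedSpace (Fin (r + 1) → E) (JetBundle E M r) :=
  (JetBundle.core E M r).toChartedSpace

instance (r : ℕ) : IsManifold 𝓘(ℝ, Fin (r + 1) → E) ∞ (JetBundle E M r) := by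
  refine isManifold_of_contDiffOn _ _ _ fun c c' hc hc' => ?_
  change c ∈ ⋃ (e : PartialEquiv _ _) (he : e ∈ (JetBundle.core E M r).atlas), _ at hc
  change c' ∈ ⋃ (e : PartialEquiv _ _) (he : e ∈ (JetBundle.core E M r).atlas), _ at hc'
  simp only [Set.mem_iUnion, Set.mem_singleton_iff] at hc hc'
  obtain ⟨_, ⟨e, he, rfl⟩, rfl⟩ := hc
  obtain ⟨_, ⟨e', he', rfl⟩, rfl⟩ := hc'
  have := JetBundle.contDiffOn_trans (r := r) he he'
  simp only [modelWithCornersSelf_coe, modelWithCornersSelf_coe_symm, Function.id_comp,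
    Function.comp_id, Set.preimage_id, Set.range_id, Set.inter_univ]
  exact this

end Jets

section Geometry

variable (F : Type*) [NormedAddCommGroup F] [NormedSpace ℝ F]
  (N : Type*) [TopologicalSpace N] [ChartedSpace F N] [IsManifold 𝓘(ℝ, F) ∞ N]

/-- Vector fields on `N` (as bare sections of the tangent bundle, without regularity). -/
abbrev VField : Type _ := Π x : N, TangentSpace 𝓘(ℝ, F) x

/-- Affine connections on `N`: covariant derivatives on the tangent bundle.
`D Y x (X x)` is `(∇_X Y)(x)`. -/
abbrev AffineConnection : Type _ :=
  CovariantDerivative 𝓘(ℝ, F) F (TangentSpace 𝓘(ℝ, F) : N → Type _)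

/-- Fields of bilinear forms on the tangent spaces of `N`. -/
abbrev BilinField : Type _ :=
  Π x : N, TangentSpace 𝓘(ℝ, F) x →L[ℝ] TangentSpace 𝓘(ℝ, F) x →L[ℝ] ℝ

variable {F N}

/-- The vector field `Y` is differentiable at the point `x`. -/
def DiffFieldAt (Y : VField F N) (x : N) : Prop :=
  MDifferentiableAt 𝓘(ℝ, F) (𝓘(ℝ, F).prod 𝓘(ℝ, F))
    (fun y => (⟨y, Y y⟩ : TangentBundle 𝓘(ℝ, F) N)) x

/-- The vector field `Y` is smooth. -/
def SmoothField (Y : VField F N) : Prop :=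
  ContMDiff 𝓘(ℝ, F) (𝓘(ℝ, F).prod 𝓘(ℝ, F)) ∞ (fun y => (⟨y, Y y⟩ : TangentBundle 𝓘(ℝ, F) N))

/-- Equality of two connections, as operators on (differentiable) vector fields.  A bundled
covariant derivative also has meaningless values on non-differentiable fields, ignored here. -/
def ConnEq (D D' : AffineConnection F N) : Prop :=
  ∀ (x : N) (Y : VField F N), DiffFieldAt Y x → D Y x = D' Y x

/-- A pseudo-Riemannian metric: a smooth field of symmetric nondegenerate bilinear forms. -/
structure IsPseudoRiemannian (g : BilinField F N) : Prop where
  smooth : ContMDiff 𝓘(ℝ, F) (𝓘(ℝ, F).prod 𝓘(ℝ, F →L[ℝ] F →L[ℝ] ℝ)) ∞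
    (fun x => Bundle.TotalSpace.mk' (F →L[ℝ] F →L[ℝ] ℝ)
      (E := fun x : N => TangentSpace 𝓘(ℝ, F) x →L[ℝ] TangentSpace 𝓘(ℝ, F) x →L[ℝ] ℝ) x (g x))
  symm : ∀ (x : N) (v w : TangentSpace 𝓘(ℝ, F) x), g x v w = g x w v
  nondegenerate : ∀ (x : N) (v : TangentSpace 𝓘(ℝ, F) x), (∀ w, g x v w = 0) → v = 0

/-- The derivative `v (g(Y, Z))` of the function `g(Y, Z)` along the tangent vector `v`. -/
noncomputable def derivMetric (g : BilinField F N) (x : N) (v : TangentSpace 𝓘(ℝ, F) x)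
    (Y Z : VField F N) : ℝ :=
  mvfderiv 𝓘(ℝ, F) (fun y => g y (Y y) (Z y)) x v

/-- `D'` is the connection dual to `D` with respect to `g`:
`g(D'_X Y, Z) = X g(Y, Z) - g(Y, D_X Z)`. -/
def IsDualConnection (g : BilinField F N) (D D' : AffineConnection F N) : Prop :=
  ∀ (x : N) (v : TangentSpace 𝓘(ℝ, F) x) (Y Z : VField F N), DiffFieldAt Y x → DiffFieldAt Z x →
    g x (D' Y x v) (Z x) = derivMetric g x v Y Z - g x (Y x) (D Z x v)

/-- The covariant derivative of `g`:
`(D_v g)(Y, Z) = v (g(Y, Z)) - g(D_v Y, Z) - g(Y, D_v Z)` at `x`. -/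
noncomputable def nablaMetric (g : BilinField F N) (D : AffineConnection F N) (x : N)
    (v : TangentSpace 𝓘(ℝ, F) x) (Y Z : VField F N) : ℝ :=
  derivMetric g x v Y Z - g x (D Y x v) (Z x) - g x (Y x) (D Z x v)

/-- `D` is Codazzi coupled with `g`: the covariant 3-tensor `D g` is symmetric, i.e. invariant
under two transpositions of its arguments which generate all permutations. -/
def IsCodazziCoupled (g : BilinField F N) (D : AffineConnection F N) : Prop :=
  ∀ (x : N) (X Y Z : VField F N), DiffFieldAt X x → DiffFieldAt Y x → DiffFieldAt Z x →
    nablaMetric g D x (X x) Y Z = nablaMetric g D x (Y x) X Z ∧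
      nablaMetric g D x (X x) Y Z = nablaMetric g D x (X x) Z Y

/-- The curvature operator on vector fields:
`R(X, Y) Z = D_X D_Y Z - D_Y D_X Z - D_[X, Y] Z`. -/
noncomputable def curvatureField (D : AffineConnection F N) (X Y Z : VField F N) : VField F N :=
  fun x => D (fun y => D Z y (Y y)) x (X x) - D (fun y => D Z y (X y)) x (Y x)
    - D Z x (VectorField.mlieBracket 𝓘(ℝ, F) X Y x)

/-- The curvature tensor `R(u, v) w` at the point `x`: the curvature operator evaluated on
extensions of `u`, `v`, `w` to vector fields which are smooth near `x`. -/
noncomputable def curvature (D : AffineConnection F N) (x : N) (u v w : TangentSpace 𝓘(ℝ, F) x) :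
    TangentSpace 𝓘(ℝ, F) x :=
  curvatureField D (FiberBundle.extend F u) (FiberBundle.extend F v) (FiberBundle.extend F w) x

variable [FiniteDimensional ℝ F] [CompleteSpace F]

/-- `D` is the metric (Levi-Civita) connection of `g`: it is torsion-free and `D g = 0`. -/
def IsLeviCivita (g : BilinField F N) (D : AffineConnection F N) : Prop :=
  D.torsion = 0 ∧ ∀ (x : N) (v : TangentSpace 𝓘(ℝ, F) x) (Y Z : VField F N),
    DiffFieldAt Y x → DiffFieldAt Z x → nablaMetric g D x v Y Z = 0

/-- `(D, D')` is a dualistic structure for `g`: a pair of dual torsion-free connections. -/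
def IsDualistic (g : BilinField F N) (D D' : AffineConnection F N) : Prop :=
  IsDualConnection g D D' ∧ D.torsion = 0 ∧ D'.torsion = 0

end Geometry

section Coordinates

variable {F : Type*} [NormedAddCommGroup F] [NormedSpace ℝ F]
  {N : Type*} [TopologicalSpace N] [ChartedSpace F N] [IsManifold 𝓘(ℝ, F) ∞ N]

/-- Components of a tangent vector at `y` in the preferred chart around `x`
(zero if `y` is outside the domain of that chart). -/
noncomputable def tangentCoord (x y : N) : TangentSpace 𝓘(ℝ, F) y →L[ℝ] F :=
  (trivializationAt F (TangentSpace 𝓘(ℝ, F)) x).continuousLinearMapAt ℝ y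

/-- The tangent vector at `y` with given components in the preferred chart around `x`
(zero if `y` is outside the domain of that chart).  For fixed `x` and `u`, the map
`y ↦ coordVector x y u` is the coordinate vector field `uⁱ ∂/∂xⁱ`. -/
noncomputable def coordVector (x y : N) : F →L[ℝ] TangentSpace 𝓘(ℝ, F) y :=
  (trivializationAt F (TangentSpace 𝓘(ℝ, F)) x).symmL ℝ y

/-- The component matrix `g_{ij}(y)` of `g` in the preferred chart around `x`. -/
noncomputable def localMetric (g : BilinField F N) (x y : N) : F →L[ℝ] F →L[ℝ] ℝ :=
  (ContinuousLinearMap.precomp ℝ (coordVector x y)) ∘L (g y) ∘L (coordVector x y)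

theorem diffFieldAt_coordVector {x y : N}
    (hy : y ∈ (trivializationAt F (TangentSpace 𝓘(ℝ, F)) x).baseSet) (v : F) :
    DiffFieldAt (fun y => coordVector x y v) y := by
  refine ((trivializationAt F (TangentSpace 𝓘(ℝ, F)) x).mdifferentiableAt_section_iff 𝓘(ℝ, F)
    (fun y => coordVector x y v) hy).2 ?_
  refine (mdifferentiableAt_const (c := v)).congr_of_eventuallyEq ?_
  filter_upwards [(trivializationAt F (TangentSpace 𝓘(ℝ, F)) x).open_baseSet.mem_nhds hy]
    with z hz
  change (trivializationAt F (TangentSpace 𝓘(ℝ, F)) x ⟨z, coordVector x z v⟩).2 = v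
  rw [coordVector, Bundle.Trivialization.symmL_apply _ hz,
    Bundle.Trivialization.apply_mk_symm _ hz]

variable [FiniteDimensional ℝ F]

/-- The connection components `Γ(y)(v)(u)` of `D` in the preferred chart around `x`: the components
at `y` of `D_{∂_u} ∂_v`, where `∂_u = uⁱ ∂/∂xⁱ` and `∂_v = vⁱ ∂/∂xⁱ`. -/
noncomputable def connComponents (D : AffineConnection F N) (x y : N) : F →L[ℝ] F →L[ℝ] F :=
  LinearMap.toContinuousLinearMap
    { toFun := fun v => tangentCoord x y ∘L D (fun z => coordVector x z v) y ∘L coordVector x y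
      map_add' := fun v w => by
        by_cases hy : y ∈ (trivializationAt F (TangentSpace 𝓘(ℝ, F)) x).baseSet
        · have h : (fun z : N => coordVector x z (v + w)) =
              (fun z => coordVector x z v) + fun z => coordVector x z w := by
            funext z; exact map_add _ _ _
          rw [h, D.isCovariantDerivativeOnUniv.add (diffFieldAt_coordVector hy v)
            (diffFieldAt_coordVector hy w)]
          ext u; simp
        · ext u
          simp [tangentCoord, Bundle.Trivialization.linearMapAt_def_of_notMem _ hy]
      map_smul' := fun a v => by
        by_cases hy : y ∈ (trivializationAt F (TangentSpace 𝓘(ℝ, F)) x).baseSet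
        · have h : (fun z : N => coordVector x z (a • v)) = a • fun z => coordVector x z v := by
            funext z; exact map_smul _ _ _
          rw [h, D.isCovariantDerivativeOnUniv.smul_const a (diffFieldAt_coordVector hy v)]
          ext u; simp
        · ext u
          simp [tangentCoord, Bundle.Trivialization.linearMapAt_def_of_notMem _ hy] }

end Coordinates

section Lifts

variable {E : Type*} [NormedAddCommGroup E] [NormedSpace ℝ E] [FiniteDimensional ℝ E]
  {M : Type*} [TopologicalSpace M] [ChartedSpace E M] [IsManifold 𝓘(ℝ, E) ∞ M] [T2Space M]

/-- The `l`-lift of a vector field to `T^r M`, in the coordinates `(xⁱ_ν)` of `T^r M`: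
`(aⁱ ∂/∂xⁱ)^(l) = ∑_ν (aⁱ)^(ν + l - r) ∂/∂xⁱ_ν`. -/
noncomputable def vectorLift (r : ℕ) (l : ℤ) (X : VField E M) :
    VField (Fin (r + 1) → E) (JetBundle E M r) :=
  fun j => coordVector j j fun ν : Fin (r + 1) => taylorCoeff ((ν : ℕ) + l - r)
    fun t => tangentCoord j.proj (j.rep t) (X (j.rep t))

/-- The complete lift `g^c = g^(r)` to `T^r M` of a covariant 2-tensor, in coordinates:
`(g_{ik} dxⁱ ⊗ dxᵏ)^(r) = ∑_{μ + a + b = r} (g_{ik})^(μ) dxⁱ_a ⊗ dxᵏ_b`. -/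
noncomputable def metricLift (r : ℕ) (g : BilinField E M) :
    BilinField (Fin (r + 1) → E) (JetBundle E M r) :=
  fun j => ∑ a : Fin (r + 1), ∑ b : Fin (r + 1),
    (ContinuousLinearMap.precomp ℝ
      ((ContinuousLinearMap.proj b : (Fin (r + 1) → E) →L[ℝ] E) ∘L tangentCoord j j)) ∘L
    (taylorCoeff ((r : ℤ) - (a : ℕ) - (b : ℕ)) fun t => localMetric g j.proj (j.rep t)) ∘L
    ((ContinuousLinearMap.proj a : (Fin (r + 1) → E) →L[ℝ] E) ∘L tangentCoord j j)

/-- The complete lift `K^c = K^(r)` to `T^r M` of a tensor field `K` of type `(1, p)`.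
In coordinates `(Kⁱ_{k₁…k_p} ∂/∂xⁱ ⊗ dx^{k₁} ⊗ … ⊗ dx^{k_p})^(r)` is the sum of
`(Kⁱ_{k₁…k_p})^(μ) ∂/∂xⁱ_κ ⊗ dx^{k₁}_{ν₁} ⊗ … ⊗ dx^{k_p}_{ν_p}` over
`μ + (r - κ) + ν₁ + … + ν_p = r` (recall `(∂/∂xⁱ)^(l) = ∂/∂xⁱ_{r - l}`). -/
noncomputable def tensorLift (r : ℕ) {p : ℕ}
    (K : Π x : M, (Fin p → TangentSpace 𝓘(ℝ, E) x) → TangentSpace 𝓘(ℝ, E) x)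
    (j : JetBundle E M r) (U : Fin p → TangentSpace 𝓘(ℝ, Fin (r + 1) → E) j) :
    TangentSpace 𝓘(ℝ, Fin (r + 1) → E) j :=
  coordVector j j fun κ : Fin (r + 1) => ∑ ν : Fin p → Fin (r + 1),
    taylorCoeff (((κ : ℕ) : ℤ) - ∑ i, ((ν i : ℕ) : ℤ)) fun t =>
      tangentCoord j.proj (j.rep t)
        (K (j.rep t) fun i => coordVector j.proj (j.rep t) (tangentCoord j j (U i) (ν i)))

/-- The components at `j` of the complete lift of the connection `D`: with `Γ` the connection
components of `D`, the `κ`-th component of `∇^c_U V` for coordinate fields `U`, `V` on `T^r M` is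
`∑_{μ + a + b = κ} Γ^(μ)(V_b)(U_a)`. -/
noncomputable def connComponentsLift (r : ℕ) (D : AffineConnection E M) (j : JetBundle E M r)
    (V : Fin (r + 1) → E) : (Fin (r + 1) → E) →L[ℝ] (Fin (r + 1) → E) :=
  ContinuousLinearMap.pi fun κ : Fin (r + 1) => ∑ a : Fin (r + 1), ∑ b : Fin (r + 1),
    (taylorCoeff (((κ : ℕ) : ℤ) - (a : ℕ) - (b : ℕ))
      (fun t => connComponents D j.proj (j.rep t)) (V b)) ∘L
    (ContinuousLinearMap.proj a : (Fin (r + 1) → E) →L[ℝ] E)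

/-- The complete lift `∇^c` to `T^r M` of a connection `∇`, in coordinates:
`∇^c_U W = dW(U) + Γ^c(U, W)`. -/
noncomputable def connLift (r : ℕ) (D : AffineConnection E M) :
    AffineConnection (Fin (r + 1) → E) (JetBundle E M r) where
  toFun W j := coordVector j j ∘L
    (mvfderiv 𝓘(ℝ, Fin (r + 1) → E) (fun j' => tangentCoord j j' (W j')) j +
      connComponentsLift r D j (tangentCoord j j (W j)) ∘L tangentCoord j j)
  isCovariantDerivativeOnUniv := by
    have key : ∀ (j : JetBundle E M r) (W : VField (Fin (r + 1) → E) (JetBundle E M r)),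
        DiffFieldAt W j → MDifferentiableAt 𝓘(ℝ, Fin (r + 1) → E) 𝓘(ℝ, Fin (r + 1) → E)
          (fun j' => tangentCoord j j' (W j')) j := by
      intro j W hW
      have hj := FiberBundle.mem_baseSet_trivializationAt' (F := Fin (r + 1) → E)
        (E := (TangentSpace 𝓘(ℝ, Fin (r + 1) → E) : JetBundle E M r → Type _)) j
      refine (((trivializationAt (Fin (r + 1) → E)
        (TangentSpace 𝓘(ℝ, Fin (r + 1) → E)) j).mdifferentiableAt_section_iff
          𝓘(ℝ, Fin (r + 1) → E) W hj).1 hW).congr_of_eventuallyEq ?_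
      filter_upwards [(trivializationAt (Fin (r + 1) → E)
        (TangentSpace 𝓘(ℝ, Fin (r + 1) → E)) j).open_baseSet.mem_nhds hj] with z hz
      exact Bundle.Trivialization.continuousLinearMapAt_apply_of_mem _ _ hz _
    refine ⟨fun {W W' j} hW hW' _ => ?_, fun {W f j} hW hf _ => ?_⟩
    · have h1 : (fun j' => tangentCoord j j' ((W + W') j')) =
          (fun j' => tangentCoord j j' (W j')) + fun j' => tangentCoord j j' (W' j') := by
        funext j'; exact map_add _ _ _
      rw [h1, mvfderiv_add (key j W hW) (key j W' hW')]
      ext1 u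
      have h2 : ∀ V V' : Fin (r + 1) → E, connComponentsLift r D j (V + V') =
          connComponentsLift r D j V + connComponentsLift r D j V' := by
        intro V V'; ext u κ
        simp [connComponentsLift, Finset.sum_add_distrib]
      simp only [Pi.add_apply, map_add, h2, add_apply,
        ContinuousLinearMap.comp_apply]
      abel
    · have h1 : (fun j' => tangentCoord j j' ((f • W) j')) =
          f • fun j' => tangentCoord j j' (W j') := by
        funext j'; exact map_smul (tangentCoord j j') (f j') (W j')
      rw [h1, mvfderiv_smul hf (key j W hW)]
      have h2 : ∀ (c : ℝ) (V : Fin (r + 1) → E), connComponentsLift r D j (c • V) =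
          c • connComponentsLift r D j V := by
        intro c V; ext u κ
        simp [connComponentsLift, Finset.smul_sum]
      have h3 : coordVector j j (tangentCoord j j (W j)) = W j :=
        Bundle.Trivialization.symmL_continuousLinearMapAt _
          (FiberBundle.mem_baseSet_trivializationAt' j) _
      ext1 u
      simp only [Pi.smul_apply', map_add, map_smul, h2, h3, add_apply,
        ContinuousLinearMap.comp_apply, smul_apply,
        ContinuousLinearMap.smulRight_apply, smul_add]
      abel

/-- `D'` satisfies the property which characterizes the complete lift of `D` to `T^r M`:
`D'_{X^(l)} Y^(m) = (D_X Y)^(l + m - r)` for all smooth vector fields `X`, `Y` on `M` and all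
`0 ≤ l, m ≤ r`. -/
def IsCompleteLift (r : ℕ) (D : AffineConnection E M)
    (D' : AffineConnection (Fin (r + 1) → E) (JetBundle E M r)) : Prop :=
  ∀ X Y : VField E M, SmoothField X → SmoothField Y → ∀ l m : ℕ, l ≤ r → m ≤ r →
    ∀ j : JetBundle E M r, D' (vectorLift r m Y) j (vectorLift r l X j) =
      vectorLift r ((l : ℤ) + m - r) (fun x => D Y x (X x)) j

end Lifts

end HigherLift

open HigherLift

/-!
A tangent vector `U` of `T^r M` at the jet of a curve `γ` has components `U_0, …, U_r`, which are
best read as the polynomial vector field `u(t) = ∑ t^a U_a` along `γ`, taken modulo `t^(r + 1)`.  In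
this picture the lift `X^(l)` of a vector field is the field `t^(r - l) X(γ(t))`
(`tangentCoord_vectorLift_eq_taylorCoeff`), and the complete lift of a tensor field `K` is the
pointwise application of `K` along `γ` to such fields, followed by taking Taylor coefficients.  The
sums over `μ + a + b = …` in the definitions of the lifts are Leibniz rules
(`sum_taylorCoeff_vectorLift`).

Everything follows from three rules, valid for smooth `f`, `X`, `Y` on `M` and integers
`k, l, m ≤ r`:
* `X^(l) f^(k) = (X f)^(k + l - r)` (`mvfderiv_functionLift_vectorLift`): the derivative of the
  Taylor polynomial of `f` along a polynomial curve is the Taylor polynomial of `df` applied to the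
  polynomial variation;
* `g^c(X^(l), Y^(m)) = g(X, Y)^(l + m - r)` (`metricLift_vectorLift`);
* `∇^c_{X^(l)} Y^(m) = (∇_X Y)^(l + m - r)` (`connLift_vectorLift`), which is the first rule applied
  to the components of `Y`, plus the Leibniz rule for the connection components.

The coordinate fields of `T^r M` are the lifts `(∂/∂xⁱ)^(r - a)` (`vectorLift_coordVector`), so that
lifts span every tangent space, and can be chosen to commute (`exists_eq_sum_vectorLift`,
`mlieBracket_vectorLift`).  Hence a tensorial identity on `T^r M` may be checked on lifts, where the
three rules turn it into the lift of the corresponding identity on `M`.  This gives the torsion and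
the curvature (`torsion_connLift`, `curvature_connLift`), the uniqueness of the complete lift
(`IsCompleteLift.connEq`), and duality, metric compatibility and the Codazzi equation
(`dualityDefect_lift_eq_sum`), the last three being statements about the tensor
`v (g(Y, Z)) - g(D'_v Y, Z) - g(Y, D_v Z)`.  Nondegeneracy of `g^c` is triangular: if
`g(γ(t))(u(t), ·)` vanishes modulo `t^(r + 1)`, then so does `u`, coefficient by coefficient.  The
uniqueness of dual and of Levi-Civita connections is the usual one, on any manifold
(`IsDualConnection.connEq`, `IsLeviCivita.connEq`).
-/

namespace HigherLift

open Filter Set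

/-! ### Taylor coefficients of curves in normed spaces -/

section Calculus

variable {V W : Type*} [NormedAddCommGroup V] [NormedSpace ℝ V]
  [NormedAddCommGroup W] [NormedSpace ℝ W]

theorem taylorCoeff_natCast (n : ℕ) (c : ℝ → V) :
    taylorCoeff (n : ℤ) c = (n ! : ℝ)⁻¹ • iteratedDeriv n c 0 := rfl

theorem taylorCoeff_of_neg {k : ℤ} (hk : k < 0) (c : ℝ → V) : taylorCoeff k c = 0 := by
  obtain ⟨n, rfl⟩ := Int.eq_negSucc_of_lt_zero hk
  rfl

theorem taylorCoeff_zero (c : ℝ → V) : taylorCoeff 0 c = c 0 := by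
  simpa using taylorCoeff_natCast 0 c

theorem taylorCoeff_congr {c₁ c₂ : ℝ → V} (h : c₁ =ᶠ[𝓝 0] c₂) (k : ℤ) :
    taylorCoeff k c₁ = taylorCoeff k c₂ := by
  rcases lt_or_ge k 0 with hk | hk
  · rw [taylorCoeff_of_neg hk, taylorCoeff_of_neg hk]
  · lift k to ℕ using hk
    rw [taylorCoeff_natCast, taylorCoeff_natCast, h.iteratedDeriv_eq]

theorem taylorCoeff_add {c₁ c₂ : ℝ → V} (h₁ : ContDiffAt ℝ ∞ c₁ 0) (h₂ : ContDiffAt ℝ ∞ c₂ 0)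
    (k : ℤ) : taylorCoeff k (fun t => c₁ t + c₂ t) = taylorCoeff k c₁ + taylorCoeff k c₂ := by
  rcases lt_or_ge k 0 with hk | hk
  · simp [taylorCoeff_of_neg hk]
  · lift k to ℕ using hk
    have hn : (k : ℕ∞ω) ≤ ∞ := by exact_mod_cast le_top
    simp only [taylorCoeff_natCast]
    rw [iteratedDeriv_fun_add (h₁.of_le hn) (h₂.of_le hn), smul_add]

theorem taylorCoeff_clm (l : V →L[ℝ] W) {c : ℝ → V} (hc : ContDiffAt ℝ ∞ c 0) (k : ℤ) :
    taylorCoeff k (fun t => l (c t)) = l (taylorCoeff k c) := by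
  rcases lt_or_ge k 0 with hk | hk
  · simp [taylorCoeff_of_neg hk]
  · lift k to ℕ using hk
    simp only [taylorCoeff_natCast]
    rw [clm_iteratedDeriv l hc, map_smul]

theorem taylorCoeff_const_smul (a : ℝ) (c : ℝ → V) (k : ℤ) :
    taylorCoeff k (fun t => a • c t) = a • taylorCoeff k c := by
  rcases lt_or_ge k 0 with hk | hk
  · simp [taylorCoeff_of_neg hk]
  · lift k to ℕ using hk
    simp only [taylorCoeff_natCast]
    rw [iteratedDeriv_fun_const_smul_field, smul_comm]

theorem taylorCoeff_fun_zero (k : ℤ) : taylorCoeff k (fun _ : ℝ => (0 : V)) = 0 := by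
  simpa using taylorCoeff_const_smul 0 (fun _ : ℝ => (0 : V)) k

theorem taylorCoeff_const (v : V) (k : ℤ) :
    taylorCoeff k (fun _ : ℝ => v) = if k = 0 then v else 0 := by
  rcases lt_or_ge k 0 with hk | hk
  · rw [taylorCoeff_of_neg hk, if_neg hk.ne]
  · lift k to ℕ using hk
    rw [taylorCoeff_natCast, iteratedDeriv_const]
    rcases Nat.eq_zero_or_pos k with rfl | h
    · simp
    · simp [h.ne']

theorem taylorCoeff_sum {ι : Type*} (s : Finset ι) {c : ι → ℝ → V}
    (h : ∀ i ∈ s, ContDiffAt ℝ ∞ (c i) 0) (k : ℤ) :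
    taylorCoeff k (fun t => ∑ i ∈ s, c i t) = ∑ i ∈ s, taylorCoeff k (c i) := by
  classical
  induction s using Finset.induction_on with
  | empty => simpa using taylorCoeff_fun_zero k
  | insert a s ha ih =>
    simp only [Finset.sum_insert ha]
    rw [taylorCoeff_add (h a (by simp))
      (ContDiffAt.sum fun i hi => h i (Finset.mem_insert_of_mem hi)),
      ih fun i hi => h i (Finset.mem_insert_of_mem hi)]

/-- Multiplication by `t ^ n` shifts Taylor coefficients. -/
theorem taylorCoeff_pow_smul (n : ℕ) {c : ℝ → V} (hc : ContDiffAt ℝ ∞ c 0) (k : ℤ) :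
    taylorCoeff k (fun t => t ^ n • c t) = taylorCoeff (k - n) c := by
  rcases lt_or_ge k 0 with hk | hk
  · rw [taylorCoeff_of_neg hk, taylorCoeff_of_neg (by omega)]
  lift k to ℕ using hk
  have hn : (k : ℕ∞ω) ≤ ∞ := by exact_mod_cast le_top
  have hpow : ContDiffAt ℝ ∞ (fun t : ℝ => t ^ n) 0 := by fun_prop
  -- Pair with a functional `l`, to use the Leibniz rule for real functions.
  rw [SeparatingDual.eq_iff_forall_dual_eq (R := ℝ)]
  intro l
  rw [← taylorCoeff_clm l hc, ← taylorCoeff_clm l (c := fun t => t ^ n • c t) (hpow.smul hc)]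
  have hl : ContDiffAt ℝ ∞ (fun t => l (c t)) 0 := l.contDiff.contDiffAt.comp 0 hc
  simp only [map_smul, smul_eq_mul]
  rw [taylorCoeff_natCast, iteratedDeriv_fun_mul (hpow.of_le hn) (hl.of_le hn)]
  simp only [iteratedDeriv_fun_pow_zero]
  rcases lt_or_ge k n with h | h
  · rw [taylorCoeff_of_neg (by omega), Finset.sum_eq_zero, smul_zero]
    intro i hi
    rw [if_neg (by simp at hi; omega)]
    simp
  · rw [Finset.sum_eq_single n, if_pos rfl]
    · have h1 : (k : ℤ) - n = ((k - n : ℕ) : ℤ) := by omega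
      rw [h1, taylorCoeff_natCast, smul_eq_mul, smul_eq_mul]
      have h2 := Nat.choose_mul_factorial_mul_factorial h
      have h3 : (k ! : ℝ) = k.choose n * n ! * (k - n)! := by exact_mod_cast h2.symm
      rw [h3]
      have e1 : (k.choose n : ℝ) ≠ 0 := by exact_mod_cast (Nat.choose_pos h).ne'
      have e2 : (n ! : ℝ) ≠ 0 := by exact_mod_cast (Nat.factorial_pos n).ne'
      have e3 : ((k - n)! : ℝ) ≠ 0 := by exact_mod_cast (Nat.factorial_pos _).ne'
      field_simp
    · intro i _ hi
      rw [if_neg hi]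
      simp
    · intro hh
      simp at hh
      omega

/-- The `k`-th Taylor coefficient of `F ∘ c` only depends on the Taylor coefficients of `c` up to
order `k`. -/
theorem taylorCoeff_comp_congr {k : ℤ} {F : V → W} {c₁ c₂ : ℝ → V}
    (hF : ContDiffAt ℝ ∞ F (c₁ 0)) (h₁ : ContDiffAt ℝ ∞ c₁ 0) (h₂ : ContDiffAt ℝ ∞ c₂ 0)
    (h : ∀ i : ℕ, (i : ℤ) ≤ k → taylorCoeff (i : ℤ) c₁ = taylorCoeff (i : ℤ) c₂) :
    taylorCoeff k (F ∘ c₁) = taylorCoeff k (F ∘ c₂) := by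
  rcases lt_or_ge k 0 with hk | hk
  · rw [taylorCoeff_of_neg hk, taylorCoeff_of_neg hk]
  lift k to ℕ using hk
  have h0 : c₁ 0 = c₂ 0 := by
    have := h 0 (by simp)
    simpa [taylorCoeff_zero] using this
  rw [taylorCoeff_natCast, taylorCoeff_natCast,
    iteratedDeriv_comp_congr h0 hF h₁ h₂ fun i hi => ?_]
  have := h i (by exact_mod_cast hi)
  rw [taylorCoeff_natCast, taylorCoeff_natCast] at this
  exact smul_right_injective V (inv_ne_zero (by exact_mod_cast (Nat.factorial_pos i).ne')) this

/-- The polynomial curve `∑ tⁱ vᵢ` with given coefficients. -/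
def polyCurve {r : ℕ} (v : Fin (r + 1) → V) (t : ℝ) : V := ∑ i : Fin (r + 1), t ^ (i : ℕ) • v i

theorem contDiff_polyCurve {r : ℕ} (v : Fin (r + 1) → V) : ContDiff ℝ ∞ (polyCurve v) := by
  unfold polyCurve
  fun_prop

@[simp]
theorem polyCurve_zero {r : ℕ} (v : Fin (r + 1) → V) : polyCurve v 0 = v 0 := poly_zero v

theorem taylorCoeff_polyCurve {r : ℕ} (v : Fin (r + 1) → V) (k : Fin (r + 1)) :
    taylorCoeff ((k : ℕ) : ℤ) (polyCurve v) = v k :=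
  taylorCoeff_poly (.of_forall fun _ => rfl) k

theorem taylorCoeff_prodMk {c : ℝ → V} {d : ℝ → W} (hc : ContDiffAt ℝ ∞ c 0)
    (hd : ContDiffAt ℝ ∞ d 0) (k : ℤ) :
    taylorCoeff k (fun t => (c t, d t)) = (taylorCoeff k c, taylorCoeff k d) := by
  refine Prod.ext ?_ ?_
  · exact (taylorCoeff_clm (.fst ℝ V W) (hc.prodMk hd) k).symm
  · exact (taylorCoeff_clm (.snd ℝ V W) (hc.prodMk hd) k).symm

/-- Leibniz rule: pairing a curve of linear maps with a polynomial curve. -/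
theorem taylorCoeff_clm_polyCurve {r : ℕ} {B : ℝ → V →L[ℝ] W} (hB : ContDiffAt ℝ ∞ B 0)
    (v : Fin (r + 1) → V) (k : ℤ) :
    taylorCoeff k (fun t => B t (polyCurve v t)) =
      ∑ a : Fin (r + 1), taylorCoeff (k - (a : ℕ)) B (v a) := by
  have h1 : ∀ a : Fin (r + 1), ContDiffAt ℝ ∞ (fun t => B t (v a)) 0 := fun a =>
    hB.clm_apply contDiffAt_const
  have h2 : (fun t => B t (polyCurve v t)) =
      fun t => ∑ a : Fin (r + 1), t ^ (a : ℕ) • B t (v a) := by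
    funext t
    simp [polyCurve]
  have h3 : ∀ a ∈ Finset.univ, ContDiffAt ℝ ∞ (fun t => t ^ ((a : Fin (r + 1)) : ℕ) • B t (v a))
      0 := fun a _ => ContDiffAt.smul (by fun_prop) (h1 a)
  rw [h2, taylorCoeff_sum _ h3]
  refine Finset.sum_congr rfl fun a _ => ?_
  rw [taylorCoeff_pow_smul _ (h1 a)]
  exact taylorCoeff_clm (ContinuousLinearMap.apply ℝ W (v a)) hB _

/-- Leibniz rule: up to order `r`, pairing a curve of linear maps with a curve of vectors only
involves the Taylor coefficients of the latter of order at most `r`. -/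
theorem taylorCoeff_clm_apply {r : ℕ} {B : ℝ → V →L[ℝ] W} {u : ℝ → V}
    (hB : ContDiffAt ℝ ∞ B 0) (hu : ContDiffAt ℝ ∞ u 0) {k : ℤ} (hk : k ≤ r) :
    taylorCoeff k (fun t => B t (u t)) =
      ∑ a : Fin (r + 1), taylorCoeff (k - (a : ℕ)) B (taylorCoeff ((a : ℕ) : ℤ) u) := by
  set p : Fin (r + 1) → V := fun a => taylorCoeff ((a : ℕ) : ℤ) u with hp
  rw [← taylorCoeff_clm_polyCurve hB p k]
  have hpc : ContDiffAt ℝ ∞ (polyCurve p) 0 := (contDiff_polyCurve p).contDiffAt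
  have hF : ContDiff ℝ ∞ fun q : (V →L[ℝ] W) × V => q.1 q.2 :=
    contDiff_fst.clm_apply contDiff_snd
  refine taylorCoeff_comp_congr (F := fun q : (V →L[ℝ] W) × V => q.1 q.2)
    (c₁ := fun t => (B t, u t)) (c₂ := fun t => (B t, polyCurve p t)) hF.contDiffAt
    (hB.prodMk hu) (hB.prodMk hpc) fun i hi => ?_
  rw [taylorCoeff_prodMk hB hu, taylorCoeff_prodMk hB hpc]
  have := taylorCoeff_polyCurve p ⟨i, by omega⟩
  rw [this]

/-- Leibniz rule for bilinear maps. -/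
theorem taylorCoeff_clm_apply₂ {V₁ V₂ W : Type*} [NormedAddCommGroup V₁] [NormedSpace ℝ V₁]
    [NormedAddCommGroup V₂] [NormedSpace ℝ V₂] [NormedAddCommGroup W] [NormedSpace ℝ W] {r : ℕ}
    {B : ℝ → V₁ →L[ℝ] V₂ →L[ℝ] W} {u : ℝ → V₁} {v : ℝ → V₂}
    (hB : ContDiffAt ℝ ∞ B 0) (hu : ContDiffAt ℝ ∞ u 0) (hv : ContDiffAt ℝ ∞ v 0) {k : ℤ}
    (hk : k ≤ r) :
    taylorCoeff k (fun t => B t (u t) (v t)) = ∑ a : Fin (r + 1), ∑ b : Fin (r + 1),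
      taylorCoeff (k - (a : ℕ) - (b : ℕ)) B (taylorCoeff ((a : ℕ) : ℤ) u)
        (taylorCoeff ((b : ℕ) : ℤ) v) := by
  rw [taylorCoeff_clm_apply (hB.clm_apply hu) hv hk, Finset.sum_comm]
  refine Finset.sum_congr rfl fun b _ => ?_
  rw [taylorCoeff_clm_apply (r := r) hB hu (by omega), sum_apply]
  refine Finset.sum_congr rfl fun a _ => ?_
  rw [sub_right_comm]

/-! ### Prolongation of smooth maps to Taylor polynomials -/

/-- Derivatives of a function `G(t, v)` with respect to `t` commute with derivatives with respect to
the parameter `v`. -/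
theorem fderiv_iteratedDeriv_param {G : ℝ × V → W} {Ω : Set (ℝ × V)} (hΩ : IsOpen Ω)
    (hG : ContDiffOn ℝ ∞ G Ω) (w : V) (k : ℕ) {p : ℝ × V} (hp : p ∈ Ω) :
    fderiv ℝ (fun p : ℝ × V => iteratedDeriv k (fun t => G (t, p.2)) p.1) p (0, w) =
      iteratedDeriv k (fun t => fderiv ℝ G (t, p.2) (0, w)) p.1 := by
  induction k generalizing p with
  | zero => simp [iteratedDeriv_zero]
  | succ k ih =>
    set A : ℝ × V → W := fun p => iteratedDeriv k (fun t => G (t, p.2)) p.1 with hA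
    have hAs : ContDiffOn ℝ ∞ A Ω := contDiffOn_iteratedDeriv_param hΩ hG k
    have hAp : ∀ q ∈ Ω, ContDiffAt ℝ ∞ A q := fun q hq => hAs.contDiffAt (hΩ.mem_nhds hq)
    have hline : ∀ q : ℝ × V, HasDerivAt (fun t : ℝ => (t, q.2)) (1, 0) q.1 := fun q =>
      (hasDerivAt_id _).prodMk (hasDerivAt_const _ _)
    have h1 : ∀ q ∈ Ω, iteratedDeriv (k + 1) (fun t => G (t, q.2)) q.1 = fderiv ℝ A q (1, 0) := by
      intro q hq
      rw [iteratedDeriv_succ]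
      exact (HasFDerivAt.comp_hasDerivAt q.1 (f := fun t : ℝ => (t, q.2))
        ((hAp q hq).differentiableAt (by simp)).hasFDerivAt (hline q)).deriv
    have hd : DifferentiableAt ℝ (fderiv ℝ A) p :=
      ((hAp p hp).fderiv_right (m := ∞) (by simp)).differentiableAt (by simp)
    have h2 : (fun p : ℝ × V => iteratedDeriv (k + 1) (fun t => G (t, p.2)) p.1) =ᶠ[𝓝 p]
        fun q => fderiv ℝ A q (1, 0) := by
      filter_upwards [hΩ.mem_nhds hp] with q hq using h1 q hq
    rw [h2.fderiv_eq, fderiv_clm_apply hd (by fun_prop)]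
    have hsymm := (hAp p hp).isSymmSndFDerivAt (by
      rw [minSmoothness_of_isRCLikeNormedField]; exact ENat.LEInfty.out)
    simp only [fderiv_fun_const, Pi.zero_apply, ContinuousLinearMap.comp_zero, zero_add,
      ContinuousLinearMap.flip_apply]
    rw [hsymm.eq, iteratedDeriv_succ]
    have h3 : iteratedDeriv k (fun t => fderiv ℝ G (t, p.2) (0, w)) =ᶠ[𝓝 p.1]
        fun t => fderiv ℝ A (t, p.2) (0, w) := by
      have hc : ContinuousAt (fun t : ℝ => (t, p.2)) p.1 := by fun_prop
      filter_upwards [hc.preimage_mem_nhds (hΩ.mem_nhds hp)] with t ht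
      exact (ih ht).symm
    rw [h3.deriv_eq]
    have h4 := (HasFDerivAt.comp_hasDerivAt p.1 (f := fun t : ℝ => (t, p.2))
      hd.hasFDerivAt (hline p)).clm_apply (hasDerivAt_const p.1 ((0 : ℝ), w))
    simpa using h4.deriv.symm

theorem contDiffOn_polyCurve_param {r : ℕ} {F : V → W} {U : Set V} (hU : IsOpen U)
    (hF : ContDiffOn ℝ ∞ F U) :
    IsOpen {q : ℝ × (Fin (r + 1) → V) | polyCurve q.2 q.1 ∈ U} ∧
    ContDiffOn ℝ ∞ (fun q : ℝ × (Fin (r + 1) → V) => F (polyCurve q.2 q.1))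
      {q | polyCurve q.2 q.1 ∈ U} := by
  have hP : ContDiff ℝ ∞ fun q : ℝ × (Fin (r + 1) → V) => polyCurve q.2 q.1 := by
    unfold polyCurve
    fun_prop
  exact ⟨hU.preimage hP.continuous, hF.comp hP.contDiffOn fun q hq => hq⟩

/-- The prolongation of a smooth map `F`, sending the coefficients of a polynomial curve to the
`k`-th Taylor coefficient of its image under `F`, is smooth. -/
theorem contDiffOn_taylorCoeff_polyCurve {r : ℕ} {F : V → W} {U : Set V} (hU : IsOpen U)
    (hF : ContDiffOn ℝ ∞ F U) (k : ℤ) :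
    ContDiffOn ℝ ∞ (fun v : Fin (r + 1) → V => taylorCoeff k fun t => F (polyCurve v t))
      {v | v 0 ∈ U} := by
  rcases lt_or_ge k 0 with hk | hk
  · simpa [taylorCoeff_of_neg hk] using contDiffOn_const
  lift k to ℕ using hk
  simp only [taylorCoeff_natCast]
  obtain ⟨hΩ, hG⟩ := contDiffOn_polyCurve_param (r := r) hU hF
  refine ContDiffOn.const_smul _ ((contDiffOn_iteratedDeriv_param hΩ hG k).comp
    (f := fun v : Fin (r + 1) → V => ((0 : ℝ), v)) (by fun_prop) fun v hv => ?_)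
  simpa using hv

/-- The derivative of the prolongation of `F` is the prolongation of the derivative of `F`. -/
theorem fderiv_taylorCoeff_polyCurve {r : ℕ} {F : V → W} {U : Set V} (hU : IsOpen U)
    (hF : ContDiffOn ℝ ∞ F U) (k : ℤ) {v : Fin (r + 1) → V} (hv : v 0 ∈ U)
    (w : Fin (r + 1) → V) :
    fderiv ℝ (fun v : Fin (r + 1) → V => taylorCoeff k fun t => F (polyCurve v t)) v w =
      taylorCoeff k fun t => fderiv ℝ F (polyCurve v t) (polyCurve w t) := by
  rcases lt_or_ge k 0 with hk | hk
  · simp [taylorCoeff_of_neg hk]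
  lift k to ℕ using hk
  simp only [taylorCoeff_natCast]
  obtain ⟨hΩ, hG⟩ := contDiffOn_polyCurve_param (r := r) hU hF
  set G : ℝ × (Fin (r + 1) → V) → W := fun q => F (polyCurve q.2 q.1) with hGdef
  have hp : ((0 : ℝ), v) ∈ {q : ℝ × (Fin (r + 1) → V) | polyCurve q.2 q.1 ∈ U} := by
    simpa using hv
  have hA := ((contDiffOn_iteratedDeriv_param hΩ hG k).contDiffAt
    (hΩ.mem_nhds hp)).differentiableAt (by simp)
  have h1 := hA.hasFDerivAt.comp v (f := fun v : Fin (r + 1) → V => ((0 : ℝ), v))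
    ((hasFDerivAt_const (0 : ℝ) v).prodMk (hasFDerivAt_id v))
  have h2 : HasFDerivAt (fun v : Fin (r + 1) → V =>
      iteratedDeriv k (fun t => F (polyCurve v t)) 0) _ v := h1
  rw [(h2.fun_const_smul ((k ! : ℝ)⁻¹)).fderiv]
  have h3 := fderiv_iteratedDeriv_param hΩ hG w k hp
  rw [smul_apply]
  congr 1
  refine Eq.trans ?_ (h3.trans ?_)
  · simp
  · refine Filter.EventuallyEq.iteratedDeriv_eq _ ?_
    have hc : Continuous (polyCurve v) := (contDiff_polyCurve v).continuous
    filter_upwards [hc.continuousAt.preimage_mem_nhds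
      (hU.mem_nhds (show polyCurve v 0 ∈ U by simpa using hv))] with t ht
    have hP : HasFDerivAt (fun q : ℝ × (Fin (r + 1) → V) => polyCurve q.2 q.1)
        (fderiv ℝ (fun q : ℝ × (Fin (r + 1) → V) => polyCurve q.2 q.1) (t, v)) (t, v) := by
      refine DifferentiableAt.hasFDerivAt ?_
      unfold polyCurve
      fun_prop
    have hl : HasFDerivAt (fun v : Fin (r + 1) → V => polyCurve v t)
        (∑ i : Fin (r + 1), t ^ (i : ℕ) •
          (ContinuousLinearMap.proj i : (Fin (r + 1) → V) →L[ℝ] V)) v := by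
      unfold polyCurve
      refine HasFDerivAt.fun_sum fun i _ => ?_
      exact (hasFDerivAt_apply i v).fun_const_smul (t ^ (i : ℕ))
    have hl2 := hP.comp v (f := fun v : Fin (r + 1) → V => (t, v))
      ((hasFDerivAt_const t v).prodMk (hasFDerivAt_id v))
    have h5 := congrArg (fun L => L w) (hl2.unique hl)
    have hFt := ((hF.contDiffAt (hU.mem_nhds ht)).differentiableAt (by simp)).hasFDerivAt
    have h6 : fderiv ℝ G (t, v) = _ := (HasFDerivAt.comp (t, v)
      (f := fun q : ℝ × (Fin (r + 1) → V) => polyCurve q.2 q.1) hFt hP).fderiv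
    rw [h6]
    change fderiv ℝ F (polyCurve v t) _ = _
    congr 1
    simpa [polyCurve] using h5

end Calculus

/-! ### Tangent vectors and vector fields in charts -/

section Charts

variable {F : Type*} [NormedAddCommGroup F] [NormedSpace ℝ F]
  {N : Type*} [TopologicalSpace N] [ChartedSpace F N] [IsManifold 𝓘(ℝ, F) ∞ N]
  {W : Type*} [NormedAddCommGroup W] [NormedSpace ℝ W]

/-- The vector field `Y` is smooth at the point `x`. -/
def SmoothFieldAt (Y : VField F N) (x : N) : Prop :=
  ContMDiffAt 𝓘(ℝ, F) (𝓘(ℝ, F).prod 𝓘(ℝ, F)) ∞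
    (fun y => (⟨y, Y y⟩ : TangentBundle 𝓘(ℝ, F) N)) x

theorem SmoothField.smoothFieldAt {Y : VField F N} (h : SmoothField Y) (x : N) :
    SmoothFieldAt Y x := h x

theorem SmoothFieldAt.diffFieldAt {Y : VField F N} {x : N} (h : SmoothFieldAt Y x) :
    DiffFieldAt Y x := ContMDiffAt.mdifferentiableAt h (by simp)

theorem SmoothField.diffFieldAt {Y : VField F N} (h : SmoothField Y) (x : N) :
    DiffFieldAt Y x := (h.smoothFieldAt x).diffFieldAt

theorem SmoothFieldAt.congr {Y Z : VField F N} {x : N} (h : SmoothFieldAt Y x)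
    (hYZ : ∀ᶠ y in 𝓝 x, Z y = Y y) : SmoothFieldAt Z x := by
  refine ContMDiffAt.congr_of_eventuallyEq h ?_
  filter_upwards [hYZ] with y hy
  rw [hy]

theorem chart_mem_nhds (x : N) {y : N} (hy : y ∈ (chartAt F x).source) :
    (chartAt F x).source ∈ 𝓝 y := (chartAt F x).open_source.mem_nhds hy

theorem tangentCoord_coordVector {x y : N} (hy : y ∈ (chartAt F x).source) (u : F) :
    tangentCoord x y (coordVector x y u) = u :=
  Bundle.Trivialization.continuousLinearMapAt_symmL _ hy _

theorem coordVector_tangentCoord {x y : N} (hy : y ∈ (chartAt F x).source)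
    (v : TangentSpace 𝓘(ℝ, F) y) : coordVector x y (tangentCoord x y v) = v :=
  Bundle.Trivialization.symmL_continuousLinearMapAt _ hy _

theorem tangentCoord_injective {x y : N} (hy : y ∈ (chartAt F x).source) :
    Function.Injective (tangentCoord x y : TangentSpace 𝓘(ℝ, F) y → F) :=
  Function.LeftInverse.injective (coordVector_tangentCoord hy)

theorem trivializationAt_snd_eq_tangentCoord {x y : N} (hy : y ∈ (chartAt F x).source)
    (v : TangentSpace 𝓘(ℝ, F) y) :
    (trivializationAt F (TangentSpace 𝓘(ℝ, F)) x ⟨y, v⟩).2 = tangentCoord x y v :=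
  (Bundle.Trivialization.continuousLinearMapAt_apply_of_mem _ _ hy _).symm

theorem smoothFieldAt_iff {x y : N} (hy : y ∈ (chartAt F x).source) {Y : VField F N} :
    SmoothFieldAt Y y ↔
      ContMDiffAt 𝓘(ℝ, F) 𝓘(ℝ, F) ∞ (fun z => tangentCoord x z (Y z)) y := by
  have h1 : (fun z => (trivializationAt F (TangentSpace 𝓘(ℝ, F)) x ⟨z, Y z⟩).2) =ᶠ[𝓝 y]
      fun z => tangentCoord x z (Y z) := by
    filter_upwards [chart_mem_nhds x hy] with z hz
    exact trivializationAt_snd_eq_tangentCoord hz _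
  rw [← h1.contMDiffAt_iff]
  exact (trivializationAt F (TangentSpace 𝓘(ℝ, F)) x).contMDiffAt_section_iff hy

theorem diffFieldAt_iff {x y : N} (hy : y ∈ (chartAt F x).source) {Y : VField F N} :
    DiffFieldAt Y y ↔
      MDifferentiableAt 𝓘(ℝ, F) 𝓘(ℝ, F) (fun z => tangentCoord x z (Y z)) y := by
  have h1 : (fun z => (trivializationAt F (TangentSpace 𝓘(ℝ, F)) x ⟨z, Y z⟩).2) =ᶠ[𝓝 y]
      fun z => tangentCoord x z (Y z) := by
    filter_upwards [chart_mem_nhds x hy] with z hz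
    exact trivializationAt_snd_eq_tangentCoord hz _
  rw [← h1.mdifferentiableAt_iff]
  exact (trivializationAt F (TangentSpace 𝓘(ℝ, F)) x).mdifferentiableAt_section_iff 𝓘(ℝ, F) _ hy

theorem smoothFieldAt_coordVector {x y : N} (hy : y ∈ (chartAt F x).source) (u : F) :
    SmoothFieldAt (fun z => coordVector x z u) y := by
  refine (smoothFieldAt_iff hy).2 ((contMDiffAt_const (c := u)).congr_of_eventuallyEq ?_)
  filter_upwards [chart_mem_nhds x hy] with z hz
  exact tangentCoord_coordVector hz u

theorem contMDiffAt_chart {x y : N} (hy : y ∈ (chartAt F x).source) :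
    ContMDiffAt 𝓘(ℝ, F) 𝓘(ℝ, F) ∞ (chartAt F x) y :=
  contMDiffAt_of_mem_maximalAtlas (IsManifold.chart_mem_maximalAtlas x) hy

theorem contMDiffAt_chart_symm {x y : N} (hy : y ∈ (chartAt F x).source) :
    ContMDiffAt 𝓘(ℝ, F) 𝓘(ℝ, F) ∞ (chartAt F x).symm (chartAt F x y) :=
  contMDiffAt_symm_of_mem_maximalAtlas (IsManifold.chart_mem_maximalAtlas x)
    ((chartAt F x).map_source hy)

theorem comp_symm_chart_eventuallyEq {X : Type*} {x y : N} (hy : y ∈ (chartAt F x).source)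
    (f : N → X) : f =ᶠ[𝓝 y] (f ∘ (chartAt F x).symm) ∘ chartAt F x := by
  filter_upwards [chart_mem_nhds x hy] with z hz
  simp [(chartAt F x).left_inv hz]

theorem contMDiffAt_iff_chart {x y : N} (hy : y ∈ (chartAt F x).source) {f : N → W} :
    ContMDiffAt 𝓘(ℝ, F) 𝓘(ℝ, W) ∞ f y ↔
      ContDiffAt ℝ ∞ (f ∘ (chartAt F x).symm) (chartAt F x y) := by
  constructor
  · intro h
    refine contMDiffAt_iff_contDiffAt.1 (ContMDiffAt.comp (I' := 𝓘(ℝ, F)) _ ?_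
      (contMDiffAt_chart_symm hy))
    rwa [(chartAt F x).left_inv hy]
  · intro h
    exact ContMDiffAt.congr_of_eventuallyEq
      (ContMDiffAt.comp (I' := 𝓘(ℝ, F)) y (contMDiffAt_iff_contDiffAt.2 h) (contMDiffAt_chart hy))
      (comp_symm_chart_eventuallyEq hy f)

theorem mdifferentiableAt_comp_chart_symm {x y : N} (hy : y ∈ (chartAt F x).source) {f : N → W}
    (h : MDifferentiableAt 𝓘(ℝ, F) 𝓘(ℝ, W) f y) :
    DifferentiableAt ℝ (f ∘ (chartAt F x).symm) (chartAt F x y) := by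
  refine mdifferentiableAt_iff_differentiableAt.1 (MDifferentiableAt.comp (I' := 𝓘(ℝ, F)) _ ?_
    ((contMDiffAt_chart_symm hy).mdifferentiableAt (by simp)))
  rwa [(chartAt F x).left_inv hy]

theorem mvfderiv_congr {f g : N → W} {y : N} (h : f =ᶠ[𝓝 y] g) :
    mvfderiv 𝓘(ℝ, F) f y = mvfderiv 𝓘(ℝ, F) g y := by
  ext v
  change (mfderiv 𝓘(ℝ, F) 𝓘(ℝ, W) f y v : W) = (mfderiv 𝓘(ℝ, F) 𝓘(ℝ, W) g y v : W)
  rw [h.mfderiv_eq]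
  rfl

theorem tangentCoord_eq_mfderiv {x y : N} (hy : y ∈ (chartAt F x).source)
    (v : TangentSpace 𝓘(ℝ, F) y) :
    tangentCoord x y v = mfderiv 𝓘(ℝ, F) 𝓘(ℝ, F) (chartAt F x) y v := by
  have := TangentBundle.continuousLinearMapAt_trivializationAt (I := 𝓘(ℝ, F)) hy
  rw [tangentCoord, this]
  rfl

theorem tangentCoord_eq_mvfderiv {x y : N} (hy : y ∈ (chartAt F x).source)
    (v : TangentSpace 𝓘(ℝ, F) y) :
    tangentCoord x y v = mvfderiv 𝓘(ℝ, F) (chartAt F x) y v := tangentCoord_eq_mfderiv hy v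

/-- The derivative of a function, read in a chart. -/
theorem mvfderiv_eq_fderiv {x y : N} (hy : y ∈ (chartAt F x).source) {f : N → W}
    (h : MDifferentiableAt 𝓘(ℝ, F) 𝓘(ℝ, W) f y) (v : TangentSpace 𝓘(ℝ, F) y) :
    mvfderiv 𝓘(ℝ, F) f y v =
      fderiv ℝ (f ∘ (chartAt F x).symm) (chartAt F x y) (tangentCoord x y v) := by
  have h1 := mdifferentiableAt_comp_chart_symm hy h
  rw [mvfderiv_congr (comp_symm_chart_eventuallyEq hy f)]
  refine (mfderiv_comp_apply (I' := 𝓘(ℝ, F)) y h1.mdifferentiableAt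
      ((contMDiffAt_chart hy).mdifferentiableAt (by simp)) v).trans ?_
  refine (congrArg _ (tangentCoord_eq_mfderiv hy v).symm).trans ?_
  change mfderiv 𝓘(ℝ, F) 𝓘(ℝ, W) _ _ _ = _
  rw [mfderiv_eq_fderiv]
  rfl

/-- The vector field `Y`, read in the chart around `x`. -/
noncomputable def localField (x : N) (Y : VField F N) (p : F) : F :=
  tangentCoord x ((chartAt F x).symm p) (Y ((chartAt F x).symm p))

theorem localField_apply_chart {x y : N} (hy : y ∈ (chartAt F x).source) (Y : VField F N) :
    localField x Y (chartAt F x y) = tangentCoord x y (Y y) := by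
  rw [localField, (chartAt F x).left_inv hy]

theorem smoothFieldAt_iff_localField {x y : N} (hy : y ∈ (chartAt F x).source) {Y : VField F N} :
    SmoothFieldAt Y y ↔ ContDiffAt ℝ ∞ (localField x Y) (chartAt F x y) := by
  rw [smoothFieldAt_iff hy, contMDiffAt_iff_chart hy]
  rfl

theorem localField_coordVector_eventuallyEq {x y : N} (hy : y ∈ (chartAt F x).source) (u : F) :
    localField x (fun z => coordVector x z u) =ᶠ[𝓝 (chartAt F x y)] fun _ => u := by
  filter_upwards [(chartAt F x).open_target.mem_nhds ((chartAt F x).map_source hy)] with p hp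
  exact tangentCoord_coordVector ((chartAt F x).map_target hp) u

/-- Mathlib defines the Lie bracket through pullbacks of vector fields; the pullback by the inverse
of a chart is the field read in this chart. -/
theorem mpullback_chart_symm {x : N} {p : F} (hp : p ∈ (chartAt F x).target) (Y : VField F N) :
    VectorField.mpullback 𝓘(ℝ, F) 𝓘(ℝ, F) (chartAt F x).symm Y p = localField x Y p := by
  have h1 := mfderiv_extChartAt_comp_mfderivWithin_extChartAt_symm (I := 𝓘(ℝ, F)) (x := x)
    (y := p) (by simpa using hp)
  have h2 := mfderivWithin_extChartAt_symm_comp_mfderiv_extChartAt (I := 𝓘(ℝ, F)) (x := x)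
    (y := p) (by simpa using hp)
  have hs : (chartAt F x).symm p ∈ (chartAt F x).source := (chartAt F x).map_target hp
  have h3 := ContinuousLinearMap.inverse_eq h2 h1
  simp only [mfderivWithin_univ, mfld_simps] at h3
  have h4 : ∀ w : F, ((mfderiv 𝓘(ℝ, F) 𝓘(ℝ, F) (chartAt F x).symm p).inverse : F →L[ℝ] F) w =
      (mfderiv 𝓘(ℝ, F) 𝓘(ℝ, F) (chartAt F x) ((chartAt F x).symm p) : F →L[ℝ] F) w :=
    fun w => congrArg (fun L : F →L[ℝ] F => L w) h3
  exact (h4 _).trans (tangentCoord_eq_mfderiv hs _).symm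

/-- The Lie bracket of vector fields, read in a chart. -/
theorem tangentCoord_mlieBracket [CompleteSpace F] {x y : N} (hy : y ∈ (chartAt F x).source)
    {X Y : VField F N} (hX : DiffFieldAt X y) (hY : DiffFieldAt Y y) :
    tangentCoord x y (VectorField.mlieBracket 𝓘(ℝ, F) X Y y) =
      fderiv ℝ (localField x Y) (chartAt F x y) (tangentCoord x y (X y)) -
        fderiv ℝ (localField x X) (chartAt F x y) (tangentCoord x y (Y y)) := by
  have ht := (chartAt F x).map_source hy
  have : IsManifold 𝓘(ℝ, F) (minSmoothness ℝ 2) N := by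
    rw [minSmoothness_of_isRCLikeNormedField]
    infer_instance
  have h1 := VectorField.mpullback_mlieBracket (I := 𝓘(ℝ, F)) (I' := 𝓘(ℝ, F)) (n := ∞)
    (f := (chartAt F x).symm) (x₀ := chartAt F x y) (V := X) (W := Y)
    (by rw [(chartAt F x).left_inv hy]; exact hX) (by rw [(chartAt F x).left_inv hy]; exact hY)
    (contMDiffAt_chart_symm hy)
    (by rw [minSmoothness_of_isRCLikeNormedField]; exact ENat.LEInfty.out)
  rw [mpullback_chart_symm ht, localField_apply_chart hy] at h1
  have h2 : ∀ Z : VField F N, VectorField.mpullback 𝓘(ℝ, F) 𝓘(ℝ, F) (chartAt F x).symm Z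
      =ᶠ[𝓝 (chartAt F x y)] localField x Z := fun Z => by
    filter_upwards [(chartAt F x).open_target.mem_nhds ht] with p hp
    exact mpullback_chart_symm hp Z
  have h3 : ∀ V W : F → F, VectorField.mlieBracket 𝓘(ℝ, F) (M := F) V W =
      VectorField.lieBracket ℝ V W := fun V W => by
    have := VectorField.mlieBracketWithin_eq_lieBracketWithin (𝕜 := ℝ) (E := F) (V := V) (W := W)
      (s := univ)
    exact (VectorField.mlieBracketWithin_univ).symm.trans
      (this.trans VectorField.lieBracketWithin_univ)
  have h4 := (h1.trans ((h2 X).mlieBracket_vectorField_eq (h2 Y))).trans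
    (congrFun (h3 (localField x X) (localField x Y)) (chartAt F x y))
  rw [h4, VectorField.lieBracket_eq]
  simp only [localField_apply_chart hy]

theorem mlieBracket_coordVector [CompleteSpace F] {x y : N} (hy : y ∈ (chartAt F x).source)
    (u v : F) : VectorField.mlieBracket 𝓘(ℝ, F) (fun z : N => coordVector x z u)
      (fun z => coordVector x z v) y = 0 := by
  apply tangentCoord_injective hy
  rw [tangentCoord_mlieBracket hy (smoothFieldAt_coordVector hy u).diffFieldAt
    (smoothFieldAt_coordVector hy v).diffFieldAt,
    (localField_coordVector_eventuallyEq hy u).fderiv_eq,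
    (localField_coordVector_eventuallyEq hy v).fderiv_eq]
  simp

end Charts

/-! ### Connections in charts -/

section Connections

variable {F : Type*} [NormedAddCommGroup F] [NormedSpace ℝ F]
  {N : Type*} [TopologicalSpace N] [ChartedSpace F N] [IsManifold 𝓘(ℝ, F) ∞ N]
  {W : Type*} [NormedAddCommGroup W] [NormedSpace ℝ W]

theorem SmoothFieldAt.eventually_diffFieldAt {Y : VField F N} {x : N} (h : SmoothFieldAt Y x) :
    ∀ᶠ y in 𝓝 x, DiffFieldAt Y y := by
  have h1 := ContMDiffAt.of_le h (show (1 : ℕ∞ω) ≤ ∞ from ENat.LEInfty.out)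
  filter_upwards [(contMDiffAt_iff_contMDiffAt_nhds (by simp)).1 h1] with y hy
  exact ContMDiffAt.mdifferentiableAt hy (by simp)

theorem SmoothFieldAt.const_smul {Y : VField F N} {x : N} (h : SmoothFieldAt Y x) (a : ℝ) :
    SmoothFieldAt (a • Y) x := ContMDiffAt.const_smul_section h

variable [FiniteDimensional ℝ F]

theorem connComponents_apply (D : AffineConnection F N) (x y : N) (u v : F) :
    connComponents D x y v u =
      tangentCoord x y (D (fun z => coordVector x z v) y (coordVector x y u)) := rfl

/-- Two fields which agree near a point have the same covariant derivative there. -/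
theorem conn_congr (D : AffineConnection F N) {Y Z : VField F N} {x : N} (hY : DiffFieldAt Y x)
    (hYZ : ∀ᶠ y in 𝓝 x, Z y = Y y) : D Z x = D Y x := by
  refine D.isCovariantDerivativeOnUniv.congr_of_eventuallyEq ?_ hY univ_mem hYZ
  exact MDifferentiableAt.congr_of_eventuallyEq hY (by
    filter_upwards [hYZ] with y hy
    rw [hy])

/-- The coordinate expression `∇_v Z = dZ(v) + Γ(Z)(v)` of a connection. -/
theorem tangentCoord_conn (D : AffineConnection F N) {x y : N} (hy : y ∈ (chartAt F x).source)
    {Z : VField F N} (hZ : DiffFieldAt Z y) (v : TangentSpace 𝓘(ℝ, F) y) :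
    tangentCoord x y (D Z y v) = fderiv ℝ (localField x Z) (chartAt F x y) (tangentCoord x y v) +
      connComponents D x y (tangentCoord x y (Z y)) (tangentCoord x y v) := by
  -- The difference of both derivatives is tensorial in `Z`, so that `Z` may be replaced by the
  -- coordinate field with the same value at `y`.
  set Φ : VField F N → F := fun Z => tangentCoord x y (D Z y v) -
    mvfderiv 𝓘(ℝ, F) (fun z => tangentCoord x z (Z z)) y v with hΦ
  have hT : TensorialAt 𝓘(ℝ, F) F Φ y := by
    refine ⟨fun {f σ} hf hσ => ?_, fun {σ σ'} hσ hσ' => ?_⟩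
    · have h1 : (fun z => tangentCoord x z ((f • σ) z)) =
          f • fun z => tangentCoord x z (σ z) := by
        funext z
        exact map_smul (tangentCoord x z) (f z) (σ z)
      simp only [hΦ]
      rw [h1, mvfderiv_smul hf ((diffFieldAt_iff hy).1 hσ),
        D.isCovariantDerivativeOnUniv.leibniz hσ hf]
      simp [smul_sub]
    · have h1 : (fun z => tangentCoord x z ((σ + σ') z)) =
          (fun z => tangentCoord x z (σ z)) + fun z => tangentCoord x z (σ' z) := by
        funext z
        exact map_add (tangentCoord x z) (σ z) (σ' z)
      simp only [hΦ]
      rw [h1, mvfderiv_add ((diffFieldAt_iff hy).1 hσ) ((diffFieldAt_iff hy).1 hσ'),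
        D.isCovariantDerivativeOnUniv.add hσ hσ']
      simp only [add_apply, map_add]
      abel
  have hc := smoothFieldAt_coordVector hy (tangentCoord x y (Z y))
  have h1 : Φ Z = Φ fun z => coordVector x z (tangentCoord x y (Z y)) :=
    hT.pointwise hZ hc.diffFieldAt (coordVector_tangentCoord hy (Z y)).symm
  have h2 : mvfderiv 𝓘(ℝ, F)
      (fun z => tangentCoord x z (coordVector x z (tangentCoord x y (Z y)))) y v = 0 := by
    rw [mvfderiv_congr (g := fun _ => tangentCoord x y (Z y)), mvfderiv_const]
    · rfl
    · filter_upwards [chart_mem_nhds x hy] with z hz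
      exact tangentCoord_coordVector hz _
  simp only [hΦ] at h1
  rw [h2, sub_zero, sub_eq_iff_eq_add] at h1
  rw [h1, mvfderiv_eq_fderiv hy ((diffFieldAt_iff hy).1 hZ), connComponents_apply,
    coordVector_tangentCoord hy, add_comm]
  rfl

/-- Smoothness of a family of linear maps on a finite dimensional space is tested on vectors. -/
theorem contMDiffAt_clm_of_apply {f : N → F →L[ℝ] W} {y : N}
    (h : ∀ u, ContMDiffAt 𝓘(ℝ, F) 𝓘(ℝ, W) ∞ (fun z => f z u) y) :
    ContMDiffAt 𝓘(ℝ, F) 𝓘(ℝ, F →L[ℝ] W) ∞ f y := by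
  set b := Module.finBasis ℝ F with hb
  have h1 : f = fun z => ∑ i, ((b.coord i).toContinuousLinearMap).smulRight (f z (b i)) := by
    funext z
    ext u
    conv_lhs => rw [← b.sum_repr u]
    simp [-Module.Basis.sum_repr]
  rw [h1]
  refine ContMDiffAt.sum fun i _ => ?_
  exact ((ContinuousLinearMap.smulRightL ℝ F W
    ((b.coord i).toContinuousLinearMap)).contDiff.contMDiff.contMDiffAt).comp y (h (b i))

/-- The components of the curvature in terms of those of the connection: with `Γ(w)(u)` the
components of `D_{∂_u} ∂_w`, those of `R(∂_u, ∂_v) ∂_w` are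
`∂_u Γ(w)(v) - ∂_v Γ(w)(u) + Γ(Γ(w)(v))(u) - Γ(Γ(w)(u))(v)`. -/
noncomputable def curvatureComponents (D : AffineConnection F N) (x y : N) (u v w : F) : F :=
  fderiv ℝ (connComponents D x ∘ (chartAt F x).symm) (chartAt F x y) u w v -
    fderiv ℝ (connComponents D x ∘ (chartAt F x).symm) (chartAt F x y) v w u +
    connComponents D x y (connComponents D x y w v) u -
    connComponents D x y (connComponents D x y w u) v

theorem localField_conn_eventuallyEq (D : AffineConnection F N) {x y : N}
    (hy : y ∈ (chartAt F x).source) {Y Z : VField F N} (hZ : SmoothFieldAt Z y) :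
    localField x (fun z => D Z z (Y z)) =ᶠ[𝓝 (chartAt F x y)] fun p =>
      fderiv ℝ (localField x Z) p (localField x Y p) +
        (connComponents D x ∘ (chartAt F x).symm) p (localField x Z p) (localField x Y p) := by
  have h1 := ((chartAt F x).continuousAt_symm ((chartAt F x).map_source hy))
  rw [ContinuousAt, (chartAt F x).left_inv hy] at h1
  filter_upwards [h1.eventually hZ.eventually_diffFieldAt,
    (chartAt F x).open_target.mem_nhds ((chartAt F x).map_source hy)] with p hp hpt
  have h2 := tangentCoord_conn D ((chartAt F x).map_target hpt) hp (Y ((chartAt F x).symm p))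
  rw [(chartAt F x).right_inv hpt] at h2
  exact h2

/-- A connection with smooth components maps smooth fields to smooth fields. -/
theorem smoothFieldAt_conn (D : AffineConnection F N) {x y : N} (hy : y ∈ (chartAt F x).source)
    (hΓ : ContMDiffAt 𝓘(ℝ, F) 𝓘(ℝ, F →L[ℝ] F →L[ℝ] F) ∞ (connComponents D x) y)
    {Y Z : VField F N} (hY : SmoothFieldAt Y y) (hZ : SmoothFieldAt Z y) :
    SmoothFieldAt (fun z => D Z z (Y z)) y := by
  rw [smoothFieldAt_iff_localField hy] at hY ⊢
  refine ContDiffAt.congr_of_eventuallyEq ?_ (localField_conn_eventuallyEq D hy hZ)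
  rw [smoothFieldAt_iff_localField hy] at hZ
  rw [contMDiffAt_iff_chart hy] at hΓ
  exact ((hZ.fderiv_right (m := ∞) (by simp)).clm_apply hY).add ((hΓ.clm_apply hZ).clm_apply hY)

/-- The curvature operator in coordinates: all terms involving derivatives of the fields cancel, by
the symmetry of second derivatives and the formula for the bracket.  Hence curvature is a tensor. -/
theorem tangentCoord_curvatureField [CompleteSpace F] (D : AffineConnection F N) {x y : N}
    (hy : y ∈ (chartAt F x).source)
    (hΓ : ContMDiffAt 𝓘(ℝ, F) 𝓘(ℝ, F →L[ℝ] F →L[ℝ] F) ∞ (connComponents D x) y)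
    {X Y Z : VField F N} (hX : SmoothFieldAt X y) (hY : SmoothFieldAt Y y)
    (hZ : SmoothFieldAt Z y) :
    tangentCoord x y (curvatureField D X Y Z y) = curvatureComponents D x y
      (tangentCoord x y (X y)) (tangentCoord x y (Y y)) (tangentCoord x y (Z y)) := by
  -- The coordinate expression of `D_X D_Y Z`.
  have second : ∀ {X Y : VField F N}, SmoothFieldAt X y → SmoothFieldAt Y y →
      tangentCoord x y (D (fun z => D Z z (Y z)) y (X y)) =
        fderiv ℝ (fderiv ℝ (localField x Z)) (chartAt F x y) (tangentCoord x y (X y))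
            (tangentCoord x y (Y y)) +
          fderiv ℝ (localField x Z) (chartAt F x y)
            (fderiv ℝ (localField x Y) (chartAt F x y) (tangentCoord x y (X y))) +
          fderiv ℝ (connComponents D x ∘ (chartAt F x).symm) (chartAt F x y)
            (tangentCoord x y (X y)) (tangentCoord x y (Z y)) (tangentCoord x y (Y y)) +
          connComponents D x y
            (fderiv ℝ (localField x Z) (chartAt F x y) (tangentCoord x y (X y)))
            (tangentCoord x y (Y y)) +
          connComponents D x y (tangentCoord x y (Z y))
            (fderiv ℝ (localField x Y) (chartAt F x y) (tangentCoord x y (X y))) +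
          connComponents D x y
            (fderiv ℝ (localField x Z) (chartAt F x y) (tangentCoord x y (Y y)) +
              connComponents D x y (tangentCoord x y (Z y)) (tangentCoord x y (Y y)))
            (tangentCoord x y (X y)) := by
    intro X Y hX hY
    rw [tangentCoord_conn D hy (smoothFieldAt_conn D hy hΓ hY hZ).diffFieldAt,
      (localField_conn_eventuallyEq D hy hZ).fderiv_eq,
      tangentCoord_conn D hy hZ.diffFieldAt]
    rw [smoothFieldAt_iff_localField hy] at hX hY
    have hZ' := (smoothFieldAt_iff_localField hy).1 hZ
    have hΓ' := (contMDiffAt_iff_chart hy).1 hΓ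
    have dZ := (hZ'.fderiv_right (m := ∞) (by simp)).differentiableAt (by simp)
    have dZ0 := hZ'.differentiableAt (by simp)
    have dY := hY.differentiableAt (by simp)
    have dΓ := hΓ'.differentiableAt (by simp)
    rw [fderiv_fun_add (dZ.clm_apply dY) ((dΓ.clm_apply dZ0).clm_apply dY),
      fderiv_clm_apply dZ dY, fderiv_clm_apply (dΓ.clm_apply dZ0) dY, fderiv_clm_apply dΓ dZ0]
    simp only [add_apply, ContinuousLinearMap.comp_apply, ContinuousLinearMap.flip_apply,
      localField_apply_chart hy, Function.comp_apply, (chartAt F x).left_inv hy]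
    abel
  have hsymm := ((smoothFieldAt_iff_localField hy).1 hZ).isSymmSndFDerivAt (by
      rw [minSmoothness_of_isRCLikeNormedField]; exact ENat.LEInfty.out)
  rw [curvatureField, map_sub, map_sub, second hX hY, second hY hX,
    tangentCoord_conn D hy hZ.diffFieldAt,
    tangentCoord_mlieBracket hy hX.diffFieldAt hY.diffFieldAt, curvatureComponents,
    hsymm.eq (tangentCoord x y (X y)) (tangentCoord x y (Y y))]
  simp only [map_add, map_sub, add_apply]
  abel

theorem smoothFieldAt_extend (x : N) (u : TangentSpace 𝓘(ℝ, F) x) :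
    SmoothFieldAt (FiberBundle.extend F u) x :=
  FiberBundle.contMDiffAt_extend _ _ _

/-- The curvature tensor may be computed with any smooth fields. -/
theorem curvature_eq_curvatureField [CompleteSpace F] (D : AffineConnection F N) {x : N}
    (hΓ : ContMDiffAt 𝓘(ℝ, F) 𝓘(ℝ, F →L[ℝ] F →L[ℝ] F) ∞ (connComponents D x) x)
    {X Y Z : VField F N} (hX : SmoothFieldAt X x) (hY : SmoothFieldAt Y x)
    (hZ : SmoothFieldAt Z x) :
    curvature D x (X x) (Y x) (Z x) = curvatureField D X Y Z x := by
  have hx := mem_chart_source F x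
  apply tangentCoord_injective hx
  rw [curvature, tangentCoord_curvatureField D hx hΓ (smoothFieldAt_extend _ _)
    (smoothFieldAt_extend _ _) (smoothFieldAt_extend _ _),
    tangentCoord_curvatureField D hx hΓ hX hY hZ]
  simp

theorem tangentCoord_curvature [CompleteSpace F] (D : AffineConnection F N) {x : N}
    (hΓ : ContMDiffAt 𝓘(ℝ, F) 𝓘(ℝ, F →L[ℝ] F →L[ℝ] F) ∞ (connComponents D x) x)
    (u v w : TangentSpace 𝓘(ℝ, F) x) :
    tangentCoord x x (curvature D x u v w) = curvatureComponents D x x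
      (tangentCoord x x u) (tangentCoord x x v) (tangentCoord x x w) := by
  have hx := mem_chart_source F x
  rw [curvature, tangentCoord_curvatureField D hx hΓ (smoothFieldAt_extend _ _)
    (smoothFieldAt_extend _ _) (smoothFieldAt_extend _ _)]
  simp

variable [T2Space N]

/-- A vector field which is smooth near a point agrees near this point with a globally smooth
vector field. -/
theorem exists_smoothField_eventuallyEq {Y : VField F N} {x : N}
    (h : ∀ᶠ y in 𝓝 x, SmoothFieldAt Y y) :
    ∃ Y' : VField F N, SmoothField Y' ∧ ∀ᶠ y in 𝓝 x, Y' y = Y y := by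
  obtain ⟨s, hs, hso, hxs⟩ := eventually_nhds_iff.1 h
  obtain ⟨f, -, hf⟩ := (SmoothBumpFunction.nhds_basis_tsupport (I := 𝓘(ℝ, F)) x).mem_iff.1
    (hso.mem_nhds hxs)
  refine ⟨(f : N → ℝ) • Y, ?_, ?_⟩
  · exact ContMDiffOn.smul_section_of_tsupport f.contMDiff.contMDiffOn hso hf
      fun y hy => (hs y hy).contMDiffWithinAt
  · filter_upwards [f.eventuallyEq_one] with y hy
    simp [hy]

theorem exists_smoothField_eventuallyEq_coordVector (x : N) (u : F) :
    ∃ Y : VField F N, SmoothField Y ∧ ∀ᶠ y in 𝓝 x, Y y = coordVector x y u :=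
  exists_smoothField_eventuallyEq (by
    filter_upwards [chart_mem_nhds x (mem_chart_source F x)] with y hy
    exact smoothFieldAt_coordVector hy u)

theorem SmoothField.conn {D : AffineConnection F N} (hD : D.ContMDiffCovariantDerivative ∞)
    {X Y : VField F N} (hX : SmoothField X) (hY : SmoothField Y) :
    SmoothField (fun x => D Y x (X x)) := by
  have h1 := hD.contMDiff.contMDiff (σ := Y) (by simpa using ContMDiff.contMDiffOn hY)
  exact ContMDiff.clm_bundle_apply (contMDiffOn_univ.1 h1) hX

/-- The components of a smooth connection are smooth.  Smoothness of a connection is a statement on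
global fields, so that the coordinate fields have to be extended. -/
theorem contMDiffAt_connComponents {D : AffineConnection F N}
    (hD : D.ContMDiffCovariantDerivative ∞) {x y : N} (hy : y ∈ (chartAt F x).source) :
    ContMDiffAt 𝓘(ℝ, F) 𝓘(ℝ, F →L[ℝ] F →L[ℝ] F) ∞ (connComponents D x) y := by
  have hext : ∀ u : F, ∃ Y : VField F N, SmoothField Y ∧ ∀ᶠ z in 𝓝 y, Y z = coordVector x z u :=
    fun u => exists_smoothField_eventuallyEq (by
      filter_upwards [chart_mem_nhds x hy] with y hy
      exact smoothFieldAt_coordVector hy u)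
  refine contMDiffAt_clm_of_apply fun v => contMDiffAt_clm_of_apply fun u => ?_
  obtain ⟨X, hX, hXu⟩ := hext u
  obtain ⟨Y, hY, hYv⟩ := hext v
  refine ((smoothFieldAt_iff hy).1
    ((SmoothField.conn hD hX hY).smoothFieldAt y)).congr_of_eventuallyEq ?_
  filter_upwards [hXu, hYv.eventually_nhds, chart_mem_nhds x hy] with z hz hz' hzs
  rw [connComponents_apply, hz, conn_congr D (smoothFieldAt_coordVector hzs v).diffFieldAt hz']

end Connections

/-! ### Lifts of functions to the jet bundle -/

section FunctionLift

variable {E : Type*} [NormedAddCommGroup E] [NormedSpace ℝ E]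
  {M : Type*} [TopologicalSpace M] [ChartedSpace E M] [IsManifold 𝓘(ℝ, E) ∞ M]
  {W : Type*} [NormedAddCommGroup W] [NormedSpace ℝ W] {r : ℕ}

/-- The `k`-lift `f^(k)` of a function `f` on `M` to `T^r M`: the `k`-th Taylor coefficient of `f`
along the curve. -/
noncomputable def functionLift (r : ℕ) (k : ℤ) (f : M → W) (j : JetBundle E M r) : W :=
  taylorCoeff k (f ∘ j.rep)

theorem rep_tendsto (j : JetBundle E M r) : Tendsto j.rep (𝓝 0) (𝓝 j.proj) :=
  (Curve.continuous j.rep).continuousAt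

theorem functionLift_congr {f g : M → W} {j : JetBundle E M r} (h : f =ᶠ[𝓝 j.proj] g) (k : ℤ) :
    functionLift r k f j = functionLift r k g j :=
  taylorCoeff_congr (h.comp_tendsto (rep_tendsto j)) k

theorem contDiffAt_comp_rep {f : M → W} {j : JetBundle E M r}
    (hf : ContMDiffAt 𝓘(ℝ, E) 𝓘(ℝ, W) ∞ f j.proj) : ContDiffAt ℝ ∞ (f ∘ j.rep) 0 :=
  contMDiffAt_iff_contDiffAt.1 (hf.comp 0 j.rep.contMDiff.contMDiffAt)

theorem functionLift_add {f g : M → W} {j : JetBundle E M r}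
    (hf : ContMDiffAt 𝓘(ℝ, E) 𝓘(ℝ, W) ∞ f j.proj) (hg : ContMDiffAt 𝓘(ℝ, E) 𝓘(ℝ, W) ∞ g j.proj)
    (k : ℤ) : functionLift r k (fun y => f y + g y) j =
      functionLift r k f j + functionLift r k g j :=
  taylorCoeff_add (contDiffAt_comp_rep hf) (contDiffAt_comp_rep hg) k

theorem functionLift_const_smul (a : ℝ) (f : M → W) (j : JetBundle E M r) (k : ℤ) :
    functionLift r k (fun y => a • f y) j = a • functionLift r k f j :=
  taylorCoeff_const_smul a _ k

theorem functionLift_zero (j : JetBundle E M r) (k : ℤ) :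
    functionLift r k (fun _ => (0 : W)) j = 0 := taylorCoeff_fun_zero k

theorem functionLift_sub {f g : M → W} {j : JetBundle E M r}
    (hf : ContMDiffAt 𝓘(ℝ, E) 𝓘(ℝ, W) ∞ f j.proj) (hg : ContMDiffAt 𝓘(ℝ, E) 𝓘(ℝ, W) ∞ g j.proj)
    (k : ℤ) : functionLift r k (fun y => f y - g y) j =
      functionLift r k f j - functionLift r k g j := by
  have hg' := contDiffAt_comp_rep hg
  have h := taylorCoeff_add (contDiffAt_comp_rep hf) (hg'.const_smul (-1 : ℝ)) k
  simp only [taylorCoeff_const_smul] at h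
  simpa [functionLift, Function.comp_def, sub_eq_add_neg] using h

/-- In a chart, the lift of `f` is the Taylor coefficient of `f` along the polynomial curve. -/
theorem functionLift_eq_polyCurve {x : M} {f : M → W} {j : JetBundle E M r}
    (hj : j.proj ∈ (chartAt E x).source) (hf : ContMDiffAt 𝓘(ℝ, E) 𝓘(ℝ, W) ∞ f j.proj)
    {k : ℤ} (hk : k ≤ r) :
    functionLift r k f j = taylorCoeff k fun t =>
      (f ∘ (chartAt E x).symm) (polyCurve (j.coord (chartAt E x)) t) := by
  rw [functionLift, taylorCoeff_congr (comp_eventuallyEq (γ := j.rep) hj f) k]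
  have h0 : (chartAt E x ∘ j.rep) 0 = chartAt E x j.proj := rfl
  refine taylorCoeff_comp_congr (F := f ∘ (chartAt E x).symm) ?_
    (contDiffAt_chart_comp (chart_mem_atlas E x) hj) (contDiff_polyCurve _).contDiffAt
    fun i hi => ?_
  · rw [h0]
    exact (contMDiffAt_iff_chart hj).1 hf
  · have := taylorCoeff_polyCurve (j.coord (chartAt E x)) ⟨i, by omega⟩
    rw [this]
    rfl

variable [FiniteDimensional ℝ E] [T2Space M]

theorem jetChart_apply (j₀ j : JetBundle E M r) :
    chartAt (Fin (r + 1) → E) j₀ j = j.coord (chartAt E j₀.proj) := rfl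

theorem mem_jetChart_source {j₀ j : JetBundle E M r} :
    j ∈ (chartAt (Fin (r + 1) → E) j₀).source ↔ j.proj ∈ (chartAt E j₀.proj).source := Iff.rfl

theorem mem_jetChart_target {j₀ : JetBundle E M r} {v : Fin (r + 1) → E} :
    v ∈ (chartAt (Fin (r + 1) → E) j₀).target ↔ v 0 ∈ (chartAt E j₀.proj).target := Iff.rfl

theorem proj_tendsto (j : JetBundle E M r) : Tendsto JetBundle.proj (𝓝 j) (𝓝 j.proj) := by
  have hj := mem_chart_source (Fin (r + 1) → E) j
  have hs : j.proj ∈ (chartAt E j.proj).source := mem_chart_source E j.proj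
  have h1 : (JetBundle.proj : JetBundle E M r → M) =ᶠ[𝓝 j] fun j' =>
      (chartAt E j.proj).symm (chartAt (Fin (r + 1) → E) j j' 0) := by
    filter_upwards [(chartAt (Fin (r + 1) → E) j).open_source.mem_nhds hj] with j' hj'
    rw [jetChart_apply, JetBundle.coord_zero, (chartAt E j.proj).left_inv hj']
  refine Tendsto.congr' h1.symm ?_
  have h2 : ContinuousAt (fun j' => chartAt (Fin (r + 1) → E) j j' 0) j :=
    (continuous_apply 0).continuousAt.comp ((chartAt (Fin (r + 1) → E) j).continuousAt hj)
  have h3 : chartAt (Fin (r + 1) → E) j j 0 = chartAt E j.proj j.proj := by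
    rw [jetChart_apply, JetBundle.coord_zero]
  have h4 : ContinuousAt (chartAt E j.proj).symm (chartAt (Fin (r + 1) → E) j j 0) := by
    rw [h3]
    exact (chartAt E j.proj).continuousAt_symm ((chartAt E j.proj).map_source hs)
  have h5 := ContinuousAt.comp (f := fun j' => chartAt (Fin (r + 1) → E) j j' 0) h4 h2
  have h6 : (chartAt E j.proj).symm (chartAt (Fin (r + 1) → E) j j 0) = j.proj := by
    rw [h3, (chartAt E j.proj).left_inv hs]
  rw [ContinuousAt] at h5
  simp only [Function.comp_def] at h5
  rwa [h6] at h5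

/-- A smooth function near `j.proj`, read in a chart, is smooth on an open set of the model space
containing the image of `j.proj`. -/
theorem exists_isOpen_contDiffOn {x y : M} {f : M → W} (hy : y ∈ (chartAt E x).source)
    (hf : ∀ᶠ z in 𝓝 y, ContMDiffAt 𝓘(ℝ, E) 𝓘(ℝ, W) ∞ f z) :
    ∃ U : Set E, IsOpen U ∧ chartAt E x y ∈ U ∧ U ⊆ (chartAt E x).target ∧
      (∀ p ∈ U, ContMDiffAt 𝓘(ℝ, E) 𝓘(ℝ, W) ∞ f ((chartAt E x).symm p)) ∧
      ContDiffOn ℝ ∞ (f ∘ (chartAt E x).symm) U := by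
  obtain ⟨s, hs, hso, hys⟩ := eventually_nhds_iff.1 hf
  refine ⟨(chartAt E x).target ∩ (chartAt E x).symm ⁻¹' s,
    (chartAt E x).isOpen_inter_preimage_symm hso, ⟨(chartAt E x).map_source hy, ?_⟩,
    inter_subset_left, fun p hp => hs _ hp.2, fun p hp => ?_⟩
  · rwa [mem_preimage, (chartAt E x).left_inv hy]
  · have h1 := (contMDiffAt_iff_chart ((chartAt E x).map_target hp.1)).1 (hs _ hp.2)
    rw [(chartAt E x).right_inv hp.1] at h1
    exact h1.contDiffWithinAt

/-- A lifted function, read in a chart of `T^r M`, is the prolongation of the function read in the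
chart of `M`. -/
theorem functionLift_comp_jetChart_symm {j₀ j : JetBundle E M r} {f : M → W}
    (hj : j.proj ∈ (chartAt E j₀.proj).source)
    (hf : ∀ᶠ y in 𝓝 j.proj, ContMDiffAt 𝓘(ℝ, E) 𝓘(ℝ, W) ∞ f y) {k : ℤ} (hk : k ≤ r) :
    functionLift r k f ∘ (chartAt (Fin (r + 1) → E) j₀).symm
      =ᶠ[𝓝 (chartAt (Fin (r + 1) → E) j₀ j)]
      fun v => taylorCoeff k fun t => (f ∘ (chartAt E j₀.proj).symm) (polyCurve v t) := by
  obtain ⟨U, hU, hyU, hUt, hUf, -⟩ := exists_isOpen_contDiffOn hj hf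
  have h1 : {v : Fin (r + 1) → E | v 0 ∈ U} ∈ 𝓝 (chartAt (Fin (r + 1) → E) j₀ j) := by
    refine (hU.preimage (continuous_apply 0)).mem_nhds ?_
    change (j.coord (chartAt E j₀.proj)) 0 ∈ U
    rwa [JetBundle.coord_zero]
  filter_upwards [h1] with v hv
  have hvt : v ∈ (chartAt (Fin (r + 1) → E) j₀).target := mem_jetChart_target.2 (hUt hv)
  have h2 := (chartAt (Fin (r + 1) → E) j₀).map_target hvt
  have h3 : ((chartAt (Fin (r + 1) → E) j₀).symm v).coord (chartAt E j₀.proj) = v :=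
    (chartAt (Fin (r + 1) → E) j₀).right_inv hvt
  have h4 : ((chartAt (Fin (r + 1) → E) j₀).symm v).proj = (chartAt E j₀.proj).symm (v 0) := by
    rw [← (chartAt E j₀.proj).left_inv (mem_jetChart_source.1 h2), ← JetBundle.coord_zero, h3]
  rw [Function.comp_apply, functionLift_eq_polyCurve (mem_jetChart_source.1 h2)
    (by rw [h4]; exact hUf _ hv) hk, h3]

theorem contMDiffAt_functionLift {j : JetBundle E M r} {f : M → W}
    (hf : ∀ᶠ y in 𝓝 j.proj, ContMDiffAt 𝓘(ℝ, E) 𝓘(ℝ, W) ∞ f y) {k : ℤ} (hk : k ≤ r) :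
    ContMDiffAt 𝓘(ℝ, Fin (r + 1) → E) 𝓘(ℝ, W) ∞ (functionLift r k f) j := by
  have hj : j.proj ∈ (chartAt E j.proj).source := mem_chart_source E j.proj
  refine (contMDiffAt_iff_chart (mem_chart_source _ j)).2
    (ContDiffAt.congr_of_eventuallyEq ?_ (functionLift_comp_jetChart_symm hj hf hk))
  obtain ⟨U, hU, hyU, -, -, hfU⟩ := exists_isOpen_contDiffOn hj hf
  refine (contDiffOn_taylorCoeff_polyCurve hU hfU k).contDiffAt
    ((hU.preimage (continuous_apply 0)).mem_nhds ?_)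
  change (j.coord (chartAt E j.proj)) 0 ∈ U
  rwa [JetBundle.coord_zero]

theorem tangentCoord_vectorLift_self (l : ℤ) (X : VField E M) (j : JetBundle E M r)
    (ν : Fin (r + 1)) : tangentCoord j j (vectorLift r l X j) ν =
      functionLift r ((ν : ℕ) + l - r) (fun y => tangentCoord j.proj y (X y)) j := by
  rw [vectorLift, tangentCoord_coordVector (mem_chart_source _ j)]
  rfl

/-- The rule `X^(l) f^(k) = (X f)^(k + l - r)`: the derivative of the prolongation of `f` is the
prolongation of `df`, applied to the polynomial curve which has the Taylor coefficients of
`t^(r - l) X`. -/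
theorem mvfderiv_functionLift_vectorLift {j : JetBundle E M r} {f : M → W}
    (hf : ∀ᶠ y in 𝓝 j.proj, ContMDiffAt 𝓘(ℝ, E) 𝓘(ℝ, W) ∞ f y) {k l : ℤ} (hk : k ≤ r)
    (hl : l ≤ r) {X : VField E M} (hX : SmoothFieldAt X j.proj) :
    mvfderiv 𝓘(ℝ, Fin (r + 1) → E) (functionLift r k f) j (vectorLift r l X j) =
      functionLift r (k + l - r) (fun y => mvfderiv 𝓘(ℝ, E) f y (X y)) j := by
  have hj : j.proj ∈ (chartAt E j.proj).source := mem_chart_source E j.proj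
  have hjj := mem_chart_source (Fin (r + 1) → E) j
  obtain ⟨U, hU, hyU, -, -, hfU⟩ := exists_isOpen_contDiffOn hj hf
  obtain ⟨n, rfl⟩ : ∃ n : ℕ, l = r - n := ⟨(r - l).toNat, by omega⟩
  set e := chartAt E j.proj with he
  have h0 : (j.coord e) 0 ∈ U := by rwa [JetBundle.coord_zero]
  rw [mvfderiv_eq_fderiv hjj ((contMDiffAt_functionLift hf hk).mdifferentiableAt (by simp)),
    (functionLift_comp_jetChart_symm hj hf hk).fderiv_eq, jetChart_apply,
    fderiv_taylorCoeff_polyCurve hU hfU k h0]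
  have hfe : ContDiffAt ℝ ∞ (f ∘ e.symm) (e j.proj) := hfU.contDiffAt (hU.mem_nhds hyU)
  have hG : ContDiffAt ℝ ∞ (fun q : E × E => fderiv ℝ (f ∘ e.symm) q.1 q.2)
      (e j.proj, polyCurve (tangentCoord j j (vectorLift r (r - n) X j)) 0) := by
    refine ContDiffAt.clm_apply ?_ contDiffAt_snd
    exact ContDiffAt.comp (g := fderiv ℝ (f ∘ e.symm)) _
      (hfe.fderiv_right (m := ∞) (by simp)) contDiffAt_fst
  have hXc : ContDiffAt ℝ ∞ (fun t => tangentCoord j.proj (j.rep t) (X (j.rep t))) 0 :=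
    contDiffAt_comp_rep ((smoothFieldAt_iff hj).1 hX)
  have hec : ContDiffAt ℝ ∞ (e ∘ j.rep) 0 := contDiffAt_chart_comp (chart_mem_atlas E _) hj
  have hsm : ContDiffAt ℝ ∞
      (fun t : ℝ => t ^ n • tangentCoord j.proj (j.rep t) (X (j.rep t))) 0 :=
    ContDiffAt.smul (by fun_prop) hXc
  have key := taylorCoeff_comp_congr (k := k)
    (F := fun q : E × E => fderiv ℝ (f ∘ e.symm) q.1 q.2)
    (c₁ := fun t => (polyCurve (j.coord e) t,
      polyCurve (tangentCoord j j (vectorLift r (r - n) X j)) t))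
    (c₂ := fun t => ((e ∘ j.rep) t, t ^ n • tangentCoord j.proj (j.rep t) (X (j.rep t))))
    (by simpa [JetBundle.coord_zero] using hG)
    ((contDiff_polyCurve _).contDiffAt.prodMk (contDiff_polyCurve _).contDiffAt)
    (hec.prodMk hsm) (fun i hi => by
      rw [taylorCoeff_prodMk (contDiff_polyCurve _).contDiffAt (contDiff_polyCurve _).contDiffAt,
        taylorCoeff_prodMk hec hsm, taylorCoeff_polyCurve (j.coord e) ⟨i, by omega⟩,
        taylorCoeff_polyCurve _ ⟨i, by omega⟩, taylorCoeff_pow_smul n hXc,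
        tangentCoord_vectorLift_self]
      refine Prod.ext rfl ?_
      change taylorCoeff ((i : ℤ) + (r - n) - r) _ = _
      rw [show (i : ℤ) + (r - n) - r = i - n by ring]
      rfl)
  refine key.trans ?_
  have hfr : ContDiffAt ℝ ∞ (fun t => fderiv ℝ (f ∘ e.symm) ((e ∘ j.rep) t)
      (tangentCoord j.proj (j.rep t) (X (j.rep t)))) 0 := by
    refine ContDiffAt.clm_apply ?_ hXc
    exact ContDiffAt.comp (g := fderiv ℝ (f ∘ e.symm)) _
      (hfe.fderiv_right (m := ∞) (by simp)) hec
  have h5 : (fun q : E × E => fderiv ℝ (f ∘ e.symm) q.1 q.2) ∘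
      (fun t => ((e ∘ j.rep) t, t ^ n • tangentCoord j.proj (j.rep t) (X (j.rep t)))) =
      fun t => t ^ n • fderiv ℝ (f ∘ e.symm) ((e ∘ j.rep) t)
        (tangentCoord j.proj (j.rep t) (X (j.rep t))) := by
    funext t
    simp
  rw [h5, taylorCoeff_pow_smul n hfr, functionLift]
  have h6 : k + (r - n) - r = k - n := by ring
  rw [h6]
  refine taylorCoeff_congr ?_ _
  filter_upwards [(rep_tendsto j).eventually hf,
    (rep_tendsto j).eventually (chart_mem_nhds j.proj hj)] with t ht hts
  exact (mvfderiv_eq_fderiv hts (ht.mdifferentiableAt (by simp)) _).symm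

end FunctionLift

/-! ### Lifts of vector fields -/

section VectorLift

variable {E : Type*} [NormedAddCommGroup E] [NormedSpace ℝ E] [FiniteDimensional ℝ E]
  {M : Type*} [TopologicalSpace M] [ChartedSpace E M] [IsManifold 𝓘(ℝ, E) ∞ M] [T2Space M]
  {r : ℕ}

theorem mvfderiv_apply_pi {F : Type*} [NormedAddCommGroup F] [NormedSpace ℝ F]
    {N : Type*} [TopologicalSpace N] [ChartedSpace F N] [IsManifold 𝓘(ℝ, F) ∞ N]
    {f : N → Fin (r + 1) → E} {y : N}
    (hf : MDifferentiableAt 𝓘(ℝ, F) 𝓘(ℝ, Fin (r + 1) → E) f y) (v : TangentSpace 𝓘(ℝ, F) y)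
    (ν : Fin (r + 1)) :
    mvfderiv 𝓘(ℝ, F) f y v ν = mvfderiv 𝓘(ℝ, F) (fun z => f z ν) y v := by
  have hy := mem_chart_source F y
  have hp : MDifferentiableAt 𝓘(ℝ, F) 𝓘(ℝ, E) (fun z => f z ν) y :=
    MDifferentiableAt.comp (I' := 𝓘(ℝ, Fin (r + 1) → E)) y
      ((ContinuousLinearMap.proj ν : (Fin (r + 1) → E) →L[ℝ] E).differentiableAt.mdifferentiableAt)
      hf
  rw [mvfderiv_eq_fderiv hy hf, mvfderiv_eq_fderiv hy hp]
  have h1 := mdifferentiableAt_comp_chart_symm hy hf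
  have h2 := ((ContinuousLinearMap.proj ν :
    (Fin (r + 1) → E) →L[ℝ] E).hasFDerivAt.comp _ h1.hasFDerivAt).fderiv
  exact (congrArg (fun L : F →L[ℝ] E => L (tangentCoord y y v)) h2).symm

/-- The components of a lift in the chart around a jet `j₀` at any jet `j` in its domain.  The
definition of the lift at `j` uses the chart around `j` itself; independence of the chart comes from
the action of lifts on the coordinate functions of the chart around `j₀`. -/
theorem tangentCoord_vectorLift {j₀ j : JetBundle E M r}
    (hj : j.proj ∈ (chartAt E j₀.proj).source) {X : VField E M} (hX : SmoothFieldAt X j.proj)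
    {l : ℤ} (hl : l ≤ r) (ν : Fin (r + 1)) :
    tangentCoord j₀ j (vectorLift r l X j) ν =
      functionLift r ((ν : ℕ) + l - r) (fun y => tangentCoord j₀.proj y (X y)) j := by
  have hjj : j ∈ (chartAt (Fin (r + 1) → E) j₀).source := hj
  have hf : ∀ᶠ y in 𝓝 j.proj, ContMDiffAt 𝓘(ℝ, E) 𝓘(ℝ, E) ∞ (chartAt E j₀.proj) y := by
    filter_upwards [chart_mem_nhds j₀.proj hj] with y hy
    exact contMDiffAt_chart hy
  rw [tangentCoord_eq_mvfderiv hjj,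
    mvfderiv_apply_pi ((contMDiffAt_chart hjj).mdifferentiableAt (by simp))]
  refine (mvfderiv_functionLift_vectorLift hf (k := ((ν : ℕ) : ℤ)) (by omega) hl hX).trans ?_
  refine functionLift_congr ?_ _
  filter_upwards [chart_mem_nhds j₀.proj hj] with y hy
  exact (tangentCoord_eq_mvfderiv hy _).symm

theorem vectorLift_congr {X Y : VField E M} {j : JetBundle E M r}
    (h : ∀ᶠ y in 𝓝 j.proj, X y = Y y) (l : ℤ) : vectorLift r l X j = vectorLift r l Y j := by
  refine tangentCoord_injective (mem_chart_source _ j) (funext fun ν => ?_)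
  rw [tangentCoord_vectorLift_self, tangentCoord_vectorLift_self]
  refine functionLift_congr ?_ _
  filter_upwards [h] with y hy
  rw [hy]

theorem vectorLift_zero (l : ℤ) (j : JetBundle E M r) :
    vectorLift r l (fun x => (0 : TangentSpace 𝓘(ℝ, E) x)) j = 0 := by
  refine tangentCoord_injective (mem_chart_source _ j) (funext fun ν => ?_)
  rw [tangentCoord_vectorLift_self, map_zero]
  simp only [map_zero]
  exact functionLift_zero _ _

theorem vectorLift_add {X Y : VField E M} {j : JetBundle E M r} (hX : SmoothFieldAt X j.proj)
    (hY : SmoothFieldAt Y j.proj) (l : ℤ) :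
    vectorLift r l (fun x => X x + Y x) j = vectorLift r l X j + vectorLift r l Y j := by
  have hj := mem_chart_source E j.proj
  refine tangentCoord_injective (mem_chart_source _ j) (funext fun ν => ?_)
  rw [map_add, Pi.add_apply]
  rw [tangentCoord_vectorLift_self, tangentCoord_vectorLift_self, tangentCoord_vectorLift_self,
    ← functionLift_add ((smoothFieldAt_iff hj).1 hX) ((smoothFieldAt_iff hj).1 hY)]
  simp only [map_add]

theorem vectorLift_const_smul (a : ℝ) (X : VField E M) (j : JetBundle E M r) (l : ℤ) :
    vectorLift r l (fun x => a • X x) j = a • vectorLift r l X j := by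
  refine tangentCoord_injective (mem_chart_source _ j) (funext fun ν => ?_)
  rw [map_smul, Pi.smul_apply]
  rw [tangentCoord_vectorLift_self, tangentCoord_vectorLift_self, ← functionLift_const_smul]
  simp only [map_smul]

theorem vectorLift_sub {X Y : VField E M} {j : JetBundle E M r} (hX : SmoothFieldAt X j.proj)
    (hY : SmoothFieldAt Y j.proj) (l : ℤ) :
    vectorLift r l (fun x => X x - Y x) j = vectorLift r l X j - vectorLift r l Y j := by
  have h := vectorLift_add hX (hY.const_smul (-1)) l
  have h2 := vectorLift_const_smul (-1) Y j l
  simp only [neg_smul, one_smul] at h2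
  simp only [Pi.smul_apply, neg_smul, one_smul] at h
  have h3 : vectorLift r l ((-1 : ℝ) • Y) j = -vectorLift r l Y j := by
    rw [← h2]
    refine vectorLift_congr (.of_forall fun y => ?_) l
    simp
  refine Eq.trans ?_ (h.trans ?_)
  · simp only [sub_eq_add_neg]
  · rw [sub_eq_add_neg, ← h3, neg_one_smul]

theorem smoothFieldAt_vectorLift {X : VField E M} (hX : SmoothField X) {l : ℤ} (hl : l ≤ r)
    (j : JetBundle E M r) : SmoothFieldAt (vectorLift r l X) j := by
  have hj := mem_chart_source E j.proj
  have hjj := mem_chart_source (Fin (r + 1) → E) j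
  refine (smoothFieldAt_iff hjj).2 (contMDiffAt_pi_space.2 fun ν => ?_)
  refine (contMDiffAt_functionLift (k := (ν : ℕ) + l - r)
    (f := fun y => tangentCoord j.proj y (X y)) ?_ (by omega)).congr_of_eventuallyEq ?_
  · filter_upwards [chart_mem_nhds j.proj hj] with y hy
    exact (smoothFieldAt_iff hy).1 (hX.smoothFieldAt y)
  · filter_upwards [chart_mem_nhds j hjj] with j' hj'
    exact tangentCoord_vectorLift (mem_jetChart_source.1 hj') (hX.smoothFieldAt _) hl ν

/-- Coordinate fields of `T^r M` are lifts of coordinate fields of `M`: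
`∂/∂xⁱ_a = (∂/∂xⁱ)^(r - a)`. -/
theorem vectorLift_coordVector {j₀ j : JetBundle E M r} (hj : j.proj ∈ (chartAt E j₀.proj).source)
    {u : E} {X : VField E M} (hX : ∀ᶠ y in 𝓝 j.proj, X y = coordVector j₀.proj y u)
    (a : Fin (r + 1)) :
    vectorLift r ((r : ℤ) - (a : ℕ)) X j = coordVector j₀ j (Pi.single a u) := by
  have hjj : j ∈ (chartAt (Fin (r + 1) → E) j₀).source := hj
  refine tangentCoord_injective hjj (funext fun ν => ?_)
  rw [tangentCoord_vectorLift hj ((smoothFieldAt_coordVector hj u).congr hX) (by omega),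
    tangentCoord_coordVector hjj]
  have h1 : (fun y => tangentCoord j₀.proj y (X y)) =ᶠ[𝓝 j.proj] fun _ => u := by
    filter_upwards [hX, chart_mem_nhds j₀.proj hj] with y hy hys
    rw [hy, tangentCoord_coordVector hys]
  rw [functionLift_congr h1]
  refine (taylorCoeff_const u _).trans ?_
  rcases eq_or_ne ν a with rfl | h
  · rw [Pi.single_eq_same, if_pos (by ring)]
  · rw [Pi.single_eq_of_ne h, if_neg fun h' => h (Fin.ext (by omega))]

/-- Lifts of smooth fields span the tangent spaces of `T^r M`; the fields may be taken to be
coordinate fields near the base point. -/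
theorem exists_eq_sum_vectorLift (j : JetBundle E M r)
    (U : TangentSpace 𝓘(ℝ, Fin (r + 1) → E) j) :
    ∃ X : Fin (r + 1) → VField E M, (∀ a, SmoothField (X a)) ∧
      (∀ a, ∀ᶠ y in 𝓝 j.proj, X a y = coordVector j.proj y (tangentCoord j j U a)) ∧
      U = ∑ a : Fin (r + 1), vectorLift r ((r : ℤ) - (a : ℕ)) (X a) j := by
  choose X hX hX' using fun a : Fin (r + 1) =>
    exists_smoothField_eventuallyEq_coordVector j.proj (tangentCoord j j U a)
  refine ⟨X, hX, hX', ?_⟩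
  have h1 : ∀ a : Fin (r + 1), vectorLift r ((r : ℤ) - (a : ℕ)) (X a) j =
      coordVector j j (Pi.single a (tangentCoord j j U a)) := fun a =>
    vectorLift_coordVector (mem_chart_source E j.proj) (hX' a) a
  simp only [h1]
  rw [← map_sum, Finset.univ_sum_single]
  exact (coordVector_tangentCoord (mem_chart_source _ j) U).symm

theorem mlieBracket_eq_zero {F : Type*} [NormedAddCommGroup F] [NormedSpace ℝ F]
    [CompleteSpace F] {N : Type*} [TopologicalSpace N] [ChartedSpace F N] [IsManifold 𝓘(ℝ, F) ∞ N]
    {x y : N} (hy : y ∈ (chartAt F x).source) {u v : F} {X Y : VField F N}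
    (hX : ∀ᶠ z in 𝓝 y, X z = coordVector x z u) (hY : ∀ᶠ z in 𝓝 y, Y z = coordVector x z v) :
    VectorField.mlieBracket 𝓘(ℝ, F) X Y y = 0 :=
  (Filter.EventuallyEq.mlieBracket_vectorField_eq hX hY).trans (mlieBracket_coordVector hy u v)

/-- Lifts of coordinate fields commute. -/
theorem mlieBracket_vectorLift {j : JetBundle E M r} {u v : E} {X Y : VField E M}
    (hX : ∀ᶠ y in 𝓝 j.proj, X y = coordVector j.proj y u)
    (hY : ∀ᶠ y in 𝓝 j.proj, Y y = coordVector j.proj y v) (a b : Fin (r + 1)) :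
    VectorField.mlieBracket 𝓘(ℝ, Fin (r + 1) → E) (vectorLift r ((r : ℤ) - (a : ℕ)) X)
      (vectorLift r ((r : ℤ) - (b : ℕ)) Y) j = 0 := by
  have hjj := mem_chart_source (Fin (r + 1) → E) j
  have key : ∀ {w : E} {Z : VField E M} (c : Fin (r + 1)),
      (∀ᶠ y in 𝓝 j.proj, Z y = coordVector j.proj y w) →
      ∀ᶠ j' in 𝓝 j, vectorLift r ((r : ℤ) - (c : ℕ)) Z j' = coordVector j j' (Pi.single c w) := by
    intro w Z c hZ
    filter_upwards [(proj_tendsto j).eventually (eventually_eventually_nhds.2 hZ),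
      chart_mem_nhds j hjj] with j' hj' hs
    exact vectorLift_coordVector (mem_jetChart_source.1 hs) hj' c
  have : CompleteSpace (Fin (r + 1) → E) := FiniteDimensional.complete ℝ _
  exact mlieBracket_eq_zero hjj (key a hX) (key b hY)

end VectorLift

/-! ### Complete lifts of metrics -/

section Metric

variable {F : Type*} [NormedAddCommGroup F] [NormedSpace ℝ F]
  {N : Type*} [TopologicalSpace N] [ChartedSpace F N] [IsManifold 𝓘(ℝ, F) ∞ N]

theorem IsPseudoRiemannian.contMDiffAt_apply {g : BilinField F N} (hg : IsPseudoRiemannian g)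
    {y : N} {Y Z : VField F N} (hY : SmoothFieldAt Y y) (hZ : SmoothFieldAt Z y) :
    ContMDiffAt 𝓘(ℝ, F) 𝓘(ℝ, ℝ) ∞ (fun z => g z (Y z) (Z z)) y := by
  have h1 := ContMDiffAt.clm_bundle_apply₂ (E₃ := fun _ : N => ℝ) (F₃ := ℝ)
    (hg.smooth.contMDiffAt (x := y)) hY hZ
  exact (Bundle.contMDiffAt_totalSpace.1 h1).2

theorem localMetric_apply (g : BilinField F N) (x y : N) (u v : F) :
    localMetric g x y u v = g y (coordVector x y u) (coordVector x y v) := rfl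

theorem localMetric_tangentCoord (g : BilinField F N) {x y : N} (hy : y ∈ (chartAt F x).source)
    (v w : TangentSpace 𝓘(ℝ, F) y) :
    localMetric g x y (tangentCoord x y v) (tangentCoord x y w) = g y v w := by
  rw [localMetric_apply, coordVector_tangentCoord hy, coordVector_tangentCoord hy]

variable [FiniteDimensional ℝ F]

theorem IsPseudoRiemannian.contMDiffAt_localMetric {g : BilinField F N}
    (hg : IsPseudoRiemannian g) {x y : N} (hy : y ∈ (chartAt F x).source) :
    ContMDiffAt 𝓘(ℝ, F) 𝓘(ℝ, F →L[ℝ] F →L[ℝ] ℝ) ∞ (localMetric g x) y :=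
  contMDiffAt_clm_of_apply fun u => contMDiffAt_clm_of_apply fun v =>
    hg.contMDiffAt_apply (smoothFieldAt_coordVector hy u) (smoothFieldAt_coordVector hy v)

/-- A field of bilinear forms with smooth components is smooth. -/
theorem contMDiffAt_bilinField {g : BilinField F N} {y : N}
    (h : ContMDiffAt 𝓘(ℝ, F) 𝓘(ℝ, F →L[ℝ] F →L[ℝ] ℝ) ∞ (localMetric g y) y) :
    ContMDiffAt 𝓘(ℝ, F) (𝓘(ℝ, F).prod 𝓘(ℝ, F →L[ℝ] F →L[ℝ] ℝ)) ∞
    (fun x => Bundle.TotalSpace.mk' (F →L[ℝ] F →L[ℝ] ℝ)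
      (E := fun x : N => TangentSpace 𝓘(ℝ, F) x →L[ℝ] TangentSpace 𝓘(ℝ, F) x →L[ℝ] ℝ) x (g x)) y := by
  refine (contMDiffAt_hom_bundle _).2 ⟨contMDiffAt_id, h.congr_of_eventuallyEq ?_⟩
  filter_upwards [chart_mem_nhds y (mem_chart_source F y)] with z hz
  ext u v
  refine (inCoordinates_apply_eq₂ (E₃ := fun _ : N => ℝ) hz hz (mem_univ z)).trans ?_
  rw [localMetric_apply, coordVector, Bundle.Trivialization.symmL_apply _ hz,
    Bundle.Trivialization.symmL_apply _ hz]
  simp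

end Metric

section MetricLift

variable {E : Type*} [NormedAddCommGroup E] [NormedSpace ℝ E] [FiniteDimensional ℝ E]
  {M : Type*} [TopologicalSpace M] [ChartedSpace E M] [IsManifold 𝓘(ℝ, E) ∞ M] [T2Space M]
  {r : ℕ}

theorem metricLift_apply (g : BilinField E M) (j : JetBundle E M r)
    (U V : TangentSpace 𝓘(ℝ, Fin (r + 1) → E) j) :
    metricLift r g j U V = ∑ a : Fin (r + 1), ∑ b : Fin (r + 1),
      taylorCoeff ((r : ℤ) - (a : ℕ) - (b : ℕ)) (localMetric g j.proj ∘ j.rep)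
        (tangentCoord j j U a) (tangentCoord j j V b) := by
  simp only [metricLift, sum_apply]
  rfl

/-- The components of a lift `X^(l)` are the Taylor coefficients of the curve `t^(r - l) X`. -/
theorem tangentCoord_vectorLift_eq_taylorCoeff {j : JetBundle E M r} {X : VField E M}
    (hX : SmoothFieldAt X j.proj) (n : ℕ) (ν : Fin (r + 1)) :
    tangentCoord j j (vectorLift r ((r : ℤ) - n) X j) ν = taylorCoeff ((ν : ℕ) : ℤ)
      fun t => t ^ n • tangentCoord j.proj (j.rep t) (X (j.rep t)) := by
  have hXc : ContDiffAt ℝ ∞ (fun t => tangentCoord j.proj (j.rep t) (X (j.rep t))) 0 :=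
    contDiffAt_comp_rep ((smoothFieldAt_iff (mem_chart_source E j.proj)).1 hX)
  rw [tangentCoord_vectorLift_self, taylorCoeff_pow_smul n hXc]
  change taylorCoeff _ _ = _
  rw [show ((ν : ℕ) : ℤ) + (r - n) - r = (ν : ℕ) - n by ring]
  rfl

/-- Contraction of a bilinear map, lifted by the Leibniz rule, with lifts of vector fields. -/
theorem sum_taylorCoeff_vectorLift {W : Type*} [NormedAddCommGroup W] [NormedSpace ℝ W]
    {B : M → E →L[ℝ] E →L[ℝ] W} {j : JetBundle E M r}
    (hB : ContMDiffAt 𝓘(ℝ, E) 𝓘(ℝ, E →L[ℝ] E →L[ℝ] W) ∞ B j.proj) {X Y : VField E M}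
    (hX : SmoothFieldAt X j.proj) (hY : SmoothFieldAt Y j.proj) {k l m : ℤ} (hk : k ≤ r)
    (hl : l ≤ r) (hm : m ≤ r) :
    ∑ a : Fin (r + 1), ∑ b : Fin (r + 1), taylorCoeff (k - (a : ℕ) - (b : ℕ)) (B ∘ j.rep)
        (tangentCoord j j (vectorLift r l X j) a) (tangentCoord j j (vectorLift r m Y j) b) =
      functionLift r (k + l + m - 2 * r)
        (fun y => B y (tangentCoord j.proj y (X y)) (tangentCoord j.proj y (Y y))) j := by
  have hj := mem_chart_source E j.proj
  obtain ⟨p, rfl⟩ : ∃ n : ℕ, l = r - n := ⟨(r - l).toNat, by omega⟩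
  obtain ⟨q, rfl⟩ : ∃ n : ℕ, m = r - n := ⟨(r - m).toNat, by omega⟩
  simp only [tangentCoord_vectorLift_eq_taylorCoeff hX, tangentCoord_vectorLift_eq_taylorCoeff hY]
  have hBc := contDiffAt_comp_rep hB
  have hXc : ContDiffAt ℝ ∞ (fun t => tangentCoord j.proj (j.rep t) (X (j.rep t))) 0 :=
    contDiffAt_comp_rep ((smoothFieldAt_iff hj).1 hX)
  have hYc : ContDiffAt ℝ ∞ (fun t => tangentCoord j.proj (j.rep t) (Y (j.rep t))) 0 :=
    contDiffAt_comp_rep ((smoothFieldAt_iff hj).1 hY)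
  have hXp : ContDiffAt ℝ ∞ (fun t : ℝ => t ^ p • tangentCoord j.proj (j.rep t) (X (j.rep t))) 0 :=
    ContDiffAt.smul (by fun_prop) hXc
  have hYp : ContDiffAt ℝ ∞ (fun t : ℝ => t ^ q • tangentCoord j.proj (j.rep t) (Y (j.rep t))) 0 :=
    ContDiffAt.smul (by fun_prop) hYc
  rw [← taylorCoeff_clm_apply₂ hBc hXp hYp hk]
  have h1 : (fun t : ℝ => (B ∘ j.rep) t (t ^ p • tangentCoord j.proj (j.rep t) (X (j.rep t)))
      (t ^ q • tangentCoord j.proj (j.rep t) (Y (j.rep t)))) = fun t => t ^ (p + q) •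
      (B ∘ j.rep) t (tangentCoord j.proj (j.rep t) (X (j.rep t)))
        (tangentCoord j.proj (j.rep t) (Y (j.rep t))) := by
    funext t
    simp only [map_smul, smul_apply, smul_smul, pow_add, mul_comm]
  rw [h1, taylorCoeff_pow_smul _ ((hBc.clm_apply hXc).clm_apply hYc), functionLift]
  congr 1
  push_cast
  ring

/-- The characterization of the complete lift of a metric:
`g^c(X^(l), Y^(m)) = g(X, Y)^(l + m - r)`. -/
theorem metricLift_vectorLift {g : BilinField E M} (hg : IsPseudoRiemannian g)
    {j : JetBundle E M r} {X Y : VField E M}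
    (hX : SmoothFieldAt X j.proj) (hY : SmoothFieldAt Y j.proj) {l m : ℤ}
    (hl : l ≤ r) (hm : m ≤ r) :
    metricLift r g j (vectorLift r l X j) (vectorLift r m Y j) =
      functionLift r (l + m - r) (fun y => g y (X y) (Y y)) j := by
  have hj := mem_chart_source E j.proj
  rw [metricLift_apply, sum_taylorCoeff_vectorLift (hg.contMDiffAt_localMetric hj) hX hY le_rfl
    hl hm, show (r : ℤ) + l + m - 2 * r = l + m - r by ring]
  refine functionLift_congr ?_ _
  filter_upwards [chart_mem_nhds j.proj hj] with y hy
  exact localMetric_tangentCoord g hy _ _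

theorem metricLift_symm {g : BilinField E M} (hg : IsPseudoRiemannian g)
    (j : JetBundle E M r) (U V : TangentSpace 𝓘(ℝ, Fin (r + 1) → E) j) :
    metricLift r g j U V = metricLift r g j V U := by
  have hsymm : ∀ (x y : M) (u v : E), localMetric g x y u v = localMetric g x y v u :=
    fun x y u v => hg.symm _ _ _
  have hc : ∀ (k : ℤ) (u v : E), taylorCoeff k (localMetric g j.proj ∘ j.rep) u v =
      taylorCoeff k (localMetric g j.proj ∘ j.rep) v u := by
    intro k u v
    have hB := contDiffAt_comp_rep (hg.contMDiffAt_localMetric (mem_chart_source E j.proj))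
    have h1 : ∀ u v : E, taylorCoeff k (fun t => (localMetric g j.proj ∘ j.rep) t u v) =
        taylorCoeff k (localMetric g j.proj ∘ j.rep) u v := by
      intro u v
      exact taylorCoeff_clm ((ContinuousLinearMap.apply ℝ ℝ v).comp
        (ContinuousLinearMap.apply ℝ (E →L[ℝ] ℝ) u)) hB k
    rw [← h1, ← h1]
    simp only [Function.comp_apply, hsymm j.proj _ u v]
  rw [metricLift_apply, metricLift_apply, Finset.sum_comm]
  refine Finset.sum_congr rfl fun b _ => Finset.sum_congr rfl fun a _ => ?_
  rw [hc, sub_right_comm]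

/-- Nondegeneracy is triangular: if the components `U_a` with `a < n` vanish, then the `n`-th Taylor
coefficient of `g(u, ·)` is `g(U_n, ·)` at the base point. -/
theorem metricLift_nondegenerate {g : BilinField E M} (hg : IsPseudoRiemannian g)
    (j : JetBundle E M r) (U : TangentSpace 𝓘(ℝ, Fin (r + 1) → E) j)
    (hU : ∀ V, metricLift r g j U V = 0) : U = 0 := by
  have hj := mem_chart_source E j.proj
  have hjj := mem_chart_source (Fin (r + 1) → E) j
  -- Testing against `∂/∂xⁱ_{r - k}`: the `k`-th Taylor coefficient of `g(u, ∂/∂xⁱ)` vanishes.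
  have h1 : ∀ (k : Fin (r + 1)) (v : E), ∑ a : Fin (r + 1),
      taylorCoeff ((k : ℕ) - (a : ℕ) : ℤ) (localMetric g j.proj ∘ j.rep)
        (tangentCoord j j U a) v = 0 := by
    intro k v
    have h := hU (coordVector j j (Pi.single (Fin.rev k) v))
    rw [metricLift_apply, tangentCoord_coordVector hjj] at h
    rw [← h]
    refine Finset.sum_congr rfl fun a _ => ?_
    rw [Finset.sum_eq_single (Fin.rev k), Pi.single_eq_same, Fin.val_rev,
      show (r : ℤ) - (a : ℕ) - ((r + 1 - ((k : ℕ) + 1) : ℕ) : ℤ) = (k : ℕ) - (a : ℕ) by omega]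
    · intro b _ hb
      rw [Pi.single_eq_of_ne hb, map_zero]
    · simp
  have h2 : ∀ (n : ℕ) (hn : n < r + 1), tangentCoord j j U ⟨n, hn⟩ = 0 := by
    intro n
    induction n using Nat.strong_induction_on with
    | _ n ih =>
    intro hn
    have h3 : ∀ v : E, localMetric g j.proj j.proj (tangentCoord j j U ⟨n, hn⟩) v = 0 := by
      intro v
      have h := h1 ⟨n, hn⟩ v
      rw [Finset.sum_eq_single ⟨n, hn⟩, sub_self, taylorCoeff_zero] at h
      · exact h
      · intro a _ ha
        rcases lt_or_ge (a : ℕ) n with h' | h'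
        · have : tangentCoord j j U a = 0 := ih a h' a.2
          rw [this, map_zero, zero_apply]
        · have : (a : ℕ) ≠ n := fun h'' => ha (Fin.ext h'')
          have h'' : ((n : ℤ) - (a : ℕ)) < 0 := by omega
          rw [taylorCoeff_of_neg h'']
          rfl
      · simp
    have h4 := hg.nondegenerate j.proj (coordVector j.proj j.proj (tangentCoord j j U ⟨n, hn⟩))
      fun w => by
        rw [← h3 (tangentCoord j.proj j.proj w), localMetric_apply, coordVector_tangentCoord hj]
    rw [← tangentCoord_coordVector hj (tangentCoord j j U ⟨n, hn⟩), h4, map_zero]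
  refine tangentCoord_injective hjj ?_
  rw [map_zero]
  exact funext fun ν => h2 ν ν.2

theorem contMDiffAt_clm_pi_of_single {N : Type*} [TopologicalSpace N]
    [ChartedSpace (Fin (r + 1) → E) N] [IsManifold 𝓘(ℝ, Fin (r + 1) → E) ∞ N] {W : Type*} [NormedAddCommGroup W] [NormedSpace ℝ W]
    {f : N → (Fin (r + 1) → E) →L[ℝ] W} {y : N}
    (h : ∀ a u, ContMDiffAt 𝓘(ℝ, Fin (r + 1) → E) 𝓘(ℝ, W) ∞ (fun z => f z (Pi.single a u)) y) :
    ContMDiffAt 𝓘(ℝ, Fin (r + 1) → E) 𝓘(ℝ, (Fin (r + 1) → E) →L[ℝ] W) ∞ f y := by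
  refine contMDiffAt_clm_of_apply fun u => ?_
  have h1 : (fun z => f z u) = fun z => ∑ a, f z (Pi.single a (u a)) := by
    funext z
    rw [← map_sum, Finset.univ_sum_single]
  rw [h1]
  exact contMDiffAt_finsetSum fun a _ => h a (u a)

/-- The complete lift of a pseudo-Riemannian metric is a pseudo-Riemannian metric. -/
theorem IsPseudoRiemannian.metricLift {g : BilinField E M} (hg : IsPseudoRiemannian g) :
    IsPseudoRiemannian (metricLift r g) where
  symm := metricLift_symm hg
  nondegenerate := metricLift_nondegenerate hg
  smooth := fun j => by
    have hj := mem_chart_source E j.proj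
    refine contMDiffAt_bilinField (contMDiffAt_clm_pi_of_single fun a u => ?_)
    refine contMDiffAt_clm_pi_of_single fun b v => ?_
    have hsm : ∀ᶠ y in 𝓝 j.proj, ContMDiffAt 𝓘(ℝ, E) 𝓘(ℝ, ℝ) ∞
        (fun z => g z (coordVector j.proj z u) (coordVector j.proj z v)) y := by
      filter_upwards [chart_mem_nhds j.proj hj] with y hy
      exact hg.contMDiffAt_apply (smoothFieldAt_coordVector hy u) (smoothFieldAt_coordVector hy v)
    refine (contMDiffAt_functionLift (r := r) (k := (r : ℤ) - (a : ℕ) - (b : ℕ)) hsm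
      (by omega)).congr_of_eventuallyEq ?_
    filter_upwards [chart_mem_nhds j (mem_chart_source (Fin (r + 1) → E) j)] with j' hj'
    have hj'' := mem_jetChart_source.1 hj'
    rw [localMetric_apply, ← vectorLift_coordVector hj'' (.of_forall fun _ => rfl) a,
      ← vectorLift_coordVector hj'' (.of_forall fun _ => rfl) b,
      metricLift_vectorLift hg (smoothFieldAt_coordVector hj'' u)
        (smoothFieldAt_coordVector hj'' v) (by omega) (by omega)]
    congr 1
    ring

end MetricLift

/-! ### Complete lifts of connections -/

section SmoothConnection

variable {F : Type*} [NormedAddCommGroup F] [NormedSpace ℝ F] [FiniteDimensional ℝ F]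
  {N : Type*} [TopologicalSpace N] [ChartedSpace F N] [IsManifold 𝓘(ℝ, F) ∞ N]

/-- A connection with smooth components is smooth. -/
theorem contMDiffCovariantDerivative_of_connComponents {D : AffineConnection F N}
    (h : ∀ x, ContMDiffAt 𝓘(ℝ, F) 𝓘(ℝ, F →L[ℝ] F →L[ℝ] F) ∞ (connComponents D x) x) :
    D.ContMDiffCovariantDerivative ∞ := by
  refine ⟨⟨fun {Y} hY => ?_⟩⟩
  have hY' : SmoothField Y := by
    have h1 := contMDiffOn_univ.1 hY
    exact h1
  refine contMDiffOn_univ.2 fun x => (contMDiffAt_hom_bundle _).2 ⟨contMDiffAt_id, ?_⟩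
  have hx := mem_chart_source F x
  exact contMDiffAt_clm_of_apply fun u => (smoothFieldAt_iff hx).1
    (smoothFieldAt_conn D hx (h x) (smoothFieldAt_coordVector hx u) (hY' x))

/-- Whether two connections agree on a field at a point only depends on the value of the field there,
because their difference is a tensor. -/
theorem conn_eq_of_pointwise {D D' : AffineConnection F N} {x : N} {Y Z : VField F N}
    (hY : DiffFieldAt Y x) (hZ : DiffFieldAt Z x) (hYZ : Y x = Z x) (h : D Z x = D' Z x) :
    D Y x = D' Y x := by
  have hx := mem_chart_source F x
  ext1 v
  have h1 := congrArg (fun L => tangentCoord x x (L v)) h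
  rw [tangentCoord_conn D hx hZ, tangentCoord_conn D' hx hZ, ← hYZ] at h1
  apply tangentCoord_injective hx
  rw [tangentCoord_conn D hx hY, tangentCoord_conn D' hx hY]
  exact congrArg _ (add_left_cancel h1)

end SmoothConnection

section ConnLift

variable {E : Type*} [NormedAddCommGroup E] [NormedSpace ℝ E] [FiniteDimensional ℝ E]
  {M : Type*} [TopologicalSpace M] [ChartedSpace E M] [IsManifold 𝓘(ℝ, E) ∞ M] [T2Space M]
  {r : ℕ}

theorem connComponentsLift_apply (D : AffineConnection E M) (j : JetBundle E M r)
    (V U : Fin (r + 1) → E) (κ : Fin (r + 1)) :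
    connComponentsLift r D j V U κ = ∑ b : Fin (r + 1), ∑ a : Fin (r + 1),
      taylorCoeff (((κ : ℕ) : ℤ) - (b : ℕ) - (a : ℕ)) (connComponents D j.proj ∘ j.rep)
        (V b) (U a) := by
  rw [Finset.sum_comm]
  simp only [connComponentsLift, ContinuousLinearMap.coe_pi', sum_apply]
  refine Finset.sum_congr rfl fun a _ => Finset.sum_congr rfl fun b _ => ?_
  rw [sub_right_comm]
  rfl

theorem tangentCoord_connLift (D : AffineConnection E M) (j : JetBundle E M r)
    (W : VField (Fin (r + 1) → E) (JetBundle E M r)) (U : TangentSpace 𝓘(ℝ, Fin (r + 1) → E) j) :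
    tangentCoord j j (connLift r D W j U) =
      mvfderiv 𝓘(ℝ, Fin (r + 1) → E) (fun j' => tangentCoord j j' (W j')) j U +
        connComponentsLift r D j (tangentCoord j j (W j)) (tangentCoord j j U) :=
  tangentCoord_coordVector (mem_chart_source _ j) _

/-- The rule `∇^c_{X^(l)} Y^(m) = (∇_X Y)^(l + m - r)`. -/
theorem connLift_vectorLift {D : AffineConnection E M} (hD : D.ContMDiffCovariantDerivative ∞)
    {X Y : VField E M} (hX : SmoothField X) (hY : SmoothField Y) {l m : ℤ} (hl : l ≤ r)
    (hm : m ≤ r) (j : JetBundle E M r) :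
    connLift r D (vectorLift r m Y) j (vectorLift r l X j) =
      vectorLift r (l + m - r) (fun x => D Y x (X x)) j := by
  have hj := mem_chart_source E j.proj
  have hjj := mem_chart_source (Fin (r + 1) → E) j
  refine tangentCoord_injective hjj (funext fun κ => ?_)
  rw [tangentCoord_connLift, Pi.add_apply, connComponentsLift_apply,
    sum_taylorCoeff_vectorLift (contMDiffAt_connComponents hD hj) (hY _) (hX _) (by omega) hm hl,
    mvfderiv_apply_pi ((diffFieldAt_iff hjj).1 (smoothFieldAt_vectorLift hY hm j).diffFieldAt),
    tangentCoord_vectorLift_self]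
  have hYs : ∀ᶠ y in 𝓝 j.proj, ContMDiffAt 𝓘(ℝ, E) 𝓘(ℝ, E) ∞
      (fun z => tangentCoord j.proj z (Y z)) y := by
    filter_upwards [chart_mem_nhds j.proj hj] with y hy
    exact (smoothFieldAt_iff hy).1 (hY y)
  have h1 : (fun j' => tangentCoord j j' (vectorLift r m Y j') κ) =ᶠ[𝓝 j]
      functionLift r ((κ : ℕ) + m - r) fun z => tangentCoord j.proj z (Y z) := by
    filter_upwards [chart_mem_nhds j hjj] with j' hj'
    exact tangentCoord_vectorLift (mem_jetChart_source.1 hj') (hY _) hm κ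
  rw [mvfderiv_congr h1, mvfderiv_functionLift_vectorLift hYs (by omega) hl (hX _)]
  rw [show ((κ : ℕ) : ℤ) + m - r + l - r = (κ : ℕ) + (l + m - r) - r by ring,
    show ((κ : ℕ) : ℤ) + m + l - 2 * r = (κ : ℕ) + (l + m - r) - r by ring]
  have hXc := (smoothFieldAt_iff hj).1 (hX j.proj)
  have hYc := (smoothFieldAt_iff hj).1 (hY j.proj)
  have hDc := (smoothFieldAt_iff hj).1 ((hX.conn hD hY) j.proj)
  have hΓ := ((contMDiffAt_connComponents hD hj).clm_apply hYc).clm_apply hXc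
  -- The derivative of `Y` along `X` is smooth, as the difference of two smooth functions.
  have h2 : (fun y => mvfderiv 𝓘(ℝ, E) (fun z => tangentCoord j.proj z (Y z)) y (X y))
      =ᶠ[𝓝 j.proj] fun y => tangentCoord j.proj y (D Y y (X y)) -
        connComponents D j.proj y (tangentCoord j.proj y (Y y)) (tangentCoord j.proj y (X y)) := by
    filter_upwards [chart_mem_nhds j.proj hj] with y hy
    rw [tangentCoord_conn D hy (hY.diffFieldAt y), add_sub_cancel_right,
      mvfderiv_eq_fderiv hy ((diffFieldAt_iff hy).1 (hY.diffFieldAt y))]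
    rfl
  rw [functionLift_congr h2, functionLift_sub hDc hΓ, sub_add_cancel]

/-- On coordinate fields of `T^r M`, which are lifts, the lifted connection takes values in lifts of
smooth fields, which are smooth. -/
theorem contMDiffAt_connComponents_connLift {D : AffineConnection E M}
    (hD : D.ContMDiffCovariantDerivative ∞) (j : JetBundle E M r) :
    ContMDiffAt 𝓘(ℝ, Fin (r + 1) → E)
      𝓘(ℝ, (Fin (r + 1) → E) →L[ℝ] (Fin (r + 1) → E) →L[ℝ] (Fin (r + 1) → E)) ∞
      (connComponents (connLift r D) j) j := by
  have hjj := mem_chart_source (Fin (r + 1) → E) j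
  refine contMDiffAt_clm_pi_of_single fun b v => contMDiffAt_clm_pi_of_single fun a u => ?_
  obtain ⟨X, hX, hXu⟩ := exists_smoothField_eventuallyEq_coordVector j.proj u
  obtain ⟨Y, hY, hYv⟩ := exists_smoothField_eventuallyEq_coordVector j.proj v
  refine ((smoothFieldAt_iff hjj).1 (smoothFieldAt_vectorLift (hX.conn hD hY)
    (l := (r : ℤ) - (a : ℕ) + ((r : ℤ) - (b : ℕ)) - r) (by omega) j)).congr_of_eventuallyEq ?_
  have hev : ∀ᶠ j' in 𝓝 j, (∀ᶠ y in 𝓝 j'.proj, X y = coordVector j.proj y u) ∧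
      (∀ᶠ y in 𝓝 j'.proj, Y y = coordVector j.proj y v) ∧ j'.proj ∈ (chartAt E j.proj).source := by
    filter_upwards [(proj_tendsto j).eventually (eventually_eventually_nhds.2 hXu),
      (proj_tendsto j).eventually (eventually_eventually_nhds.2 hYv), chart_mem_nhds j hjj]
      with j' h1 h2 h3
    exact ⟨h1, h2, mem_jetChart_source.1 h3⟩
  filter_upwards [eventually_eventually_nhds.2 hev] with j' hj'
  obtain ⟨h1, h2, h3⟩ := hj'.self_of_nhds
  rw [connComponents_apply, ← vectorLift_coordVector h3 h1 a,
    conn_congr (connLift r D) (smoothFieldAt_vectorLift hY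
      (show (r : ℤ) - (b : ℕ) ≤ r by omega) j').diffFieldAt
      (hj'.mono fun j'' h => (vectorLift_coordVector h.2.2 h.2.1 b).symm),
    connLift_vectorLift hD hX hY (by omega) (by omega)]

/-- The complete lift of a smooth connection is smooth. -/
theorem contMDiffCovariantDerivative_connLift {D : AffineConnection E M}
    (hD : D.ContMDiffCovariantDerivative ∞) : (connLift r D).ContMDiffCovariantDerivative ∞ :=
  contMDiffCovariantDerivative_of_connComponents (contMDiffAt_connComponents_connLift hD)

theorem isCompleteLift_connLift {D : AffineConnection E M}
    (hD : D.ContMDiffCovariantDerivative ∞) : IsCompleteLift r D (connLift r D) :=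
  fun X Y hX hY l m hl hm j => connLift_vectorLift hD hX hY (by exact_mod_cast hl)
    (by exact_mod_cast hm) j

/-- A covariant derivative of an arbitrary field on `T^r M` is determined by those of lifts. -/
theorem connEq_of_vectorLift {D₁ D₂ : AffineConnection (Fin (r + 1) → E) (JetBundle E M r)}
    (h : ∀ X Y : VField E M, SmoothField X → SmoothField Y → ∀ a b : Fin (r + 1),
      ∀ j : JetBundle E M r,
        D₁ (vectorLift r ((r : ℤ) - (b : ℕ)) Y) j (vectorLift r ((r : ℤ) - (a : ℕ)) X j) =
        D₂ (vectorLift r ((r : ℤ) - (b : ℕ)) Y) j (vectorLift r ((r : ℤ) - (a : ℕ)) X j)) :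
    ConnEq D₁ D₂ := by
  intro j W hW
  obtain ⟨Y, hY, -, hWY⟩ := exists_eq_sum_vectorLift j (W j)
  have hYd : ∀ b : Fin (r + 1), DiffFieldAt (vectorLift r ((r : ℤ) - (b : ℕ)) (Y b)) j := fun b =>
    (smoothFieldAt_vectorLift (hY b) (by omega) j).diffFieldAt
  have hsum : ∀ s : Finset (Fin (r + 1)),
      DiffFieldAt (∑ b ∈ s, vectorLift r ((r : ℤ) - (b : ℕ)) (Y b)) j ∧
      D₁ (∑ b ∈ s, vectorLift r ((r : ℤ) - (b : ℕ)) (Y b)) j =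
        D₂ (∑ b ∈ s, vectorLift r ((r : ℤ) - (b : ℕ)) (Y b)) j := by
    classical
    intro s
    induction s using Finset.induction_on with
    | empty =>
      have h0 : DiffFieldAt (0 : VField (Fin (r + 1) → E) (JetBundle E M r)) j :=
        ((Bundle.contMDiff_zeroSection ℝ (TangentSpace 𝓘(ℝ, Fin (r + 1) → E))).mdifferentiable
          (n := ∞) (by simp)) j
      refine ⟨h0, ?_⟩
      rw [Finset.sum_empty, D₁.isCovariantDerivativeOnUniv.zero,
        D₂.isCovariantDerivativeOnUniv.zero]
    | insert b s hb ih =>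
      rw [Finset.sum_insert hb]
      refine ⟨mdifferentiableAt_add_section (hYd b) ih.1, ?_⟩
      rw [D₁.isCovariantDerivativeOnUniv.add (hYd b) ih.1,
        D₂.isCovariantDerivativeOnUniv.add (hYd b) ih.1, ih.2]
      congr 1
      ext1 U
      obtain ⟨X, hX, -, hU⟩ := exists_eq_sum_vectorLift j U
      rw [hU, map_sum, map_sum]
      exact Finset.sum_congr rfl fun a _ => h (X a) (Y b) (hX a) (hY b) a b j
  refine conn_eq_of_pointwise hW (hsum Finset.univ).1 ?_ (hsum Finset.univ).2
  rw [hWY, Finset.sum_apply]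

/-- The complete lift of a connection is determined by its characterizing property. -/
theorem IsCompleteLift.connEq {D : AffineConnection E M}
    {D₁ D₂ : AffineConnection (Fin (r + 1) → E) (JetBundle E M r)}
    (h₁ : IsCompleteLift r D D₁) (h₂ : IsCompleteLift r D D₂) : ConnEq D₁ D₂ := by
  refine connEq_of_vectorLift fun X Y hX hY a b j => ?_
  have key : ∀ c : Fin (r + 1), (r : ℤ) - (c : ℕ) = ((r - c : ℕ) : ℤ) := fun c => by omega
  rw [key a, key b, h₁ X Y hX hY _ _ (by omega) (by omega) j,
    h₂ X Y hX hY _ _ (by omega) (by omega) j]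

end ConnLift

/-! ### Torsion and curvature of complete lifts -/

section CurvatureMultilinear

variable {F : Type*} [NormedAddCommGroup F] [NormedSpace ℝ F] [FiniteDimensional ℝ F]
  [CompleteSpace F] {N : Type*} [TopologicalSpace N] [ChartedSpace F N] [IsManifold 𝓘(ℝ, F) ∞ N]

/-- Trilinearity of the curvature tensor. -/
theorem curvature_sum {D : AffineConnection F N} {x : N}
    (hΓ : ContMDiffAt 𝓘(ℝ, F) 𝓘(ℝ, F →L[ℝ] F →L[ℝ] F) ∞ (connComponents D x) x) {ι : Type*}
    (s : Finset ι) (u v w : ι → TangentSpace 𝓘(ℝ, F) x) :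
    curvature D x (∑ a ∈ s, u a) (∑ b ∈ s, v b) (∑ c ∈ s, w c) =
      ∑ a ∈ s, ∑ b ∈ s, ∑ c ∈ s, curvature D x (u a) (v b) (w c) := by
  have h1 : ∀ (u : ι → F) (v w : F), curvatureComponents D x x (∑ a ∈ s, u a) v w =
      ∑ a ∈ s, curvatureComponents D x x (u a) v w := by
    intro u v w
    simp only [curvatureComponents, map_sum, sum_apply, Finset.sum_add_distrib,
      Finset.sum_sub_distrib]
  have h2 : ∀ (u : F) (v : ι → F) (w : F), curvatureComponents D x x u (∑ a ∈ s, v a) w =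
      ∑ a ∈ s, curvatureComponents D x x u (v a) w := by
    intro u v w
    simp only [curvatureComponents, map_sum, sum_apply, Finset.sum_add_distrib,
      Finset.sum_sub_distrib]
  have h3 : ∀ (u v : F) (w : ι → F), curvatureComponents D x x u v (∑ a ∈ s, w a) =
      ∑ a ∈ s, curvatureComponents D x x u v (w a) := by
    intro u v w
    simp only [curvatureComponents, map_sum, sum_apply, Finset.sum_add_distrib,
      Finset.sum_sub_distrib]
  apply tangentCoord_injective (mem_chart_source F x)
  rw [tangentCoord_curvature D hΓ, map_sum, map_sum, map_sum, h1]
  simp only [h2, h3, map_sum, tangentCoord_curvature D hΓ]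

end CurvatureMultilinear

section TensorLift

variable {E : Type*} [NormedAddCommGroup E] [NormedSpace ℝ E] [FiniteDimensional ℝ E]
  {M : Type*} [TopologicalSpace M] [ChartedSpace E M] [IsManifold 𝓘(ℝ, E) ∞ M] [T2Space M]
  {r : ℕ}

/-- The complete lift of a tensor field as a sum of lifts of vector fields. -/
theorem tensorLift_eq_sum {p : ℕ}
    (K : Π x : M, (Fin p → TangentSpace 𝓘(ℝ, E) x) → TangentSpace 𝓘(ℝ, E) x)
    (j : JetBundle E M r) (U : Fin p → TangentSpace 𝓘(ℝ, Fin (r + 1) → E) j) :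
    tensorLift r K j U = ∑ ν : Fin p → Fin (r + 1),
      vectorLift r ((r : ℤ) - ∑ i, ((ν i : ℕ) : ℤ))
        (fun y => K y fun i => coordVector j.proj y (tangentCoord j j (U i) (ν i))) j := by
  have hjj := mem_chart_source (Fin (r + 1) → E) j
  refine tangentCoord_injective hjj (funext fun κ => ?_)
  rw [tensorLift, tangentCoord_coordVector hjj, map_sum, Finset.sum_apply]
  refine Finset.sum_congr rfl fun ν _ => ?_
  rw [tangentCoord_vectorLift_self, functionLift,
    show ((κ : ℕ) : ℤ) + ((r : ℤ) - ∑ i, ((ν i : ℕ) : ℤ)) - r =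
      (κ : ℕ) - ∑ i, ((ν i : ℕ) : ℤ) by ring]
  rfl

theorem tensorLift_of_eq_zero {p : ℕ}
    {K : Π x : M, (Fin p → TangentSpace 𝓘(ℝ, E) x) → TangentSpace 𝓘(ℝ, E) x}
    (hK : ∀ x w, K x w = 0) (j : JetBundle E M r)
    (U : Fin p → TangentSpace 𝓘(ℝ, Fin (r + 1) → E) j) : tensorLift r K j U = 0 := by
  rw [tensorLift_eq_sum]
  simp only [hK, vectorLift_zero, Finset.sum_const_zero]

theorem sum_fin_two_arrow {A : Type*} [AddCommMonoid A] {ι : Type*} [Fintype ι]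
    (f : ι → ι → A) : ∑ ν : Fin 2 → ι, f (ν 0) (ν 1) = ∑ a, ∑ b, f a b := by
  rw [← Fintype.sum_prod_type']
  exact Fintype.sum_equiv (finTwoArrowEquiv ι) _ _ fun ν => rfl

theorem sum_fin_three_arrow {A : Type*} [AddCommMonoid A] {ι : Type*} [Fintype ι]
    (f : ι → ι → ι → A) :
    ∑ ν : Fin 3 → ι, f (ν 0) (ν 1) (ν 2) = ∑ a, ∑ b, ∑ c, f a b c := by
  rw [← Fintype.sum_equiv (Fin.consEquiv fun _ : Fin 3 => ι)
    (fun q : ι × (Fin 2 → ι) => f q.1 (q.2 0) (q.2 1)) _ fun q => rfl, Fintype.sum_prod_type]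
  exact Finset.sum_congr rfl fun a _ => sum_fin_two_arrow (f a)

variable [CompleteSpace E]

/-- The torsion of the complete lift is the complete lift of the torsion. -/
theorem torsion_connLift {D : AffineConnection E M} (hD : D.ContMDiffCovariantDerivative ∞)
    (j : JetBundle E M r) (U V : TangentSpace 𝓘(ℝ, Fin (r + 1) → E) j) :
    (connLift r D).torsion j U V =
      tensorLift r (fun x w => D.torsion x (w 0) (w 1)) j ![U, V] := by
  have hj := mem_chart_source E j.proj
  obtain ⟨X, hX, hXu, hU⟩ := exists_eq_sum_vectorLift j U
  obtain ⟨Y, hY, hYv, hV⟩ := exists_eq_sum_vectorLift j V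
  have hXs : ∀ (Z : VField E M) (a : Fin (r + 1)), SmoothField Z →
      DiffFieldAt (vectorLift r ((r : ℤ) - (a : ℕ)) Z) j := fun Z a hZ =>
    (smoothFieldAt_vectorLift hZ (by omega) j).diffFieldAt
  have key : ∀ a b : Fin (r + 1), (connLift r D).torsion j
      (vectorLift r ((r : ℤ) - (a : ℕ)) (X a) j) (vectorLift r ((r : ℤ) - (b : ℕ)) (Y b) j) =
      vectorLift r ((r : ℤ) - ((a : ℕ) + (b : ℕ))) (fun y => D.torsion y
        (coordVector j.proj y (tangentCoord j j U a)) (coordVector j.proj y (tangentCoord j j V b)))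
        j := by
    intro a b
    rw [(connLift r D).torsion_apply (hXs _ a (hX a)) (hXs _ b (hY b)),
      mlieBracket_vectorLift (hXu a) (hYv b) a b, sub_zero,
      connLift_vectorLift hD (hX a) (hY b) (by omega) (by omega),
      connLift_vectorLift hD (hY b) (hX a) (by omega) (by omega),
      show (r : ℤ) - (b : ℕ) + (r - (a : ℕ)) - r = r - ((a : ℕ) + (b : ℕ)) by ring,
      show (r : ℤ) - (a : ℕ) + (r - (b : ℕ)) - r = r - ((a : ℕ) + (b : ℕ)) by ring,
      ← vectorLift_sub (((hX a).conn hD (hY b)) _) (((hY b).conn hD (hX a)) _)]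
    refine vectorLift_congr ?_ _
    filter_upwards [eventually_eventually_nhds.2 (hXu a), eventually_eventually_nhds.2 (hYv b),
      chart_mem_nhds j.proj hj] with y hy1 hy2 hy
    rw [← hy1.self_of_nhds, ← hy2.self_of_nhds,
      D.torsion_apply ((hX a).diffFieldAt y) ((hY b).diffFieldAt y),
      mlieBracket_eq_zero hy hy1 hy2, sub_zero]
  rw [tensorLift_eq_sum]
  have h1 : (connLift r D).torsion j U V = ∑ a : Fin (r + 1), ∑ b : Fin (r + 1),
      (connLift r D).torsion j (vectorLift r ((r : ℤ) - (a : ℕ)) (X a) j)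
        (vectorLift r ((r : ℤ) - (b : ℕ)) (Y b) j) := by
    conv_lhs => rw [hU, hV]
    rw [map_sum, Finset.sum_comm]
    refine Finset.sum_congr rfl fun b _ => ?_
    rw [map_sum, sum_apply]
  rw [h1]
  simp only [key]
  rw [← sum_fin_two_arrow]
  refine Finset.sum_congr rfl fun ν _ => ?_
  rw [Fin.sum_univ_two]
  rfl

theorem torsion_connLift_eq_zero {D : AffineConnection E M}
    (hD : D.ContMDiffCovariantDerivative ∞) (h : D.torsion = 0) : (connLift r D).torsion = 0 := by
  ext j U V
  rw [torsion_connLift hD, tensorLift_of_eq_zero fun x w => ?_]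
  · rfl
  · rw [h]
    rfl

/-- The curvature of the complete lift is the complete lift of the curvature. -/
theorem curvature_connLift {D : AffineConnection E M} (hD : D.ContMDiffCovariantDerivative ∞)
    (j : JetBundle E M r) (U V W : TangentSpace 𝓘(ℝ, Fin (r + 1) → E) j) :
    curvature (connLift r D) j U V W =
      tensorLift r (fun x w => curvature D x (w 0) (w 1) (w 2)) j ![U, V, W] := by
  have hj := mem_chart_source E j.proj
  have hΓ := contMDiffAt_connComponents_connLift hD j
  obtain ⟨X, hX, hXu, hU⟩ := exists_eq_sum_vectorLift j U
  obtain ⟨Y, hY, hYv, hV⟩ := exists_eq_sum_vectorLift j V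
  obtain ⟨Z, hZ, hZw, hW⟩ := exists_eq_sum_vectorLift j W
  have hs : ∀ (Z : VField E M) (a : Fin (r + 1)), SmoothField Z →
      SmoothFieldAt (vectorLift r ((r : ℤ) - (a : ℕ)) Z) j := fun Z a hZ =>
    smoothFieldAt_vectorLift hZ (by omega) j
  -- The rule for `∇^c`, applied twice.
  have hlift : ∀ {X Y Z : VField E M}, SmoothField X → SmoothField Y → SmoothField Z →
      ∀ a b c : Fin (r + 1), connLift r D (fun j' => connLift r D
        (vectorLift r ((r : ℤ) - (c : ℕ)) Z) j' (vectorLift r ((r : ℤ) - (b : ℕ)) Y j')) j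
        (vectorLift r ((r : ℤ) - (a : ℕ)) X j) =
      vectorLift r ((r : ℤ) - ((a : ℕ) + (b : ℕ) + (c : ℕ)))
        (fun x => D (fun y => D Z y (Y y)) x (X x)) j := by
    intro X Y Z hX hY hZ a b c
    have h1 : (fun j' => connLift r D (vectorLift r ((r : ℤ) - (c : ℕ)) Z) j'
        (vectorLift r ((r : ℤ) - (b : ℕ)) Y j')) =
        vectorLift r ((r : ℤ) - (b : ℕ) + (r - (c : ℕ)) - r) fun y => D Z y (Y y) :=
      funext fun j' => connLift_vectorLift hD hY hZ (by omega) (by omega) j'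
    rw [h1, connLift_vectorLift hD hX (hY.conn hD hZ) (by omega) (by omega)]
    congr 1
    ring
  have key : ∀ a b c : Fin (r + 1), curvature (connLift r D) j
      (vectorLift r ((r : ℤ) - (a : ℕ)) (X a) j) (vectorLift r ((r : ℤ) - (b : ℕ)) (Y b) j)
      (vectorLift r ((r : ℤ) - (c : ℕ)) (Z c) j) =
      vectorLift r ((r : ℤ) - ((a : ℕ) + (b : ℕ) + (c : ℕ))) (fun y => curvature D y
        (coordVector j.proj y (tangentCoord j j U a)) (coordVector j.proj y (tangentCoord j j V b))
        (coordVector j.proj y (tangentCoord j j W c))) j := by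
    intro a b c
    rw [curvature_eq_curvatureField (connLift r D) hΓ (hs _ a (hX a)) (hs _ b (hY b))
      (hs _ c (hZ c)), curvatureField, mlieBracket_vectorLift (hXu a) (hYv b) a b, map_zero,
      sub_zero, hlift (hX a) (hY b) (hZ c), hlift (hY b) (hX a) (hZ c),
      add_comm ((b : ℕ) : ℤ) ((a : ℕ) : ℤ),
      ← vectorLift_sub (((hX a).conn hD ((hY b).conn hD (hZ c))) _)
        (((hY b).conn hD ((hX a).conn hD (hZ c))) _)]
    refine vectorLift_congr ?_ _
    filter_upwards [eventually_eventually_nhds.2 (hXu a), eventually_eventually_nhds.2 (hYv b),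
      hZw c, chart_mem_nhds j.proj hj] with y hy1 hy2 hy3 hy
    rw [← hy1.self_of_nhds, ← hy2.self_of_nhds, ← hy3, curvature_eq_curvatureField D
      (contMDiffAt_connComponents hD (mem_chart_source E y)) (hX a y) (hY b y) (hZ c y),
      curvatureField, mlieBracket_eq_zero hy hy1 hy2, map_zero, sub_zero]
  rw [tensorLift_eq_sum]
  conv_lhs => rw [hU, hV, hW]
  rw [curvature_sum hΓ]
  simp only [key]
  rw [← sum_fin_three_arrow]
  refine Finset.sum_congr rfl fun ν _ => ?_
  rw [Fin.sum_univ_three]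
  rfl

end TensorLift

/-! ### Metrics and pairs of connections -/

section Duality

variable {F : Type*} [NormedAddCommGroup F] [NormedSpace ℝ F]
  {N : Type*} [TopologicalSpace N] [ChartedSpace F N] [IsManifold 𝓘(ℝ, F) ∞ N]

theorem IsPseudoRiemannian.mdifferentiableAt_apply {g : BilinField F N}
    (hg : IsPseudoRiemannian g) {y : N} {Y Z : VField F N} (hY : DiffFieldAt Y y)
    (hZ : DiffFieldAt Z y) :
    MDifferentiableAt 𝓘(ℝ, F) 𝓘(ℝ, ℝ) (fun z => g z (Y z) (Z z)) y := by
  have h1 := MDifferentiableAt.clm_bundle_apply₂ (E₃ := fun _ : N => ℝ) (F₃ := ℝ)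
    ((hg.smooth.contMDiffAt (x := y)).mdifferentiableAt (by simp)) hY hZ
  exact ((mdifferentiableAt_totalSpace _ _).1 h1).2

/-- The obstruction `v (g(Y, Z)) - g(D'_v Y, Z) - g(Y, D_v Z)` to the duality of `D` and `D'`.  For
`D' = D` it is the covariant derivative of `g`. -/
noncomputable def dualityDefect (g : BilinField F N) (D D' : AffineConnection F N) (x : N)
    (v : TangentSpace 𝓘(ℝ, F) x) (Y Z : VField F N) : ℝ :=
  derivMetric g x v Y Z - g x (D' Y x v) (Z x) - g x (Y x) (D Z x v)

theorem nablaMetric_eq_dualityDefect (g : BilinField F N) (D : AffineConnection F N) (x : N)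
    (v : TangentSpace 𝓘(ℝ, F) x) (Y Z : VField F N) :
    nablaMetric g D x v Y Z = dualityDefect g D D x v Y Z := rfl

theorem isDualConnection_iff {g : BilinField F N} {D D' : AffineConnection F N} :
    IsDualConnection g D D' ↔ ∀ (x : N) (v : TangentSpace 𝓘(ℝ, F) x) (Y Z : VField F N),
      DiffFieldAt Y x → DiffFieldAt Z x → dualityDefect g D D' x v Y Z = 0 := by
  refine forall₄_congr fun x v Y Z => forall₂_congr fun _ _ => ?_
  rw [dualityDefect]
  constructor <;> intro h <;> linarith

/-- The two derivatives of a factor `f`, from `v (f g(Y, Z))` and from `D'_v (f Y)`, cancel. -/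
theorem tensorialAt_dualityDefect_left {g : BilinField F N} (hg : IsPseudoRiemannian g)
    (D D' : AffineConnection F N) (x : N) (v : TangentSpace 𝓘(ℝ, F) x) (Z : VField F N)
    (hZ : DiffFieldAt Z x) :
    TensorialAt 𝓘(ℝ, F) F (fun Y => dualityDefect g D D' x v Y Z) x := by
  refine ⟨fun {f Y} hf hY => ?_, fun {Y Y'} hY hY' => ?_⟩
  · have h1 : (fun y => g y ((f • Y) y) (Z y)) = f • fun y => g y (Y y) (Z y) := by
      funext y
      simp
    rw [dualityDefect, derivMetric, h1, mvfderiv_smul hf (hg.mdifferentiableAt_apply hY hZ),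
      D'.isCovariantDerivativeOnUniv.leibniz hY hf, dualityDefect, derivMetric]
    simp
    ring
  · have h1 : (fun y => g y ((Y + Y') y) (Z y)) =
        (fun y => g y (Y y) (Z y)) + fun y => g y (Y' y) (Z y) := by
      funext y
      simp
    rw [dualityDefect, derivMetric, h1, mvfderiv_add (hg.mdifferentiableAt_apply hY hZ)
      (hg.mdifferentiableAt_apply hY' hZ), D'.isCovariantDerivativeOnUniv.add hY hY',
      dualityDefect, derivMetric, dualityDefect, derivMetric]
    simp
    ring

theorem tensorialAt_dualityDefect_right {g : BilinField F N} (hg : IsPseudoRiemannian g)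
    (D D' : AffineConnection F N) (x : N) (v : TangentSpace 𝓘(ℝ, F) x) (Y : VField F N)
    (hY : DiffFieldAt Y x) :
    TensorialAt 𝓘(ℝ, F) F (fun Z => dualityDefect g D D' x v Y Z) x := by
  refine ⟨fun {f Z} hf hZ => ?_, fun {Z Z'} hZ hZ' => ?_⟩
  · have h1 : (fun y => g y (Y y) ((f • Z) y)) = f • fun y => g y (Y y) (Z y) := by
      funext y
      simp
    rw [dualityDefect, derivMetric, h1, mvfderiv_smul hf (hg.mdifferentiableAt_apply hY hZ),
      D.isCovariantDerivativeOnUniv.leibniz hZ hf, dualityDefect, derivMetric]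
    simp
    ring
  · have h1 : (fun y => g y (Y y) ((Z + Z') y)) =
        (fun y => g y (Y y) (Z y)) + fun y => g y (Y y) (Z' y) := by
      funext y
      simp
    rw [dualityDefect, derivMetric, h1, mvfderiv_add (hg.mdifferentiableAt_apply hY hZ)
      (hg.mdifferentiableAt_apply hY hZ'), D.isCovariantDerivativeOnUniv.add hZ hZ',
      dualityDefect, derivMetric, dualityDefect, derivMetric]
    simp
    ring

theorem dualityDefect_sum_vector (g : BilinField F N) (D D' : AffineConnection F N) {x : N}
    {ι : Type*} (s : Finset ι) (v : ι → TangentSpace 𝓘(ℝ, F) x) (Y Z : VField F N) :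
    dualityDefect g D D' x (∑ a ∈ s, v a) Y Z = ∑ a ∈ s, dualityDefect g D D' x (v a) Y Z := by
  simp only [dualityDefect, derivMetric, map_sum, sum_apply, Finset.sum_sub_distrib]

variable [FiniteDimensional ℝ F]

/-- The defect of duality is a tensor: it may be computed after decomposing the vectors involved
into sums of values of differentiable fields. -/
theorem dualityDefect_eq_sum {g : BilinField F N} (hg : IsPseudoRiemannian g)
    (D D' : AffineConnection F N) {x : N} {ι : Type*} {s : Finset ι}
    {v : TangentSpace 𝓘(ℝ, F) x} {Y Z : VField F N} (hY : DiffFieldAt Y x) (hZ : DiffFieldAt Z x)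
    {X' : ι → TangentSpace 𝓘(ℝ, F) x} {Y' Z' : ι → VField F N} (hY' : ∀ b, DiffFieldAt (Y' b) x)
    (hZ' : ∀ c, DiffFieldAt (Z' c) x) (hvX : v = ∑ a ∈ s, X' a) (hYY : Y x = ∑ b ∈ s, Y' b x)
    (hZZ : Z x = ∑ c ∈ s, Z' c x) :
    dualityDefect g D D' x v Y Z =
      ∑ a ∈ s, ∑ b ∈ s, ∑ c ∈ s, dualityDefect g D D' x (X' a) (Y' b) (Z' c) := by
  rw [hvX, dualityDefect_sum_vector]
  refine Finset.sum_congr rfl fun a _ => ?_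
  have h1 := fun Z hZ => tensorialAt_dualityDefect_left hg D D' x (X' a) Z hZ
  have h2 := fun Y hY => tensorialAt_dualityDefect_right hg D D' x (X' a) Y hY
  rw [← TensorialAt.mkHom₂_apply (Φ := dualityDefect g D D' x (X' a)) h1 h2 hY hZ, hYY, hZZ,
    map_sum, Finset.sum_comm]
  refine Finset.sum_congr rfl fun c _ => ?_
  rw [map_sum, sum_apply]
  exact Finset.sum_congr rfl fun b _ => TensorialAt.mkHom₂_apply h1 h2 (hY' b) (hZ' c)

theorem exists_diffFieldAt_eq {x : N} (v : TangentSpace 𝓘(ℝ, F) x) :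
    ∃ Y : VField F N, DiffFieldAt Y x ∧ Y x = v :=
  ⟨_, (smoothFieldAt_coordVector (mem_chart_source F x) (tangentCoord x x v)).diffFieldAt,
    coordVector_tangentCoord (mem_chart_source F x) v⟩

/-- The dual connection is unique. -/
theorem IsDualConnection.connEq {g : BilinField F N} (hg : IsPseudoRiemannian g)
    {D D₁ D₂ : AffineConnection F N} (h₁ : IsDualConnection g D D₁)
    (h₂ : IsDualConnection g D D₂) : ConnEq D₁ D₂ := by
  intro x Y hY
  ext1 v
  refine sub_eq_zero.1 (hg.nondegenerate x _ fun w => ?_)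
  obtain ⟨Z, hZ, rfl⟩ := exists_diffFieldAt_eq w
  rw [map_sub, sub_apply, h₁ x v Y Z hY hZ, h₂ x v Y Z hY hZ, sub_self]

variable [CompleteSpace F]

theorem ConnEq.torsion_eq {D D' : AffineConnection F N} (h : ConnEq D D') :
    D.torsion = D'.torsion := by
  ext x u v
  obtain ⟨X, hX, rfl⟩ := exists_diffFieldAt_eq u
  obtain ⟨Y, hY, rfl⟩ := exists_diffFieldAt_eq v
  rw [D.torsion_apply hX hY, D'.torsion_apply hX hY, h x X hX, h x Y hY]

/-- The Levi-Civita connection is unique: the difference of two such connections is a tensor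
`S(v, w)` which is symmetric, while `g(S(v, w), z)` is skew in `w` and `z`. -/
theorem IsLeviCivita.connEq {g : BilinField F N} (hg : IsPseudoRiemannian g)
    {D₁ D₂ : AffineConnection F N} (h₁ : IsLeviCivita g D₁) (h₂ : IsLeviCivita g D₂) :
    ConnEq D₁ D₂ := by
  intro x Y hY
  have hx := mem_chart_source F x
  set e : TangentSpace 𝓘(ℝ, F) x → VField F N := fun v y => coordVector x y (tangentCoord x x v)
    with he
  have hed : ∀ v, DiffFieldAt (e v) x := fun v => (smoothFieldAt_coordVector hx _).diffFieldAt
  have hev : ∀ v, e v x = v := fun v => coordVector_tangentCoord hx v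
  set A : TangentSpace 𝓘(ℝ, F) x → TangentSpace 𝓘(ℝ, F) x → TangentSpace 𝓘(ℝ, F) x → ℝ :=
    fun v w z => g x (D₁ (e w) x v) z - g x (D₂ (e w) x v) z with hA
  have hsymm : ∀ v w z, A v w z = A w v z := by
    intro v w z
    have key : ∀ D : AffineConnection F N, D.torsion = 0 → D (e w) x v = D (e v) x w := by
      intro D hD
      have h := D.torsion_apply (hed v) (hed w)
      rw [hD, hev, hev, mlieBracket_coordVector hx, sub_zero] at h
      exact (sub_eq_zero.1 h.symm)
    simp only [hA]
    rw [key D₁ h₁.1, key D₂ h₂.1]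
  have hskew : ∀ v w z, A v w z = -A v z w := by
    intro v w z
    have k₁ := h₁.2 x v (e w) (e z) (hed w) (hed z)
    have k₂ := h₂.2 x v (e w) (e z) (hed w) (hed z)
    rw [nablaMetric, hev, hev] at k₁ k₂
    simp only [hA]
    rw [hg.symm x _ w, hg.symm x _ w]
    linarith
  have hzero : ∀ v w z, A v w z = 0 := by
    intro v w z
    -- Exchanging arguments six times in turn returns to `A v w z`, with the opposite sign.
    have := hskew v w z
    have := hsymm v z w
    have := hskew z v w
    have := hsymm z w v
    have := hskew w z v
    have := hsymm w v z
    linarith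
  refine conn_eq_of_pointwise hY (hed (Y x)) (hev (Y x)).symm ?_
  ext1 v
  refine sub_eq_zero.1 (hg.nondegenerate x _ fun z => ?_)
  rw [map_sub, sub_apply]
  exact hzero v (Y x) z

end Duality

section DualityLift

variable {E : Type*} [NormedAddCommGroup E] [NormedSpace ℝ E] [FiniteDimensional ℝ E]
  {M : Type*} [TopologicalSpace M] [ChartedSpace E M] [IsManifold 𝓘(ℝ, E) ∞ M] [T2Space M]
  {r : ℕ}

theorem contMDiffAt_mvfderiv_apply {f : M → ℝ} {y : M}
    (hf : ∀ᶠ z in 𝓝 y, ContMDiffAt 𝓘(ℝ, E) 𝓘(ℝ, ℝ) ∞ f z) {X : VField E M}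
    (hX : SmoothFieldAt X y) :
    ContMDiffAt 𝓘(ℝ, E) 𝓘(ℝ, ℝ) ∞ (fun z => mvfderiv 𝓘(ℝ, E) f z (X z)) y := by
  have hy := mem_chart_source E y
  have h1 : (fun z => mvfderiv 𝓘(ℝ, E) f z (X z)) =ᶠ[𝓝 y] fun z =>
      fderiv ℝ (f ∘ (chartAt E y).symm) (chartAt E y z) (tangentCoord y z (X z)) := by
    filter_upwards [hf, chart_mem_nhds y hy] with z hz hzs
    exact mvfderiv_eq_fderiv hzs (hz.mdifferentiableAt (by simp)) _
  refine ContMDiffAt.congr_of_eventuallyEq ?_ h1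
  have h2 := (contMDiffAt_iff_chart hy).1 hf.self_of_nhds
  refine ContMDiffAt.clm_apply ?_ ((smoothFieldAt_iff hy).1 hX)
  exact (h2.fderiv_right (m := ∞) (by simp)).contMDiffAt.comp (I' := 𝓘(ℝ, E)) y
    (contMDiffAt_chart hy)

/-- On lifts of vector fields, the defect of duality of complete lifts is the lift of the defect of
duality. -/
theorem dualityDefect_vectorLift {g : BilinField E M} (hg : IsPseudoRiemannian g)
    {D D' : AffineConnection E M} (hD : D.ContMDiffCovariantDerivative ∞)
    (hD' : D'.ContMDiffCovariantDerivative ∞) {X Y Z : VField E M} (hX : SmoothField X)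
    (hY : SmoothField Y) (hZ : SmoothField Z) {l m n : ℤ} (hl : l ≤ r) (hm : m ≤ r) (hn : n ≤ r)
    (j : JetBundle E M r) :
    dualityDefect (metricLift r g) (connLift r D) (connLift r D') j (vectorLift r l X j)
        (vectorLift r m Y) (vectorLift r n Z) =
      functionLift r (l + m + n - 2 * r) (fun y => dualityDefect g D D' y (X y) Y Z) j := by
  have h1 : (fun j' => metricLift r g j' (vectorLift r m Y j') (vectorLift r n Z j')) =
      functionLift r (m + n - r) fun y => g y (Y y) (Z y) :=
    funext fun j' => metricLift_vectorLift hg (hY _) (hZ _) hm hn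
  have hYZ : ∀ y, ContMDiffAt 𝓘(ℝ, E) 𝓘(ℝ, ℝ) ∞ (fun y => g y (Y y) (Z y)) y := fun y =>
    hg.contMDiffAt_apply (hY y) (hZ y)
  have hDY := hX.conn hD' hY
  have hDZ := hX.conn hD hZ
  have hd1 := hg.contMDiffAt_apply (hDY j.proj) (hZ j.proj)
  have hd2 := hg.contMDiffAt_apply (hY j.proj) (hDZ j.proj)
  rw [dualityDefect, derivMetric, h1,
    mvfderiv_functionLift_vectorLift (.of_forall hYZ) (by omega) hl (hX _),
    connLift_vectorLift hD' hX hY hl hm, connLift_vectorLift hD hX hZ hl hn,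
    metricLift_vectorLift hg (hDY _) (hZ _) (by omega) hn,
    metricLift_vectorLift hg (hY _) (hDZ _) hm (by omega),
    show m + n - (r : ℤ) + l - r = l + m + n - 2 * r by ring,
    show l + m - (r : ℤ) + n - r = l + m + n - 2 * r by ring,
    show m + (l + n - (r : ℤ)) - r = l + m + n - 2 * r by ring]
  -- The derivative of `g(Y, Z)` along `X` is smooth.
  have hd0 : ContMDiffAt 𝓘(ℝ, E) 𝓘(ℝ, ℝ) ∞
      (fun y => mvfderiv 𝓘(ℝ, E) (fun z => g z (Y z) (Z z)) y (X y)) j.proj :=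
    contMDiffAt_mvfderiv_apply (.of_forall hYZ) (hX _)
  rw [← functionLift_sub hd0 hd1, ← functionLift_sub (hd0.sub hd1) hd2]
  rfl

/-- The defect of duality of complete lifts is a sum of lifts of the original defect, evaluated on
vector fields of `M`.  Hence it vanishes, or has symmetries, if the original defect does. -/
theorem dualityDefect_lift_eq_sum {g : BilinField E M} (hg : IsPseudoRiemannian g)
    {D D' : AffineConnection E M} (hD : D.ContMDiffCovariantDerivative ∞)
    (hD' : D'.ContMDiffCovariantDerivative ∞) {j : JetBundle E M r}
    {U : TangentSpace 𝓘(ℝ, Fin (r + 1) → E) j} {V W : VField (Fin (r + 1) → E) (JetBundle E M r)}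
    (hV : DiffFieldAt V j) (hW : DiffFieldAt W j) {X Y Z : Fin (r + 1) → VField E M}
    (hX : ∀ a, SmoothField (X a)) (hY : ∀ a, SmoothField (Y a)) (hZ : ∀ a, SmoothField (Z a))
    (hUX : U = ∑ a : Fin (r + 1), vectorLift r ((r : ℤ) - (a : ℕ)) (X a) j)
    (hVY : V j = ∑ a : Fin (r + 1), vectorLift r ((r : ℤ) - (a : ℕ)) (Y a) j)
    (hWZ : W j = ∑ a : Fin (r + 1), vectorLift r ((r : ℤ) - (a : ℕ)) (Z a) j) :
    dualityDefect (metricLift r g) (connLift r D) (connLift r D') j U V W =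
      ∑ a : Fin (r + 1), ∑ b : Fin (r + 1), ∑ c : Fin (r + 1),
        functionLift r ((r : ℤ) - ((a : ℕ) + (b : ℕ) + (c : ℕ)))
          (fun y => dualityDefect g D D' y (X a y) (Y b) (Z c)) j := by
  have hs : ∀ {Z : VField E M} (a : Fin (r + 1)), SmoothField Z →
      DiffFieldAt (vectorLift r ((r : ℤ) - (a : ℕ)) Z) j := fun a hZ =>
    (smoothFieldAt_vectorLift hZ (by omega) j).diffFieldAt
  rw [dualityDefect_eq_sum hg.metricLift (connLift r D) (connLift r D') hV hW
    (Y' := fun b : Fin (r + 1) => vectorLift r ((r : ℤ) - (b : ℕ)) (Y b))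
    (Z' := fun c : Fin (r + 1) => vectorLift r ((r : ℤ) - (c : ℕ)) (Z c))
    (fun b => hs b (hY b)) (fun c => hs c (hZ c)) hUX hVY hWZ]
  refine Finset.sum_congr rfl fun a _ => Finset.sum_congr rfl fun b _ =>
    Finset.sum_congr rfl fun c _ => ?_
  rw [dualityDefect_vectorLift hg hD hD' (hX a) (hY b) (hZ c) (by omega) (by omega) (by omega)]
  congr 1
  ring

/-- Complete lifts of dual connections are dual. -/
theorem IsDualConnection.connLift {g : BilinField E M} (hg : IsPseudoRiemannian g)
    {D D' : AffineConnection E M} (hD : D.ContMDiffCovariantDerivative ∞)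
    (hD' : D'.ContMDiffCovariantDerivative ∞) (h : IsDualConnection g D D') :
    IsDualConnection (metricLift r g) (connLift r D) (connLift r D') := by
  rw [isDualConnection_iff] at h ⊢
  intro j U V W hV hW
  obtain ⟨X, hX, -, hUX⟩ := exists_eq_sum_vectorLift j U
  obtain ⟨Y, hY, -, hVY⟩ := exists_eq_sum_vectorLift j (V j)
  obtain ⟨Z, hZ, -, hWZ⟩ := exists_eq_sum_vectorLift j (W j)
  rw [dualityDefect_lift_eq_sum hg hD hD' hV hW hX hY hZ hUX hVY hWZ]
  refine Finset.sum_eq_zero fun a _ => Finset.sum_eq_zero fun b _ =>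
    Finset.sum_eq_zero fun c _ => ?_
  rw [← functionLift_zero (W := ℝ) j]
  refine functionLift_congr (.of_forall fun y => ?_) _
  exact h y _ _ _ ((hY b).diffFieldAt y) ((hZ c).diffFieldAt y)

/-- The complete lift of a Codazzi coupled connection is Codazzi coupled. -/
theorem IsCodazziCoupled.connLift {g : BilinField E M} (hg : IsPseudoRiemannian g)
    {D : AffineConnection E M} (hD : D.ContMDiffCovariantDerivative ∞)
    (h : IsCodazziCoupled g D) : IsCodazziCoupled (metricLift r g) (connLift r D) := by
  intro j U V W hU hV hW
  obtain ⟨X, hX, -, hUX⟩ := exists_eq_sum_vectorLift j (U j)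
  obtain ⟨Y, hY, -, hVY⟩ := exists_eq_sum_vectorLift j (V j)
  obtain ⟨Z, hZ, -, hWZ⟩ := exists_eq_sum_vectorLift j (W j)
  simp only [nablaMetric_eq_dualityDefect]
  rw [dualityDefect_lift_eq_sum hg hD hD hV hW hX hY hZ hUX hVY hWZ,
    dualityDefect_lift_eq_sum hg hD hD hU hW hY hX hZ hVY hUX hWZ,
    dualityDefect_lift_eq_sum hg hD hD hW hV hX hZ hY hUX hWZ hVY]
  have hM := fun a b c y => h y (X a) (Y b) (Z c) ((hX a).diffFieldAt y) ((hY b).diffFieldAt y)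
    ((hZ c).diffFieldAt y)
  constructor
  · rw [Finset.sum_comm]
    refine Finset.sum_congr rfl fun b _ => Finset.sum_congr rfl fun a _ =>
      Finset.sum_congr rfl fun c _ => ?_
    rw [add_comm ((a : ℕ) : ℤ)]
    exact functionLift_congr (.of_forall fun y => (hM a b c y).1) _
  · refine Finset.sum_congr rfl fun a _ => ?_
    rw [Finset.sum_comm]
    refine Finset.sum_congr rfl fun c _ => Finset.sum_congr rfl fun b _ => ?_
    rw [add_right_comm]
    exact functionLift_congr (.of_forall fun y => (hM a b c y).2) _

/-- The complete lift is compatible with arithmetic means of connections: the mean of the lifts is a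
connection which agrees with the lift of the mean on lifts of vector fields. -/
theorem connLift_eq_half_add {D D' D₀ : AffineConnection E M}
    (hD : D.ContMDiffCovariantDerivative ∞) (hD' : D'.ContMDiffCovariantDerivative ∞)
    (hD₀ : D₀.ContMDiffCovariantDerivative ∞)
    (h : ∀ (x : M) (Y : VField E M), DiffFieldAt Y x →
      D₀ Y x = (1 / 2 : ℝ) • (D Y x + D' Y x)) (j : JetBundle E M r)
    (V : VField (Fin (r + 1) → E) (JetBundle E M r)) (hV : DiffFieldAt V j) :
    connLift r D₀ V j = (1 / 2 : ℝ) • (connLift r D V j + connLift r D' V j) := by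
  let D₂ : AffineConnection (Fin (r + 1) → E) (JetBundle E M r) :=
    ⟨_, (connLift r D).isCovariantDerivativeOnUniv.affine_combination
      (connLift r D').isCovariantDerivativeOnUniv fun _ => (1 / 2 : ℝ)⟩
  have hD₂ : ∀ W j, D₂ W j = (1 / 2 : ℝ) • (connLift r D W j + connLift r D' W j) := by
    intro W j
    change (1 / 2 : ℝ) • connLift r D W j + (1 - 1 / 2 : ℝ) • connLift r D' W j = _
    rw [smul_add]
    norm_num
  rw [← hD₂]
  refine connEq_of_vectorLift (fun X Y hX hY a b j => ?_) j V hV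
  rw [hD₂]
  change _ = (1 / 2 : ℝ) • (connLift r D _ j _ + connLift r D' _ j _)
  rw [connLift_vectorLift hD₀ hX hY (by omega) (by omega),
    connLift_vectorLift hD hX hY (by omega) (by omega),
    connLift_vectorLift hD' hX hY (by omega) (by omega),
    ← vectorLift_add ((hX.conn hD hY) _) ((hX.conn hD' hY) _), ← vectorLift_const_smul]
  refine vectorLift_congr (.of_forall fun y => ?_) _
  exact congrArg (fun L => L (X y)) (h y Y (hY.diffFieldAt y))

end DualityLift

end HigherLift

theorem mainTheorem2 {E : Type*} [NormedAddCommGroup E] [NormedSpace ℝ E] [FiniteDimensional ℝ E]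
    [CompleteSpace E] {M : Type*} [TopologicalSpace M] [T2Space M] [ChartedSpace E M]
    [IsManifold 𝓘(ℝ, E) ∞ M] (r : ℕ) :
    -- the complete lift of a connection is a smooth connection, and the only one with the
    -- characterizing property of the complete lift
    (∀ D : AffineConnection E M, D.ContMDiffCovariantDerivative ∞ →
      (connLift r D).ContMDiffCovariantDerivative ∞ ∧ IsCompleteLift r D (connLift r D) ∧
        ∀ D' : AffineConnection (Fin (r + 1) → E) (JetBundle E M r),
          IsCompleteLift r D D' → ConnEq D' (connLift r D)) ∧
    -- (1)
    (∀ g : BilinField E M, IsPseudoRiemannian g → IsPseudoRiemannian (metricLift r g)) ∧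
    -- (2)
    (∀ D : AffineConnection E M, D.ContMDiffCovariantDerivative ∞ →
      (∀ (j : JetBundle E M r) (U V : TangentSpace 𝓘(ℝ, Fin (r + 1) → E) j),
        (connLift r D).torsion j U V =
          tensorLift r (fun x w => D.torsion x (w 0) (w 1)) j ![U, V]) ∧
      (∀ (j : JetBundle E M r) (U V W : TangentSpace 𝓘(ℝ, Fin (r + 1) → E) j),
        curvature (connLift r D) j U V W =
          tensorLift r (fun x w => curvature D x (w 0) (w 1) (w 2)) j ![U, V, W]) ∧
      (D.torsion = 0 → (connLift r D).torsion = 0) ∧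
      ((∀ x u v w, curvature D x u v w = 0) →
        ∀ j U V W, curvature (connLift r D) j U V W = 0)) ∧
    -- (3)
    (∀ (g : BilinField E M) (D Dst : AffineConnection E M), IsPseudoRiemannian g →
      D.ContMDiffCovariantDerivative ∞ → Dst.ContMDiffCovariantDerivative ∞ →
      IsDualConnection g D Dst →
      IsDualConnection (metricLift r g) (connLift r D) (connLift r Dst) ∧
        ∀ D' : AffineConnection (Fin (r + 1) → E) (JetBundle E M r),
          IsDualConnection (metricLift r g) (connLift r D) D' → ConnEq D' (connLift r Dst)) ∧
    -- (4)
    (∀ (g : BilinField E M) (Dg : AffineConnection E M), IsPseudoRiemannian g →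
      Dg.ContMDiffCovariantDerivative ∞ → IsLeviCivita g Dg →
      IsLeviCivita (metricLift r g) (connLift r Dg) ∧
        ∀ D' : AffineConnection (Fin (r + 1) → E) (JetBundle E M r),
          IsLeviCivita (metricLift r g) D' → ConnEq D' (connLift r Dg)) ∧
    -- (5)
    (∀ (g : BilinField E M) (D Dst Dg : AffineConnection E M), IsPseudoRiemannian g →
      D.ContMDiffCovariantDerivative ∞ → Dst.ContMDiffCovariantDerivative ∞ →
      Dg.ContMDiffCovariantDerivative ∞ → IsDualConnection g D Dst → IsLeviCivita g Dg →
      D.torsion = 0 →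
      (∀ (x : M) (Y : VField E M), DiffFieldAt Y x →
        Dg Y x = (1 / 2 : ℝ) • (D Y x + Dst Y x)) →
      (connLift r D).torsion = 0 ∧
        ∀ D' D'' : AffineConnection (Fin (r + 1) → E) (JetBundle E M r),
          IsDualConnection (metricLift r g) (connLift r D) D' →
          IsLeviCivita (metricLift r g) D'' →
          ∀ (j : JetBundle E M r) (Y : VField (Fin (r + 1) → E) (JetBundle E M r)),
            DiffFieldAt Y j → D'' Y j = (1 / 2 : ℝ) • (connLift r D Y j + D' Y j)) ∧
    -- (6)
    (∀ (g : BilinField E M) (D Dst : AffineConnection E M), IsPseudoRiemannian g →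
      D.ContMDiffCovariantDerivative ∞ → Dst.ContMDiffCovariantDerivative ∞ →
      IsDualistic g D Dst →
      IsDualistic (metricLift r g) (connLift r D) (connLift r Dst) ∧
        ∀ D' : AffineConnection (Fin (r + 1) → E) (JetBundle E M r),
          IsDualConnection (metricLift r g) (connLift r D) D' →
          IsDualistic (metricLift r g) (connLift r D) D') ∧
    -- (7)
    (∀ (g : BilinField E M) (D : AffineConnection E M), IsPseudoRiemannian g →
      D.ContMDiffCovariantDerivative ∞ → D.torsion = 0 → IsCodazziCoupled g D →
      (connLift r D).torsion = 0 ∧ IsCodazziCoupled (metricLift r g) (connLift r D)) := by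
  have hLC : ∀ (g : BilinField E M) (Dg : AffineConnection E M), IsPseudoRiemannian g →
      Dg.ContMDiffCovariantDerivative ∞ → IsLeviCivita g Dg →
      IsLeviCivita (metricLift r g) (connLift r Dg) := by
    intro g Dg hg hDg h
    refine ⟨torsion_connLift_eq_zero hDg h.1, ?_⟩
    -- `∇^g g = 0` means that `∇^g` is its own dual.
    have hself : IsDualConnection g Dg Dg := isDualConnection_iff.2 h.2
    exact isDualConnection_iff.1 (hself.connLift hg hDg hDg)
  refine ⟨fun D hD => ⟨contMDiffCovariantDerivative_connLift hD, isCompleteLift_connLift hD,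
      fun D' h => h.connEq (isCompleteLift_connLift hD)⟩,
    fun g hg => hg.metricLift,
    fun D hD => ⟨torsion_connLift hD, curvature_connLift hD, torsion_connLift_eq_zero hD,
      fun h j U V W => ?_⟩,
    fun g D Dst hg hD hDst h => ⟨h.connLift hg hD hDst,
      fun D' h' => h'.connEq hg.metricLift (h.connLift hg hD hDst)⟩,
    fun g Dg hg hDg h => ⟨hLC g Dg hg hDg h,
      fun D' h' => h'.connEq hg.metricLift (hLC g Dg hg hDg h)⟩,
    fun g D Dst Dg hg hD hDst hDg h hLg htor hmean => ⟨torsion_connLift_eq_zero hD htor,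
      fun D' D'' h' h'' j Y hY => ?_⟩,
    fun g D Dst hg hD hDst h => ?_,
    fun g D hg hD htor h => ⟨torsion_connLift_eq_zero hD htor, h.connLift hg hD⟩⟩
  · rw [curvature_connLift hD]
    exact tensorLift_of_eq_zero (fun x w => h x _ _ _) j _
  · rw [h'.connEq hg.metricLift (h.connLift hg hD hDst) j Y hY,
      h''.connEq hg.metricLift (hLC g Dg hg hDg hLg) j Y hY]
    exact connLift_eq_half_add hD hDst hDg hmean j Y hY
  · have hdual := h.1.connLift (r := r) hg hD hDst
    have h2 := torsion_connLift_eq_zero (r := r) hDst h.2.2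
    refine ⟨⟨hdual, torsion_connLift_eq_zero hD h.2.1, h2⟩, fun D' h' =>
      ⟨h', torsion_connLift_eq_zero hD h.2.1, ?_⟩⟩
    rw [(h'.connEq hg.metricLift hdual).torsion_eq, h2]
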